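/- **Setting.** Consider the coupled nonlinear Schrödinger equation $\mathrm i\mathbf q_t+\tfrac12\mathbf q_{xx}+\mathbf q\mathbf q^\dagger\mathbf q=0$, $\mathbf q=(q_1,q_2)^T$, with the plane wave background $q^{[0]}_n=e^{\mathrm i(b_nx+(2-b_n^2/2)t)}$, $b_1=-b_2>0$, $b_1\neq\frac12$. The equation $1+\sum_{n=1}^2(\chi+b_n)^{-2}=0$ has two pairs of complex-conjugate roots; let $\chi_1,\chi_2$ be representatives of the two pairs, labelled so that $\chi_1^2=-\frac14(\zeta+1)(\zeta+3)$ with $\zeta=\sqrt{1-4b_1^2}>0$ if $b_1<\frac12$, and $\Re\chi_1>0$ if $b_1>\frac12$. They are double roots of the characteristic equation $\big(\chi-2\lambda-\sum_n\frac1{\chi+b_n}\big)\prod_j(\chi+b_j)=0$ at $\lambda=\lambda_l$, where $2\lambda_l=\chi_l-\sum_n\frac1{\chi_l+b_n}$. Let $\lambda_l(\varepsilon)=\lambda_l+\lambda_l^{[2]}\varepsilon^2$ with $\lambda_l^{[2]}\ne0$, and let $\chi_l(\varepsilon)=\chi_l+\sum_{i\ge1}\chi_l^{[i]}\varepsilon^i$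 satisfy the characteristic equation with $\lambda=\lambda_l(\varepsilon)$. Define $S_j$ by $\sum_jS_j(\mathbf z)\varepsilon^j=\exp\sum_{j\ge1}z_j\varepsilon^j$, and define coefficients by $$\mathrm i(\chi_l(\varepsilon)-\lambda_l(\varepsilon))=\sum_j\alpha_{l,j}\varepsilon^j,\qquad \tfrac12\chi_l(\varepsilon)^2-\lambda_l(\varepsilon)^2-2=\sum_j\beta_{l,j}\varepsilon^j,\qquad \ln\frac{\chi_l-\chi_m^*}{\chi_l(\varepsilon)-\chi_m^*}=\sum_{j\ge1}h^{[l,m]}_{1,j}\varepsilon^j,$$ $$\ln\Big(\frac{\chi_l-\chi_m^*}{\chi_l^{[1]}\varepsilon}\,\frac{\chi_l(\varepsilon)-\chi_l}{\chi_l(\varepsilon)-\chi_m^*}\Big)=\sum_{j\ge1}h^{[l,m]}_{2,j}\varepsilon^j,\qquad \ln\frac{\chi_l+b_n}{\chi_l(\varepsilon)+b_n}=\sum_{j\ge1}h^{[l,n]}_{3,j}\varepsilon^j,\qquad \mathbf h_3^{[l,0]}=0.$$ Put $C_{ml}=\chi_m^{[1]}/(\chi_m-\chi_l^*)$, $x^+_{l,j}=\alpha_{l,j}x+\mathrm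 i\beta_{l,j}t+d_{l,j}$, $x^-_{l,j}=(x^+_{l,j})^*$, and choose the internal parameters $d_{l,2j}=0$, $d_{l,2j+1}=\kappa_{l,2j+1}A^{2j+1}$ with constants $\kappa_{l,2j+1}\in\mathbb C$ and a parameter $A>0$. For $N_1,N_2\ge0$ the $[N_1,N_2]$-order rogue wave (RW) solution is $q_n^{[N_1,N_2]}=q_n^{[0]}\tau^{(n)}/\tau^{(0)}$, where $\tau^{(k)}$ $(k=0,1,2)$ is the determinant of the $2\times2$ block matrix with blocks $\big(\tau^{(k,l,m)}_{2i-1,2j-1}\big)_{1\le i\le N_l,1\le j\le N_m}$ and $$\tau^{(k,l,m)}_{i,j}=\frac1{\chi_l^*-\chi_m}\sum_{v=0}^{\min(i,j)}(C_{lm}^*C_{ml})^vS_{i-v}\big(\mathbf x_l^-+(\mathbf h_1^{[l,m]})^*+v(\mathbf h_2^{[l,m]})^*-(\mathbf h_3^{[l,k]})^*\big)S_{j-v}\big(\mathbf x_m^++\mathbf h_1^{[m,l]}+v\mathbf h_2^{[m,l]}+\mathbf h_3^{[m,k]}\big).$$ Let $\Theta_N(z,\boldsymbol\kappa)=\prod_{k=1}^N(2k-1)!!\,\det_{1\le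 i,j\le N}(\varphi_{2i-j})$ be the Adler--Moser polynomial, where $\sum_k\varphi_k\epsilon^k=\exp(z\epsilon+\sum_{j\ge1}\kappa_{2j+1}\epsilon^{2j+1})$ and $\varphi_k=0$ for $k<0$. Assume that $\Theta_{N_1}(\cdot,\boldsymbol\kappa_1)$ and $\Theta_{N_2}(\cdot,\boldsymbol\kappa_2)$ have only simple roots and that, with a constant $c>0$ independent of large $A$, every point $(x,t)$ with $z=\kappa_{1,1}+\mathrm i\chi_1^{[1]}(x+\chi_1t)A^{-1}$, $\Theta_{N_1}(z,\boldsymbol\kappa_1)=0$, has Euclidean distance at least $c$ from every point with $z=\kappa_{2,1}+\mathrm i\chi_2^{[1]}(x+\chi_2t)A^{-1}$, $\Theta_{N_2}(z,\boldsymbol\kappa_2)=0$. **First-order RWs.** Put $$\hat q_{n,l}(x,t)=1+\frac{2\mathrm i}{|\chi_l+b_n|^2}\,\frac{(\Re\chi_l+b_n)(x+t\,\Re\chi_l)-(\Im\chi_l)^2t+\frac{\mathrm i}2}{(x+t\,\Re\chi_l)^2+(\Im\chi_l)^2t^2+\frac1{4(\Im\chi_l)^2}},\qquad \rho_{n,l}=\frac{(\Re\chi_l+b_n)^2}{(\Im\chi_l)^2}.$$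 The first-order RW $\hat q_{n,l}q_n^{[0]}$ is called bright if $\rho_{n,l}\le\frac13$ and its amplitude has exactly one local maximum and two local minima; four-petaled if $\frac13<\rho_{n,l}<3$ and the amplitude has exactly two local maxima and two local minima; dark if $\rho_{n,l}\ge3$ and the amplitude has exactly two local maxima and one local minimum; in each case the maxima lie above and the minima below the background amplitude $1$, to which the amplitude tends at infinity. We say that the pattern of $q_n^{[N_1,N_2]}$ *consists of $\frac{N_1(N_1+1)}2$ RWs of type $T_1$ and $\frac{N_2(N_2+1)}2$ RWs of type $T_2$* if, for $l=1,2$, $\Theta_{N_l}(\cdot,\boldsymbol\kappa_l)$ has exactly $\frac{N_l(N_l+1)}2$ distinct roots, $\hat q_{n,l}q_n^{[0]}$ is of type $T_l$, and the following holds for the centres $(x_{l,0},t_{l,0})$ given by $\mathrm i\chi_l^{[1]}(x_{l,0}+\chi_lt_{l,0})+\Delta_l=(z_{l,0}-\kappa_{l,1})A$, one for each root $z_{l,0}$ of $\Theta_{N_l}(\cdot,\boldsymbol\kappa_l)$, $l=1,2$: - the distance of any two different centres tends to infinity as $A\to\infty$; - for every $R$, uniformly for $(x,t)$ within distance $R$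 of a centre $(x_{l,0},t_{l,0})$, $q_n^{[N_1,N_2]}(x,t)=\hat q_{n,l}(x-x_{l,0},t-t_{l,0})\,q_n^{[0]}(x,t)+\mathcal O(A^{-1})$ as $A\to\infty$; - away from the centres $q_n^{[N_1,N_2]}$ approaches $q_n^{[0]}$: for every $\eta>0$ there are $R,A_0$ with $|q_n^{[N_1,N_2]}(x,t)-q_n^{[0]}(x,t)|\le\eta$ whenever $A\ge A_0$ and $(x,t)$ has distance at least $R$ from all centres. Here $\Delta_l$ is the following constant. Let $\mathbf P$ be the block matrix with entries $$\mathbf P_{(l,i),(m,j)}=\frac1{\chi_l^*-\chi_m}\sum_{v\ge0}\big(C_{lm}^vS_{i-1-v}(\mathbf h_1^{[l,m]}+v\mathbf h_2^{[l,m]})\big)^*\,C_{ml}^vS_{j-1-v}(\mathbf h_1^{[m,l]}+v\mathbf h_2^{[m,l]}),\qquad i,j\ge1,\quad S_j=0\ (j<0).$$ Then $\Delta_l$ is the quotient of two of its $(N_1+N_2)\times(N_1+N_2)$ minors: both use the rows $1,\dots,N_1$ of block $1$ and $1,\dots,N_2$ of block $2$; the denominator uses the same columns, and in the numerator the column $N_l$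 of block $l$ is replaced by the column $N_l+1$ of block $l$. **Statement.** 1. If $0<b_1<\frac12$, then for $n=1,2$ the pattern of $q_n^{[N_1,N_2]}$ consists of $\frac{N_1(N_1+1)}2$ bright RWs and $\frac{N_2(N_2+1)}2$ four-petaled RWs. 2. If $b_1>\frac12$, then the pattern of $q_1^{[N_1,N_2]}$ consists of $\frac{N_1(N_1+1)}2$ four-petaled or dark RWs and $\frac{N_2(N_2+1)}2$ bright RWs, and the pattern of $q_2^{[N_1,N_2]}$ consists of $\frac{N_1(N_1+1)}2$ bright RWs and $\frac{N_2(N_2+1)}2$ four-petaled or dark RWs. -/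

import Mathlib

namespace CNLS

open Complex Filter Topology PowerSeries
open scoped ComplexConjugate

noncomputable section

/-! Component indices `n = 1, 2` and root indices `l = 1, 2` are the elements `0, 1` of `Fin 2`. -/

/-- Wave numbers of the plane wave: `b₁ = b`, `b₂ = -b`. -/
def waveNumber (b : ℝ) (n : Fin 2) : ℝ := (-1) ^ (n : ℕ) * b

/-- The plane wave `q_n^{[0]}(x,t) = exp (i (b_n x + (2 - b_n² / 2) t))` (unit amplitudes). -/
def planeWave (b : ℝ) (n : Fin 2) (p : ℝ × ℝ) : ℂ :=
  exp (I * ((waveNumber b n * p.1 + (2 - waveNumber b n ^ 2 / 2) * p.2 : ℝ) : ℂ))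

/-- Euclidean distance in the `(x,t)`-plane. -/
def planeDist (p r : ℝ × ℝ) : ℝ := Real.sqrt ((p.1 - r.1) ^ 2 + (p.2 - r.2) ^ 2)

/-! ### Schur and Adler--Moser polynomials -/

/-- Schur polynomials, `∑ S_j(z) ε^j = exp (∑_{j ≥ 1} z_j ε^j)`; the value `z 0` is not used. -/
def schur (j : ℕ) (z : ℕ → ℂ) : ℂ :=
  coeff j ((PowerSeries.exp ℂ).subst (PowerSeries.mk fun r => if r = 0 then 0 else z r))

/-- `φ_k(z, κ)`, `∑ φ_k ε^k = exp (z ε + κ_3 ε^3 + κ_5 ε^5 + ⋯)`, and `0` for `k < 0`. -/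
def adlerMoserEntry (κ : ℕ → ℂ) (k : ℤ) (z : ℂ) : ℂ :=
  if k < 0 then 0
  else schur k.toNat fun j => if j = 1 then z else if Odd j then κ j else 0

/-- The Adler--Moser polynomial `Θ_N(z, κ) = c_N det (φ_{2i-j}(z, κ))_{1 ≤ i, j ≤ N}` with
`c_N = ∏_{k=1}^N (2k-1)!!`, as a function of `z`. -/
def adlerMoser (N : ℕ) (κ : ℕ → ℂ) (z : ℂ) : ℂ :=
  (∏ k ∈ Finset.Icc 1 N, (Nat.doubleFactorial (2 * k - 1) : ℂ)) *
    (Matrix.of fun i j : Fin N =>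
      adlerMoserEntry κ (2 * ((i : ℤ) + 1) - ((j : ℤ) + 1)) z).det

/-! ### The fundamental first-order rogue waves and their shapes -/

/-- The first-order rogue wave profile `q̂_{n,l}` attached to the double root `χ = χ_l`. -/
def firstOrder (b : ℝ) (χ : ℂ) (n : Fin 2) (p : ℝ × ℝ) : ℂ :=
  1 + 2 * I / ((‖χ + waveNumber b n‖ ^ 2 : ℝ) : ℂ) *
    (((((χ.re + waveNumber b n) * (p.1 + χ.re * p.2) - χ.im ^ 2 * p.2 : ℝ) : ℂ) + I / 2) /
      (((p.1 + χ.re * p.2) ^ 2 + χ.im ^ 2 * p.2 ^ 2 + 1 / (4 * χ.im ^ 2) : ℝ) : ℂ))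

/-- The ratio `ρ_{n,l} = (Re χ_l + b_n)² / (Im χ_l)²`. -/
def shapeRatio (b : ℝ) (χ : ℂ) (n : Fin 2) : ℝ := (χ.re + waveNumber b n) ^ 2 / χ.im ^ 2

/-- The amplitude of `f` is a localized wave on the background of amplitude `1` with exactly `m`
humps (local maxima, all above the background) and exactly `k` valleys (local minima, all below
the background). -/
structure HasShape (f : ℝ × ℝ → ℂ) (m k : ℕ) : Prop where
  localized : Tendsto (fun p => ‖f p‖) (cocompact (ℝ × ℝ)) (𝓝 1)
  humps : {p | IsLocalMax (fun r => ‖f r‖) p}.encard = m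
  humps_above : ∀ p, IsLocalMax (fun r => ‖f r‖) p → 1 < ‖f p‖
  valleys : {p | IsLocalMin (fun r => ‖f r‖) p}.encard = k
  valleys_below : ∀ p, IsLocalMin (fun r => ‖f r‖) p → ‖f p‖ < 1

/-- Bright (eye-shaped): `ρ ≤ 1/3`; one hump and two valleys. -/
def IsBright (b : ℝ) (χ : ℂ) (n : Fin 2) : Prop :=
  shapeRatio b χ n ≤ 1 / 3 ∧ HasShape (firstOrder b χ n) 1 2

/-- Four-petaled: `1/3 < ρ < 3`; two humps and two valleys. -/
def IsFourPetaled (b : ℝ) (χ : ℂ) (n : Fin 2) : Prop :=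
  1 / 3 < shapeRatio b χ n ∧ shapeRatio b χ n < 3 ∧ HasShape (firstOrder b χ n) 2 2

/-- Dark (anti-eye-shaped): `3 ≤ ρ`; two humps and one valley. -/
def IsDark (b : ℝ) (χ : ℂ) (n : Fin 2) : Prop :=
  3 ≤ shapeRatio b χ n ∧ HasShape (firstOrder b χ n) 2 1

/-- Four-petaled or dark. -/
def IsFourPetaledOrDark (b : ℝ) (χ : ℂ) (n : Fin 2) : Prop :=
  IsFourPetaled b χ n ∨ IsDark b χ n

/-! ### The high-order rogue wave solutions -/

/-- The data of a high-order rogue wave solution. The requirements on them are in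
`Params.Admissible`. -/
structure Params where
  /-- the wave number `b₁` -/
  b : ℝ
  /-- the order `[N₁, N₂]` -/
  N : Fin 2 → ℕ
  /-- the constants `λ_l^{[2]}` -/
  lam2 : Fin 2 → ℂ
  /-- the perturbed roots `χ_l(ε) = χ_l + ∑_{i ≥ 1} χ_l^{[i]} ε^i` -/
  chiSeries : Fin 2 → PowerSeries ℂ
  /-- the constants `κ_{l,j}`, used for odd `j` only -/
  κ : Fin 2 → ℕ → ℂ

namespace Params

variable (P : Params)

/-- The root `χ_l`. -/
def chi (l : Fin 2) : ℂ := constantCoeff (P.chiSeries l)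

/-- `χ_l^{[1]}`. -/
def chi1 (l : Fin 2) : ℂ := coeff 1 (P.chiSeries l)

/-- The spectral parameter `λ_l` at which `χ_l` is a characteristic root. -/
def lam (l : Fin 2) : ℂ := (P.chi l - ∑ n : Fin 2, 1 / (P.chi l + waveNumber P.b n)) / 2

/-- `λ_l(ε) = λ_l + λ_l^{[2]} ε²`. -/
def lamSeries (l : Fin 2) : PowerSeries ℂ := C (P.lam l) + C (P.lam2 l) * X ^ 2

/-- `χ_l(ε) - χ_m^*`. -/
def chiSubConj (l m : Fin 2) : PowerSeries ℂ := P.chiSeries l - C (conj (P.chi m))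

/-- `χ_l(ε) + b_n`. -/
def chiAddWave (l n : Fin 2) : PowerSeries ℂ := P.chiSeries l + C (waveNumber P.b n : ℂ)

/-- `α_{l,j}`: coefficients of `i (χ_l(ε) - λ_l(ε))`. -/
def alpha (l : Fin 2) (j : ℕ) : ℂ := coeff j (C I * (P.chiSeries l - P.lamSeries l))

/-- `β_{l,j}`: coefficients of `χ_l(ε)² / 2 - λ_l(ε)² - 2`. -/
def beta (l : Fin 2) (j : ℕ) : ℂ :=
  coeff j (C (1 / 2 : ℂ) * P.chiSeries l ^ 2 - P.lamSeries l ^ 2 - C (2 : ℂ))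

/-- `h_{1,j}^{[l,m]}`: coefficients of `ln ((χ_l - χ_m^*) / (χ_l(ε) - χ_m^*))`. -/
def h1 (l m : Fin 2) (j : ℕ) : ℂ :=
  coeff j (logOf (C (P.chi l - conj (P.chi m)) * (P.chiSubConj l m)⁻¹))

/-- `h_{2,j}^{[l,m]}`: coefficients of
`ln ((χ_l - χ_m^*) / (χ_l^{[1]} ε) * (χ_l(ε) - χ_l) / (χ_l(ε) - χ_m^*))`. -/
def h2 (l m : Fin 2) (j : ℕ) : ℂ :=
  coeff j (logOf (C ((P.chi l - conj (P.chi m)) / P.chi1 l) *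
    (PowerSeries.mk fun i => coeff (i + 1) (P.chiSeries l)) * (P.chiSubConj l m)⁻¹))

/-- `h_{3,j}^{[l,k]}`: coefficients of `ln ((χ_l + b_n) / (χ_l(ε) + b_n))` for `k = n ∈ {1, 2}`
(here `some n`), and `0` for `k = 0` (here `none`). -/
def h3 (l : Fin 2) (k : Option (Fin 2)) (j : ℕ) : ℂ :=
  match k with
  | none => 0
  | some n => coeff j (logOf (C (P.chi l + waveNumber P.b n) * (P.chiAddWave l n)⁻¹))

/-- `C_{ml} = χ_m^{[1]} / (χ_m - χ_l^*)`. -/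
def cst (m l : Fin 2) : ℂ := P.chi1 m / (P.chi m - conj (P.chi l))

/-- The internal parameters `d_{l,2j+1} = κ_{l,2j+1} A^{2j+1}`, `d_{l,2j} = 0`. -/
def d (A : ℝ) (l : Fin 2) (j : ℕ) : ℂ := if Odd j then P.κ l j * (A : ℂ) ^ j else 0

/-- `x_{l,j}^+ = α_{l,j} x + β_{l,j} i t + d_{l,j}`. -/
def xPlus (A : ℝ) (p : ℝ × ℝ) (l : Fin 2) (j : ℕ) : ℂ :=
  P.alpha l j * p.1 + P.beta l j * I * p.2 + P.d A l j

/-- `τ_{i,j}^{(k,l,m)}`. -/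
def tauEntry (A : ℝ) (p : ℝ × ℝ) (k : Option (Fin 2)) (l m : Fin 2) (i j : ℕ) : ℂ :=
  1 / (conj (P.chi l) - P.chi m) *
    ∑ v ∈ Finset.range (min i j + 1), (conj (P.cst l m) * P.cst m l) ^ v *
      schur (i - v) (fun r => conj (P.xPlus A p l r) + conj (P.h1 l m r) +
        v * conj (P.h2 l m r) - conj (P.h3 l k r)) *
      schur (j - v) (fun r => P.xPlus A p m r + P.h1 m l r + v * P.h2 m l r + P.h3 m k r)

/-- `τ^{(k)}`, the determinant of the block matrix with blocks
`(τ_{2i-1,2j-1}^{(k,l,m)})_{1 ≤ i ≤ N_l, 1 ≤ j ≤ N_m}`. -/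
def tau (A : ℝ) (p : ℝ × ℝ) (k : Option (Fin 2)) : ℂ :=
  (Matrix.of fun r s : (Σ l : Fin 2, Fin (P.N l)) =>
    P.tauEntry A p k r.1 s.1 (2 * r.2 + 1) (2 * s.2 + 1)).det

/-- The component `q_n^{[N₁,N₂]}(x,t) = q_n^{[0]}(x,t) τ^{(n)} / τ^{(0)}`. -/
def solution (n : Fin 2) (A : ℝ) (p : ℝ × ℝ) : ℂ :=
  planeWave P.b n p * (P.tau A p (some n) / P.tau A p none)

/-! ### Positions -/

/-- The set of roots of `Θ_{N_l}(·, κ_l)`. -/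
def roots (l : Fin 2) : Set ℂ := {z | adlerMoser (P.N l) (P.κ l) z = 0}

/-- The point `(x,t)` with `x + χ t = w` (unique when `χ` is not real). -/
def planePoint (χ w : ℂ) : ℝ × ℝ := (w.re - χ.re * (w.im / χ.im), w.im / χ.im)

/-- The point of `B_l` for the root `z`: `z = κ_{l,1} + i χ_l^{[1]} (x + χ_l t) / A`. -/
def rootPoint (A : ℝ) (l : Fin 2) (z : ℂ) : ℝ × ℝ :=
  planePoint (P.chi l) ((z - P.κ l 1) * A / (I * P.chi1 l))

/-- Entry of the (infinite) block matrix whose `(l,m)` block is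
`(χ_l^* - χ_m)⁻¹ P_{lm}^† P_{ml}`, where `P_{ml}` has the entries
`C_{ml}^v S_{j-v}(h_1^{[m,l]} + v h_2^{[m,l]})`; all indices start at `0`. -/
def pEntry (l m : Fin 2) (i j : ℕ) : ℂ :=
  1 / (conj (P.chi l) - P.chi m) *
    ∑ v ∈ Finset.range (min i j + 1),
      conj (P.cst l m ^ v * schur (i - v) fun r => P.h1 l m r + v * P.h2 l m r) *
        (P.cst m l ^ v * schur (j - v) fun r => P.h1 m l r + v * P.h2 m l r)

/-- The `N × N` minor with rows `1, …, N_1; 1, …, N_2` and the columns given by `col`. -/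
def pMinor (col : (Σ l : Fin 2, Fin (P.N l)) → ℕ) : ℂ :=
  (Matrix.of fun r s : (Σ l : Fin 2, Fin (P.N l)) => P.pEntry r.1 s.1 r.2 (col s)).det

/-- The constant `Δ_l`: in the numerator the last column `N_l` of the block `l` is replaced by
the column `N_l + 1`. -/
def delta (l : Fin 2) : ℂ :=
  P.pMinor (fun s => if s.1 = l ∧ (s.2 : ℕ) + 1 = P.N l then s.2 + 1 else s.2) /
    P.pMinor (fun s => s.2)

/-- The centre `(x_{l,0}, t_{l,0})` of the first-order rogue wave attached to the root `z`:
`i χ_l^{[1]} (x_{l,0} + χ_l t_{l,0}) + Δ_l = (z - κ_{l,1}) A`. -/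
def centre (A : ℝ) (l : Fin 2) (z : ℂ) : ℝ × ℝ :=
  planePoint (P.chi l) (((z - P.κ l 1) * A - P.delta l) / (I * P.chi1 l))

/-! ### Standing assumptions -/

/-- The standing assumptions on the data. -/
structure Admissible : Prop where
  b_pos : 0 < P.b
  b_ne : P.b ≠ 1 / 2
  /-- `χ_l` is a double root of the characteristic equation at `λ = λ_l`. -/
  double_root : ∀ l, 1 + ∑ n : Fin 2, 1 / (P.chi l + waveNumber P.b n) ^ 2 = 0
  /-- `χ_1` and `χ_2` represent the two pairs of complex-conjugate double roots. -/
  chi_ne : P.chi 1 ≠ P.chi 0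
  chi_ne_conj : P.chi 1 ≠ conj (P.chi 0)
  /-- Labelling of the two pairs for `b₁ < 1/2`: `χ_1² = -(ζ+1)(ζ+3)/4`, `ζ = √(1 - 4 b₁²)`. -/
  label_small : P.b < 1 / 2 → P.chi 0 ^ 2 =
    ((-((Real.sqrt (1 - 4 * P.b ^ 2) + 1) * (Real.sqrt (1 - 4 * P.b ^ 2) + 3)) / 4 : ℝ) : ℂ)
  /-- Labelling of the two pairs for `b₁ > 1/2`. -/
  label_large : 1 / 2 < P.b → 0 < (P.chi 0).re
  lam2_ne : ∀ l, P.lam2 l ≠ 0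
  /-- `λ_l(ε)`, `χ_l(ε)` satisfy the characteristic equation
  `(χ - 2 λ - ∑_i 1 / (χ + b_i)) ∏_j (χ + b_j) = 0`. -/
  char_eq : ∀ l, (P.chiSeries l - C (2 : ℂ) * P.lamSeries l) *
    (P.chiAddWave l 0 * P.chiAddWave l 1) - P.chiAddWave l 1 - P.chiAddWave l 0 = 0
  /-- All roots of the two Adler--Moser polynomials are simple. -/
  simple_roots : ∀ l, ∀ z ∈ P.roots l, deriv (adlerMoser (P.N l) (P.κ l)) z ≠ 0
  /-- The point sets `B_1` and `B_2` are uniformly separated. -/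
  separated : ∃ c > 0, ∀ᶠ A : ℝ in atTop, ∀ z₁ ∈ P.roots 0, ∀ z₂ ∈ P.roots 1,
    c ≤ planeDist (P.rootPoint A 0 z₁) (P.rootPoint A 1 z₂)

end Params

/-! ### Patterns -/

/-- As `A → ∞`, the family `q A` on the background `q₀` splits into the waves with centres
`centre A i` and profiles `profile i`, where `i` runs through `ι`. -/
structure SplitsInto {ι : Type} (q : ℝ → ℝ × ℝ → ℂ) (q₀ : ℝ × ℝ → ℂ)
    (centre : ℝ → ι → ℝ × ℝ) (profile : ι → ℝ × ℝ → ℂ) : Prop where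
  /-- the centres of different waves move apart -/
  apart : ∀ i j, i ≠ j → Tendsto (fun A => planeDist (centre A i) (centre A j)) atTop atTop
  /-- within distance `O(1)` of a centre, `q` is the first-order wave up to `O(A⁻¹)` -/
  near : ∀ i, ∀ R : ℝ, ∃ K A₀ : ℝ, 0 < A₀ ∧ ∀ A ≥ A₀, ∀ p, planeDist p (centre A i) ≤ R →
    ‖q A p - profile i (p - centre A i) * q₀ p‖ ≤ K * A⁻¹
  /-- away from all centres, `q` approaches the background -/
  away : ∀ η > 0, ∃ R A₀ : ℝ, ∀ A ≥ A₀, ∀ p, (∀ i, R ≤ planeDist p (centre A i)) →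
    ‖q A p - q₀ p‖ ≤ η

/-- For `A ≫ 1` the pattern of `q_n^{[N₁,N₂]}` consists of `N₁(N₁+1)/2` first-order rogue waves of
the type `T₁` (one for each root of `Θ_{N₁}`) and `N₂(N₂+1)/2` first-order rogue waves of the type
`T₂` (one for each root of `Θ_{N₂}`). -/
structure PatternConsistsOf (P : Params) (n : Fin 2) (T₁ T₂ : ℝ → ℂ → Fin 2 → Prop) : Prop where
  count : ∀ l, (P.roots l).encard = (P.N l * (P.N l + 1) / 2 : ℕ)
  splits : SplitsInto (ι := Σ l : Fin 2, P.roots l) (P.solution n) (planeWave P.b n)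
    (fun A i => P.centre A i.1 i.2) (fun i => firstOrder P.b (P.chi i.1) n)
  type_one : T₁ P.b (P.chi 0) n
  type_two : T₂ P.b (P.chi 1) n

end

end CNLS

/-! ### Schur polynomials through their generating series -/

namespace CNLS

open Complex Filter Topology PowerSeries
open scoped ComplexConjugate

noncomputable section

/-! Each τ^{(k)} is a determinant det (G† K H). The matrix K, with entries `pEntry`, does not depend
on (x,t); the blocks of G and H consist of columns of Schur polynomials in x⁺ - h₃ and x⁺ + h₃
(`tau_eq_det_gram`). Unimodular column operations remove the even-indexed arguments, which leaves
the kind of argument that occurs in the Adler–Moser polynomials. If the r-th argument is given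
weight r, the top N × N minor of a block is to leading order A^{N(N+1)/2} times a multiple of Θ_N at
a scaled point. The minor with its last row moved down by one belongs to the derivative of that
polynomial in the same way.

Far from all roots the top minors dominate. Once these are normalized away, the columns tend to unit
columns, so numerator and denominator tend to the same minor of K while their prefactors have
quotient tending to 1 (`tendsto_tau_div`). Near a simple root z of block l the top minor degenerates
but the derivative minor does not. Normalized by the latter, the last column of block l becomes X
e_N + e_{N+1} up to O(1/A), where X is x⁺_{l,1} - A z plus a constant shift from h₃
(`isBigO_minor_quotient`).

It remains to evaluate the determinant of K between such columns. The entries of K are the Taylor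
coefficients of the Cauchy kernel 1 / (χ_l(ε)^* - χ_m(δ)), and this kernel can be expanded along any
sequence of nodes (`cauchyKernel_decomposition`). One choice of nodes reproduces the definition of
`pEntry`. Another, common to rows and columns and with block l last, gives a triangular
factorization L D L† (`exists_triangular_decomposition`). Hence the leading minor is a nonzero
product, and modifying the last column of block l multiplies it by conj(X + Δ_l)(X' + Δ_l) +
|χ_l^{[1]}|² / (4 (Im χ_l)²), with X, X' the row and column values (`det_gram_modCols`). The
quotient of two such expressions is a first-order wave whose centre is shifted by Δ_l.

For the types, a rotation and a scaling bring |q̂|² - 1 to a positive multiple of (y₁² - y₂² + σ) /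
(1 + y₁² + y₂²)² with σ = (1 - ρ) / (1 + ρ), whose extrema are found directly. The value of ρ then
follows from the double-root equation, which is quadratic in χ². -/

/-- The power series `∑_{j ≥ 1} z_j ε^j`. -/
def positiveSeries (z : ℕ → ℂ) : PowerSeries ℂ := PowerSeries.mk fun r => if r = 0 then 0 else z r

/-- The generating series of the Schur polynomials. -/
def schurSeries (z : ℕ → ℂ) : PowerSeries ℂ := PowerSeries.mk fun j => schur j z

@[simp]
theorem constantCoeff_positiveSeries (z : ℕ → ℂ) : constantCoeff (positiveSeries z) = 0 := by
  simp [positiveSeries, ← coeff_zero_eq_constantCoeff_apply]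

theorem hasSubst_positiveSeries (z : ℕ → ℂ) : HasSubst (positiveSeries z) :=
  HasSubst.of_constantCoeff_zero' (constantCoeff_positiveSeries z)

theorem schurSeries_eq (z : ℕ → ℂ) :
    schurSeries z = (PowerSeries.exp ℂ).subst (positiveSeries z) := by
  ext j; simp [schurSeries, schur, positiveSeries]

theorem constantCoeff_schurSeries (z : ℕ → ℂ) : constantCoeff (schurSeries z) = 1 := by
  rw [schurSeries_eq]
  have h := hasSubst_positiveSeries z
  rw [constantCoeff_eq, constantCoeff_subst h, finsum_eq_single _ 0]
  · simp
  · intro n hn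
    rw [← constantCoeff_eq, map_pow, constantCoeff_positiveSeries, zero_pow hn, smul_zero]

@[simp]
theorem schur_zero (z : ℕ → ℂ) : schur 0 z = 1 := by
  have := constantCoeff_schurSeries z
  simpa [← coeff_zero_eq_constantCoeff_apply, schurSeries] using this

/-- Together with constant term 1 this linear equation determines the series. Additivity, the
recursion `schur_succ` and the inversion of the logarithm are read off from it. -/
theorem derivative_schurSeries (z : ℕ → ℂ) :
    d⁄dX ℂ (schurSeries z) = schurSeries z * d⁄dX ℂ (positiveSeries z) := by
  rw [schurSeries_eq, derivative_subst (hasSubst_positiveSeries z), derivative_exp]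

/-- Uniqueness for the linear equation `f' = f g'`. -/
theorem eq_of_derivative_eq_mul {f₁ f₂ g : PowerSeries ℂ}
    (h₁ : d⁄dX ℂ f₁ = f₁ * g) (h₂ : d⁄dX ℂ f₂ = f₂ * g)
    (c₁ : constantCoeff f₁ = 1) (c₂ : constantCoeff f₂ = 1) : f₁ = f₂ := by
  have hne : constantCoeff f₂ ≠ 0 := by simp [c₂]
  have hi : f₂ * f₂⁻¹ = 1 := PowerSeries.mul_inv_cancel _ hne
  -- The quotient of two solutions has derivative zero.
  have key : f₁ * f₂⁻¹ = 1 := by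
    apply derivative.ext
    · rw [Derivation.leibniz, derivative_inv', h₁, h₂, derivative_one]
      simp only [smul_eq_mul]
      linear_combination (-f₁ * f₂⁻¹ * g) * hi
    · simp [c₁, c₂]
  calc f₁ = f₁ * (f₂ * f₂⁻¹) := by rw [hi, mul_one]
    _ = f₁ * f₂⁻¹ * f₂ := by ring
    _ = f₂ := by rw [key, one_mul]

theorem schurSeries_add (z w : ℕ → ℂ) : schurSeries (z + w) = schurSeries z * schurSeries w := by
  apply eq_of_derivative_eq_mul (derivative_schurSeries _) _ (constantCoeff_schurSeries _)
  · simp [constantCoeff_schurSeries]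
  · have : positiveSeries (z + w) = positiveSeries z + positiveSeries w := by
      ext n; simp only [positiveSeries, coeff_mk, map_add, Pi.add_apply]; split_ifs <;> simp
    rw [Derivation.leibniz, derivative_schurSeries, derivative_schurSeries, this, map_add]
    simp only [smul_eq_mul]; ring

theorem schurSeries_nsmul (v : ℕ) (z : ℕ → ℂ) : schurSeries (v • z) = schurSeries z ^ v := by
  induction v with
  | zero =>
    have : schurSeries (0 : ℕ → ℂ) * schurSeries 0 = schurSeries 0 := by
      rw [← schurSeries_add, add_zero]
    have hu : IsUnit (schurSeries (0 : ℕ → ℂ)) := by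
      rw [PowerSeries.isUnit_iff_constantCoeff, constantCoeff_schurSeries]; exact isUnit_one
    rw [zero_smul, pow_zero]
    exact hu.mul_left_cancel (by rw [this, mul_one])
  | succ v ih => rw [succ_nsmul, schurSeries_add, ih, pow_succ]

theorem schur_congr {n : ℕ} {z w : ℕ → ℂ} (h : ∀ r, r ≠ 0 → z r = w r) :
    schur n z = schur n w := by
  have : (fun r => if r = 0 then 0 else z r) = fun r => if r = 0 then 0 else w r := by
    funext r
    split_ifs with hr
    · rfl
    · exact h r hr
  rw [schur, schur, this]

theorem schur_add (n : ℕ) (z w : ℕ → ℂ) :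
    schur n (z + w) = ∑ k ∈ Finset.range (n + 1), schur k z * schur (n - k) w := by
  have := congrArg (coeff n) (schurSeries_add z w)
  rw [coeff_mul, Finset.Nat.sum_antidiagonal_eq_sum_range_succ_mk] at this
  simpa [schurSeries] using this

/-- Coefficient of ε^n in `derivative_schurSeries`. As a recursion it lets conjugation, scaling and
growth bounds be proved by induction on the index. -/
theorem schur_succ (n : ℕ) (z : ℕ → ℂ) :
    ((n : ℂ) + 1) * schur (n + 1) z =
      ∑ k ∈ Finset.range (n + 1), schur k z * (((n - k : ℕ) + 1 : ℂ) * z (n - k + 1)) := by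
  have := congrArg (coeff n) (derivative_schurSeries z)
  rw [coeff_mul, Finset.Nat.sum_antidiagonal_eq_sum_range_succ_mk, coeff_derivative] at this
  simp only [coeff_derivative, schurSeries, positiveSeries, coeff_mk] at this
  rw [mul_comm, this]
  refine Finset.sum_congr rfl fun k _ => ?_
  simp; left; ring

theorem conj_schur (n : ℕ) (z : ℕ → ℂ) : conj (schur n z) = schur n fun r => conj (z r) := by
  induction n using Nat.strong_induction_on with
  | _ n ih =>
    cases n with
    | zero => simp
    | succ n =>
      have hn : ((n : ℂ) + 1) ≠ 0 := Nat.cast_add_one_ne_zero n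
      apply mul_left_cancel₀ hn
      rw [schur_succ, ← Complex.conj_natCast n, ← map_one (starRingEnd ℂ), ← map_add, ← map_mul,
        map_one, schur_succ, map_sum]
      refine Finset.sum_congr rfl fun k hk => ?_
      rw [map_mul, ih k (by simpa using hk)]
      simp

/-- The argument z_r has weight r. The case c = -1 gives the parity statement `schur_odd_eq_zero`,
the case c = A the scaling of the minors. -/
theorem schur_scale (n : ℕ) (c : ℂ) (z : ℕ → ℂ) :
    schur n (fun r => c ^ r * z r) = c ^ n * schur n z := by
  induction n using Nat.strong_induction_on with
  | _ n ih =>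
    cases n with
    | zero => simp
    | succ n =>
      have hn : ((n : ℂ) + 1) ≠ 0 := Nat.cast_add_one_ne_zero n
      apply mul_left_cancel₀ hn
      rw [schur_succ, mul_left_comm, schur_succ, Finset.mul_sum]
      refine Finset.sum_congr rfl fun k hk => ?_
      have hk' : k < n + 1 := by simpa using hk
      rw [ih k hk']
      have : c ^ (n + 1) = c ^ k * c ^ (n - k + 1) := by rw [← pow_add]; congr 1; omega
      rw [this]; ring

/-- A sequence supported on even indices has vanishing odd Schur polynomials. -/
theorem schur_odd_eq_zero {z : ℕ → ℂ} (hz : ∀ r, Odd r → z r = 0) {n : ℕ} (hn : Odd n) :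
    schur n z = 0 := by
  have h := schur_scale n (-1) z
  rw [schur_congr (w := z), hn.neg_one_pow] at h
  · linear_combination h / 2
  · intro r _
    rcases Nat.even_or_odd r with hr | hr
    · simp [hr.neg_one_pow]
    · simp [hz r hr]

theorem schur_single (n : ℕ) (c : ℂ) :
    schur n (fun r => if r = 1 then c else 0) = c ^ n / n.factorial := by
  induction n with
  | zero => simp
  | succ n ih =>
    have hn : ((n : ℂ) + 1) ≠ 0 := Nat.cast_add_one_ne_zero n
    apply mul_left_cancel₀ hn
    rw [schur_succ, Finset.sum_eq_single n]
    · rw [ih, Nat.factorial_succ]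
      have : (n.factorial : ℂ) ≠ 0 := by exact_mod_cast n.factorial_ne_zero
      push_cast; simp; field_simp; ring
    · intro k hk hkn
      have : k < n + 1 := by simpa using hk
      rw [if_neg (by omega)]; simp
    · simp

/-- The exponential of the formal logarithm. -/
theorem schurSeries_coeff_logOf {f : PowerSeries ℂ} (hf : constantCoeff f = 1) :
    schurSeries (fun j => coeff j (logOf f)) = f := by
  have hs : HasSubst (f - 1) := HasSubst.of_constantCoeff_zero' (by simp [hf])
  have hlog : positiveSeries (fun j => coeff j (logOf f)) = logOf f := by
    ext n
    simp only [positiveSeries, coeff_mk]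
    split_ifs with h
    · rw [h, coeff_zero_eq_constantCoeff_apply, constantCoeff_logOf hf]
    · rfl
  have hd : f * d⁄dX ℂ (logOf f) = d⁄dX ℂ f := by
    rw [logOf_eq, derivative_subst hs, map_sub, derivative_one, sub_zero, ← mul_assoc]
    -- Substitution of X = f - 1 into (1 + X) · (log (1 + X))' = 1.
    have : f * (d⁄dX ℂ (log ℂ)).subst (f - 1) = 1 := by
      have h1 : (1 + X : PowerSeries ℂ) * d⁄dX ℂ (log ℂ) = 1 := by
        rw [PowerSeries.deriv_log]
        ext n
        rw [add_mul, one_mul]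
        cases n with
        | zero => simp
        | succ n => simp [coeff_succ_X_mul, coeff_one, pow_succ]
      have h2 := congrArg (fun g => PowerSeries.subst (f - 1) g) h1
      simp only [subst_mul hs, subst_add hs, subst_X hs] at h2
      have h3 : PowerSeries.subst (f - 1) (1 : PowerSeries ℂ) = (1 : PowerSeries ℂ) := by
        rw [← coe_substAlgHom hs, map_one]
      rw [h3] at h2
      simpa using h2
    rw [this, one_mul]
  apply eq_of_derivative_eq_mul (derivative_schurSeries _) _ (constantCoeff_schurSeries _) hf
  rw [hlog, hd]

theorem schur_coeff_logOf {f : PowerSeries ℂ} (hf : constantCoeff f = 1) (n : ℕ) :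
    schur n (fun j => coeff j (logOf f)) = coeff n f := by
  simpa [schurSeries] using congrArg (coeff n) (schurSeries_coeff_logOf hf)

theorem schur_one (z : ℕ → ℂ) : schur 1 z = z 1 := by
  have := schur_succ 0 z
  simpa using this

end

end CNLS

/-! ### Node expansions of the Cauchy kernel -/

namespace CNLS

open Complex Filter Topology PowerSeries
open scoped ComplexConjugate

noncomputable section

/-- Lower--upper decomposition of the Cauchy kernel `κ = 1 / (U - W)` along nodes
`(p_r, q_r)`. -/
theorem cauchyKernel_decomposition {R : Type*} [CommRing R] {κ U W : R} (hκ : κ * (U - W) = 1)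
    (p q a b : ℕ → R) (ha : ∀ r, a r * (U - q r) = 1) (hb : ∀ r, b r * (p r - W) = 1) (M : ℕ) :
    κ = ∑ v ∈ Finset.range M, (p v - q v) *
        (((∏ r ∈ Finset.range v, (U - p r) * a r) * a v) *
          ((∏ r ∈ Finset.range v, (q r - W) * b r) * b v)) +
      (∏ r ∈ Finset.range M, (U - p r) * a r) * (∏ r ∈ Finset.range M, (q r - W) * b r) * κ := by
  induction M with
  | zero => simp
  | succ M ih =>
    -- The identity (U - q)(p - W) = (p - q)(U - W) + (U - p)(q - W), divided by (U - q)(p - W)(U -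
    -- W). Iterating it expands the κ left in the remainder.
    have step : κ = (p M - q M) * (a M * b M) + (U - p M) * a M * ((q M - W) * b M) * κ := by
      linear_combination (a M * b M * (p M - q M)) * hκ - κ * b M * (p M - W) * ha M - κ * hb M
    rw [Finset.sum_range_succ, Finset.prod_range_succ, Finset.prod_range_succ]
    linear_combination ih + (∏ r ∈ Finset.range M, (U - p r) * a r) *
      (∏ r ∈ Finset.range M, (q r - W) * b r) * step

/-- A series in the row variable as a series in both variables. -/
def rowSeries : PowerSeries ℂ →+* PowerSeries (PowerSeries ℂ) := PowerSeries.C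

/-- A series in the column variable as a series in both variables. -/
def colSeries : PowerSeries ℂ →+* PowerSeries (PowerSeries ℂ) := PowerSeries.map PowerSeries.C

/-- Rows live in the inner variable and columns in the outer one, so the column coefficient is
extracted first. -/
theorem coeff_coeff_row_mul_col (a b : ℕ) (f g : PowerSeries ℂ) :
    coeff a (coeff b (rowSeries f * colSeries g)) = coeff a f * coeff b g := by
  simp [rowSeries, colSeries, PowerSeries.coeff_C_mul]

theorem rowSeries_C (c : ℂ) : rowSeries (C c) = colSeries (C c) := by
  simp [rowSeries, colSeries]

theorem coeff_coeff_row_mul_eq_zero {a : ℕ} (b : ℕ) {f : PowerSeries ℂ} {n : ℕ} (h : X ^ n ∣ f)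
    (ha : a < n) (F : PowerSeries (PowerSeries ℂ)) :
    coeff a (coeff b (rowSeries f * F)) = 0 := by
  have h1 : coeff b (rowSeries f * F) = f * coeff b F := by
    simp [rowSeries, PowerSeries.coeff_C_mul]
  rw [h1]
  exact X_pow_dvd_iff.mp (h.mul_right _) a ha

/-- The complex conjugate of a power series. -/
def conjSeries : PowerSeries ℂ →+* PowerSeries ℂ := PowerSeries.map (starRingEnd ℂ)

theorem coeff_conjSeries (n : ℕ) (f : PowerSeries ℂ) :
    coeff n (conjSeries f) = conj (coeff n f) := by simp [conjSeries]

theorem conjSeries_conjSeries (f : PowerSeries ℂ) : conjSeries (conjSeries f) = f := by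
  ext n; simp [coeff_conjSeries]

theorem conjSeries_C (c : ℂ) : conjSeries (C c) = C (conj c) := by
  simp [conjSeries]

theorem exists_mul_row_sub_col_eq_one {f g : PowerSeries ℂ}
    (h : constantCoeff f ≠ constantCoeff g) :
    ∃ κ : PowerSeries (PowerSeries ℂ), κ * (rowSeries f - colSeries g) = 1 := by
  have : IsUnit (rowSeries f - colSeries g) := by
    rw [PowerSeries.isUnit_iff_constantCoeff, PowerSeries.isUnit_iff_constantCoeff]
    have : constantCoeff (constantCoeff (rowSeries f - colSeries g)) =
        constantCoeff f - constantCoeff g := by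
      rw [map_sub, map_sub]
      congr 1
    rw [this, isUnit_iff_ne_zero]
    exact sub_ne_zero.mpr h
  obtain ⟨κ, hκ⟩ := this.exists_left_inv
  exact ⟨κ, hκ⟩

namespace Params

variable (P : Params)

/-- `1 / (χ_l(ε)^* - χ_m)`. -/
def invFactor (l m : Fin 2) : PowerSeries ℂ := (conjSeries (P.chiSeries l) - C (P.chi m))⁻¹

/-- `χ_l(ε)^* - χ_m^*`. -/
def nodeFactor (l m : Fin 2) : PowerSeries ℂ := conjSeries (P.chiSeries l) - C (conj (P.chi m))

theorem constantCoeff_conjSeries_chiSeries (l : Fin 2) :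
    constantCoeff (conjSeries (P.chiSeries l)) = conj (P.chi l) := by
  rw [← coeff_zero_eq_constantCoeff_apply, coeff_conjSeries, coeff_zero_eq_constantCoeff_apply]
  rfl

variable {P}

theorem constantCoeff_sub_ne_zero (hχ : ∀ l m, P.chi l ≠ conj (P.chi m)) (l m : Fin 2) :
    constantCoeff (conjSeries (P.chiSeries l) - C (P.chi m)) ≠ 0 := by
  rw [map_sub, constantCoeff_conjSeries_chiSeries, constantCoeff_C]
  exact sub_ne_zero.mpr (hχ m l).symm

theorem invFactor_mul (hχ : ∀ l m, P.chi l ≠ conj (P.chi m)) (l m : Fin 2) :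
    P.invFactor l m * (conjSeries (P.chiSeries l) - C (P.chi m)) = 1 :=
  PowerSeries.inv_mul_cancel _ (constantCoeff_sub_ne_zero hχ l m)

theorem constantCoeff_invFactor (l m : Fin 2) :
    constantCoeff (P.invFactor l m) = (conj (P.chi l) - P.chi m)⁻¹ := by
  simp [invFactor, constantCoeff_conjSeries_chiSeries]

theorem constantCoeff_nodeFactor (l m : Fin 2) :
    constantCoeff (P.nodeFactor l m) = conj (P.chi l) - conj (P.chi m) := by
  simp [nodeFactor, constantCoeff_conjSeries_chiSeries]

theorem conjSeries_invFactor_mul (hχ : ∀ l m, P.chi l ≠ conj (P.chi m)) (l m : Fin 2) :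
    conjSeries (P.invFactor l m) * (P.chiSeries l - C (conj (P.chi m))) = 1 := by
  have := congrArg conjSeries (invFactor_mul hχ l m)
  rwa [map_mul, map_sub, map_one, conjSeries_conjSeries, conjSeries_C] at this

/-- Expansion of the kernel `1 / (χ_l(ε)^* - χ_m(δ))` along nodes `(χ_{s(r)}^*, χ_{t(r)})`. -/
theorem kernel_coeff (hχ : ∀ l m, P.chi l ≠ conj (P.chi m)) {l m : Fin 2}
    {κ : PowerSeries (PowerSeries ℂ)}
    (hκ : κ * (rowSeries (conjSeries (P.chiSeries l)) - colSeries (P.chiSeries m)) = 1)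
    (s t : ℕ → Fin 2) (M : ℕ) {n a : ℕ} (b : ℕ)
    (hn : X ^ n ∣ ∏ r ∈ Finset.range M, P.nodeFactor l (s r) * P.invFactor l (t r)) (ha : a < n) :
    coeff a (coeff b κ) = ∑ v ∈ Finset.range M, (P.chi (t v) - conj (P.chi (s v))) *
      (coeff a ((∏ r ∈ Finset.range v, P.nodeFactor l (s r) * P.invFactor l (t r)) *
          P.invFactor l (t v)) *
        conj (coeff b ((∏ r ∈ Finset.range v, P.nodeFactor m (t r) * P.invFactor m (s r)) *
          P.invFactor m (s v)))) := by
  -- The nodes are p_r = χ_{s(r)}^* and q_r = χ_{t(r)}. The inverse of p_r - W is minus a conjugated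
  -- `invFactor`; this sign is what turns p_v - q_v into χ_{t(v)} - χ_{s(v)}^* in the weight.
  have key := cauchyKernel_decomposition hκ
    (fun r => rowSeries (C (conj (P.chi (s r))))) (fun r => rowSeries (C (P.chi (t r))))
    (fun r => rowSeries (P.invFactor l (t r)))
    (fun r => - colSeries (conjSeries (P.invFactor m (s r)))) ?_ ?_ M
  rotate_left
  · intro r
    rw [← map_sub, ← map_mul, invFactor_mul hχ, map_one]
  · intro r
    have := congrArg colSeries (conjSeries_invFactor_mul hχ m (s r))
    rw [map_mul, map_sub, map_one] at this
    rw [rowSeries_C]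
    linear_combination this
  have hrow : ∀ v, ∏ r ∈ Finset.range v, (rowSeries (conjSeries (P.chiSeries l)) -
      rowSeries (C (conj (P.chi (s r))))) * rowSeries (P.invFactor l (t r)) =
      rowSeries (∏ r ∈ Finset.range v, P.nodeFactor l (s r) * P.invFactor l (t r)) := by
    intro v
    rw [map_prod]
    refine Finset.prod_congr rfl fun r _ => ?_
    rw [map_mul, nodeFactor, map_sub]
  have hcol : ∀ v, ∏ r ∈ Finset.range v, (rowSeries (C (P.chi (t r))) -
      colSeries (P.chiSeries m)) * -colSeries (conjSeries (P.invFactor m (s r))) =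
      colSeries (conjSeries
        (∏ r ∈ Finset.range v, P.nodeFactor m (t r) * P.invFactor m (s r))) := by
    intro v
    rw [map_prod, map_prod]
    refine Finset.prod_congr rfl fun r _ => ?_
    rw [map_mul, map_mul, nodeFactor, map_sub, map_sub, conjSeries_conjSeries, conjSeries_C,
      rowSeries_C, Complex.conj_conj]
    ring
  simp only [hrow, hcol] at key
  -- The remainder contains the full row product, which is divisible by X^n and therefore does not
  -- reach row a < n.
  rw [key, map_add, map_add, mul_assoc, coeff_coeff_row_mul_eq_zero b hn ha, add_zero, map_sum,
    map_sum]
  refine Finset.sum_congr rfl fun v _ => ?_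
  have : (rowSeries (C (conj (P.chi (s v)))) - rowSeries (C (P.chi (t v)))) *
      (rowSeries (∏ r ∈ Finset.range v, P.nodeFactor l (s r) * P.invFactor l (t r)) *
        rowSeries (P.invFactor l (t v)) *
      (colSeries (conjSeries
        (∏ r ∈ Finset.range v, P.nodeFactor m (t r) * P.invFactor m (s r))) *
        -colSeries (conjSeries (P.invFactor m (s v))))) =
      rowSeries (C (P.chi (t v) - conj (P.chi (s v))) *
        ((∏ r ∈ Finset.range v, P.nodeFactor l (s r) * P.invFactor l (t r)) *
          P.invFactor l (t v))) *
      colSeries (conjSeries ((∏ r ∈ Finset.range v, P.nodeFactor m (t r) * P.invFactor m (s r)) *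
          P.invFactor m (s v))) := by
    simp only [map_mul, map_sub]; ring
  rw [this, coeff_coeff_row_mul_col, coeff_conjSeries, coeff_C_mul]
  ring

theorem X_dvd_nodeFactor (l : Fin 2) : X ∣ P.nodeFactor l l := by
  rw [X_dvd_iff, constantCoeff_nodeFactor, sub_self]

/-- Exponentiating the logarithms that define h₁ and h₂ gives C_{lm} ε exp(h₂) = (χ_l(ε) - χ_l) /
(χ_l(ε) - χ_m^*), and exp(h₁) is a constant times 1 / (χ_l(ε) - χ_m^*). So each entry of the factor
P_{lm} is a coefficient of a power of this quotient times 1 / (χ_l(ε) - χ_m^*). -/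
theorem conj_cst_pow_mul_schur (hχ : ∀ l m, P.chi l ≠ conj (P.chi m)) (h1 : ∀ l, P.chi1 l ≠ 0)
    (l m : Fin 2) {v a : ℕ} (hv : v ≤ a) :
    conj (P.cst l m ^ v * schur (a - v) fun r => P.h1 l m r + v * P.h2 l m r) =
      (conj (P.chi l) - P.chi m) *
        coeff a ((P.nodeFactor l l * P.invFactor l m) ^ v * P.invFactor l m) := by
  have hne : P.chi l - conj (P.chi m) ≠ 0 := sub_ne_zero.mpr (hχ l m)
  have hinv : conjSeries (P.invFactor l m) = (P.chiSubConj l m)⁻¹ := by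
    have h0 : constantCoeff (P.chiSubConj l m) ≠ 0 := by
      rw [chiSubConj, map_sub, constantCoeff_C]; exact hne
    rw [PowerSeries.eq_inv_iff_mul_eq_one h0]
    exact conjSeries_invFactor_mul hχ l m
  have hc : constantCoeff ((P.chiSubConj l m)⁻¹) = (P.chi l - conj (P.chi m))⁻¹ := by
    rw [constantCoeff_inv, chiSubConj, map_sub, constantCoeff_C]; rfl
  have e1 : schurSeries (P.h1 l m) =
      C (P.chi l - conj (P.chi m)) * (P.chiSubConj l m)⁻¹ := by
    apply schurSeries_coeff_logOf
    rw [map_mul, hc, constantCoeff_C, mul_inv_cancel₀ hne]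
  have e2 : schurSeries (P.h2 l m) = C ((P.chi l - conj (P.chi m)) / P.chi1 l) *
    (PowerSeries.mk fun i => coeff (i + 1) (P.chiSeries l)) * (P.chiSubConj l m)⁻¹ := by
    apply schurSeries_coeff_logOf
    rw [map_mul, map_mul, hc, constantCoeff_C, ← coeff_zero_eq_constantCoeff_apply, coeff_mk]
    change _ / _ * P.chi1 l * _ = _
    have := h1 l
    field_simp
  have hX : X * (PowerSeries.mk fun i => coeff (i + 1) (P.chiSeries l)) =
      P.chiSeries l - C (P.chi l) := by
    ext i
    cases i with
    | zero => simp [chi]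
    | succ i => simp [coeff_succ_X_mul]
  have hnode : conjSeries (P.nodeFactor l l) = P.chiSeries l - C (P.chi l) := by
    rw [nodeFactor, map_sub, conjSeries_conjSeries, conjSeries_C, Complex.conj_conj]
  have hC : C (P.cst l m) * C ((P.chi l - conj (P.chi m)) / P.chi1 l) = (1 : PowerSeries ℂ) := by
    rw [← map_mul, cst, div_mul_div_cancel₀ hne, div_self (h1 l), map_one]
  have hser : C (P.cst l m) ^ v * X ^ v * schurSeries (P.h1 l m + v • P.h2 l m) =
      conjSeries (C (conj (P.chi l) - P.chi m) *
        ((P.nodeFactor l l * P.invFactor l m) ^ v * P.invFactor l m)) := by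
    rw [schurSeries_add, schurSeries_nsmul, e1, e2, map_mul, map_mul, map_pow, map_mul, hinv,
      hnode, conjSeries_C, map_sub (starRingEnd ℂ), Complex.conj_conj, ← hX]
    calc _ = ((C (P.cst l m) * C ((P.chi l - conj (P.chi m)) / P.chi1 l)) * (X *
          (PowerSeries.mk fun i => coeff (i + 1) (P.chiSeries l)) * (P.chiSubConj l m)⁻¹)) ^ v *
          (C (P.chi l - conj (P.chi m)) * (P.chiSubConj l m)⁻¹) := by
            simp only [mul_pow]; ring
      _ = _ := by rw [hC]; ring
  have := congrArg (fun f => conj (coeff a f)) hser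
  simp only [coeff_conjSeries, Complex.conj_conj, coeff_C_mul] at this
  rw [← this, ← map_pow, mul_assoc, coeff_C_mul, coeff_X_pow_mul', if_pos hv]
  congr 2
  simp only [schurSeries, coeff_mk]
  apply schur_congr
  intro r _
  simp

/-- The entries `pEntry` are the coefficients of `1 / (χ_l(ε)^* - χ_m(δ))`. -/
theorem pEntry_eq_kernel_coeff (hχ : ∀ l m, P.chi l ≠ conj (P.chi m)) (h1 : ∀ l, P.chi1 l ≠ 0)
    {l m : Fin 2} {κ : PowerSeries (PowerSeries ℂ)}
    (hκ : κ * (rowSeries (conjSeries (P.chiSeries l)) - colSeries (P.chiSeries m)) = 1)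
    (a b : ℕ) : P.pEntry l m a b = coeff a (coeff b κ) := by
  have hvan : ∀ (l m : Fin 2) (a v : ℕ), a < v →
      coeff a ((P.nodeFactor l l * P.invFactor l m) ^ v * P.invFactor l m) = 0 := by
    intro l m a v hav
    refine X_pow_dvd_iff.mp (Dvd.dvd.mul_right ?_ _) a hav
    exact pow_dvd_pow_of_dvd ((X_dvd_nodeFactor l).mul_right _) v
  -- For the constant nodes (χ_l^*, χ_m) the expansion is term by term the definition of `pEntry`.
  -- Terms with v > min a b vanish, and a + b + 1 nodes suffice to remove the remainder.
  rw [kernel_coeff hχ hκ (fun _ => l) (fun _ => m) (a + b + 1) (n := a + b + 1) b ?_ (by omega)]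
  · simp only [Finset.prod_const, Finset.card_range]
    rw [pEntry, Finset.mul_sum]
    have hsub : Finset.range (min a b + 1) ⊆ Finset.range (a + b + 1) :=
      Finset.range_subset_range.mpr (by omega)
    rw [← Finset.sum_subset hsub]
    · refine Finset.sum_congr rfl fun v hv => ?_
      have hv' : v < min a b + 1 := by simpa using hv
      have hne : conj (P.chi l) - P.chi m ≠ 0 := sub_ne_zero.mpr (hχ m l).symm
      have hb := conj_cst_pow_mul_schur hχ h1 m l (v := v) (a := b) (by omega)
      rw [conj_cst_pow_mul_schur hχ h1 l m (by omega)]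
      have hb' := congrArg (starRingEnd ℂ) hb
      rw [Complex.conj_conj, map_mul, map_sub, Complex.conj_conj] at hb'
      rw [hb']
      field_simp
    · intro v hv hv'
      have : min a b < v := by
        rw [Finset.mem_range] at hv'; omega
      rcases min_lt_iff.mp this with h | h
      · rw [hvan l m a v h]; simp
      · rw [hvan m l b v h]; simp
  · simp only [Finset.prod_const, Finset.card_range]
    exact pow_dvd_pow_of_dvd ((X_dvd_nodeFactor l).mul_right _) _

end Params

end

end CNLS

/-! ### Triangular factorization of the kernel matrix -/

namespace CNLS

open Complex Filter Topology PowerSeries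
open scoped ComplexConjugate

noncomputable section

theorem det_of_triangular_by {ι : Type*} [Fintype ι] [DecidableEq ι] {b : ι → ℕ}
    (hb : Function.Injective b) {G : Matrix ι ι ℂ} (hG : ∀ i j, b i < b j → G i j = 0) :
    G.det = ∏ i, G i i := by
  let : LinearOrder ι := LinearOrder.lift' b hb
  have h := Matrix.det_of_isLowerTriangular G (fun i j hij => hG i j hij)
  convert h

/-- The matrix is G · diag(d) · Hᵀ with both outer factors triangular in the order given by b. -/
theorem det_sum_mul_triangular {ι : Type*} [Fintype ι] [DecidableEq ι] {b : ι → ℕ}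
    (hb : Function.Injective b) (d : ι → ℂ) {G H : ι → ι → ℂ}
    (hG : ∀ i j, b i < b j → G i j = 0) (hH : ∀ i j, b i < b j → H i j = 0) :
    (Matrix.of fun r s => ∑ v, d v * (G r v * H s v)).det = ∏ v, d v * (G v v * H v v) := by
  have : (Matrix.of fun r s => ∑ v, d v * (G r v * H s v)) =
      Matrix.of (fun r v => d v * G r v) * (Matrix.of H).transpose := by
    ext r s
    simp only [Matrix.of_apply, Matrix.mul_apply, Matrix.transpose_apply]
    exact Finset.sum_congr rfl fun v _ => by ring
  rw [this, Matrix.det_mul, Matrix.det_transpose, det_of_triangular_by hb, det_of_triangular_by hb,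
    ← Finset.prod_mul_distrib]
  · exact Finset.prod_congr rfl fun v _ => by simp only [Matrix.of_apply]; ring
  · exact hH
  · intro i j hij; simp [hG i j hij]

/-- As L comes last, column L of G and of H vanishes outside row L. Replacing these columns by unit
vectors moves their entries into the weight of L, which then absorbs the perturbation c. -/
theorem det_sum_mul_triangular_add {ι : Type*} [Fintype ι] [DecidableEq ι] {b : ι → ℕ}
    (hb : Function.Injective b) (d : ι → ℂ) {G H : ι → ι → ℂ}
    (hG : ∀ i j, b i < b j → G i j = 0) (hH : ∀ i j, b i < b j → H i j = 0)
    {L : ι} (hL : ∀ i, b i ≤ b L) (c : ℂ) :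
    (Matrix.of fun r s =>
      ∑ v, d v * (G r v * H s v) + if r = L ∧ s = L then c else 0).det =
      (∏ v ∈ Finset.univ.erase L, d v * (G v v * H v v)) * (d L * (G L L * H L L) + c) := by
  have hlt : ∀ i, i ≠ L → b i < b L := fun i hi => lt_of_le_of_ne (hL i) fun h => hi (hb h)
  have h := det_sum_mul_triangular hb
    (fun v => if v = L then d L * (G L L * H L L) + c else d v)
    (G := fun r v => if v = L then (if r = L then 1 else 0) else G r v)
    (H := fun r v => if v = L then (if r = L then 1 else 0) else H r v) ?_ ?_
  rotate_left
  · intro i j hij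
    by_cases hj : j = L
    · rw [if_pos hj, if_neg]; rintro rfl; rw [hj] at hij; exact lt_irrefl _ hij
    · rw [if_neg hj]; exact hG i j hij
  · intro i j hij
    by_cases hj : j = L
    · rw [if_pos hj, if_neg]; rintro rfl; rw [hj] at hij; exact lt_irrefl _ hij
    · rw [if_neg hj]; exact hH i j hij
  have hM : (Matrix.of fun r s =>
      ∑ v, d v * (G r v * H s v) + if r = L ∧ s = L then c else 0) = Matrix.of fun r s =>
      ∑ v, (if v = L then d L * (G L L * H L L) + c else d v) *
        ((if v = L then (if r = L then 1 else 0) else G r v) *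
          (if v = L then (if s = L then 1 else 0) else H s v)) := by
    ext r s
    simp only [Matrix.of_apply]
    rw [← Finset.add_sum_erase _ _ (Finset.mem_univ L),
      ← Finset.add_sum_erase _ _ (Finset.mem_univ L)]
    have : ∑ v ∈ Finset.univ.erase L, d v * (G r v * H s v) = ∑ v ∈ Finset.univ.erase L,
        (if v = L then d L * (G L L * H L L) + c else d v) *
        ((if v = L then (if r = L then 1 else 0) else G r v) *
          (if v = L then (if s = L then 1 else 0) else H s v)) := by
      refine Finset.sum_congr rfl fun v hv => ?_
      have hv' : v ≠ L := Finset.ne_of_mem_erase hv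
      simp only [if_neg hv']
    rw [this]
    by_cases hr : r = L
    · by_cases hs : s = L
      · simp [hr, hs]; ring
      · simp [hs, hH s L (hlt s hs)]
    · simp [hr, hG r L (hlt r hr)]
  rw [hM, h, ← Finset.mul_prod_erase _ _ (Finset.mem_univ L), mul_comm]
  congr 1
  · refine Finset.prod_congr rfl fun v hv => ?_
    have hv' : v ≠ L := Finset.ne_of_mem_erase hv
    simp only [if_neg hv']
  · simp

namespace Params

variable {P : Params}

/-- Along a sequence of nodes with `n'` times the block `o` and then the block `l`, the kernel has a
triangular decomposition. -/
theorem exists_triangular_decomposition (hχ : ∀ l m, P.chi l ≠ conj (P.chi m))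
    (h1 : ∀ l, P.chi1 l ≠ 0) {l o : Fin 2} (hlo : P.chi l ≠ P.chi o) (n' n : ℕ) :
    ∃ (F : Fin 2 → ℕ → ℕ → ℂ) (c₀ : ℂ), c₀ ≠ 0 ∧
      (∀ a < n', ∀ v, a < v → F o a v = 0) ∧ (∀ a v, n' + a < v → F l a v = 0) ∧
      (∀ a < n', F o a a ≠ 0) ∧
      (∀ a, F l a (n' + a) = c₀ * (conj (P.chi1 l) / (conj (P.chi l) - P.chi l)) ^ a) ∧
      (∀ m a b, a ≤ n → P.pEntry l m a b = ∑ v ∈ Finset.range (n' + n + 1),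
        (2 * I * (P.chi (if v < n' then o else l)).im) * (F l a v * conj (F m b v))) ∧
      (∀ m a b, a < n' → P.pEntry o m a b = ∑ v ∈ Finset.range (n' + n + 1),
        (2 * I * (P.chi (if v < n' then o else l)).im) * (F o a v * conj (F m b v))) := by
  -- The same nodes serve rows and columns, whatever the blocks of the entry. Therefore F depends on
  -- one block only and the column factor is the conjugate of the row factor.
  set nd : ℕ → Fin 2 := fun v => if v < n' then o else l with hnd
  set B : Fin 2 → ℕ → PowerSeries ℂ := fun k v =>
    ∏ r ∈ Finset.range v, P.nodeFactor k (nd r) * P.invFactor k (nd r) with hB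
  have ndl : ∀ r, nd (n' + r) = l := fun r => by simp [hnd]
  have ndo : ∀ r, r < n' → nd r = o := fun r hr => by simp [hnd, hr]
  have hBl : ∀ v, B l (n' + v) = (P.nodeFactor l o * P.invFactor l o) ^ n' *
      (P.nodeFactor l l * P.invFactor l l) ^ v := by
    intro v
    simp only [hB]
    rw [Finset.prod_range_add]
    congr 1
    · rw [Finset.prod_congr rfl (g := fun _ => P.nodeFactor l o * P.invFactor l o)]
      · simp
      · intro r hr; rw [ndo r (by simpa using hr)]
    · rw [Finset.prod_congr rfl (g := fun _ => P.nodeFactor l l * P.invFactor l l)]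
      · simp
      · intro r hr; rw [ndl r]
  have hBo : ∀ v ≤ n', B o v = (P.nodeFactor o o * P.invFactor o o) ^ v := by
    intro v hv
    simp only [hB]
    rw [Finset.prod_congr rfl (g := fun _ => P.nodeFactor o o * P.invFactor o o)]
    · simp
    · intro r hr; rw [ndo r (lt_of_lt_of_le (by simpa using hr) hv)]
  have hdl : ∀ v, X ^ v ∣ B l (n' + v) := by
    intro v
    rw [hBl]
    exact (pow_dvd_pow_of_dvd ((X_dvd_nodeFactor l).mul_right _) v).mul_left _
  have hdo : ∀ v ≤ n', X ^ v ∣ B o v := by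
    intro v hv
    rw [hBo v hv]
    exact pow_dvd_pow_of_dvd ((X_dvd_nodeFactor o).mul_right _) v
  have hdo' : ∀ v, n' ≤ v → X ^ n' ∣ B o v := by
    intro v hv
    refine (hdo n' le_rfl).trans ?_
    exact Finset.prod_dvd_prod_of_subset _ _ _ (Finset.range_subset_range.mpr hv)
  -- `nodeFactor k k` is X times a series with constant term conj χ_k^{[1]}, so only constant terms
  -- enter the lowest coefficient.
  have hlead : ∀ k : Fin 2, ∀ v (g : PowerSeries ℂ),
      coeff v ((P.nodeFactor k k * P.invFactor k k) ^ v * g) =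
        (conj (P.chi1 k) / (conj (P.chi k) - P.chi k)) ^ v * constantCoeff g := by
    intro k v g
    obtain ⟨T, hT⟩ := X_dvd_nodeFactor (P := P) k
    have hT1 : constantCoeff T = conj (P.chi1 k) := by
      have := congrArg (coeff 1) hT
      rw [show (1 : ℕ) = 0 + 1 from rfl, coeff_succ_X_mul, coeff_zero_eq_constantCoeff_apply] at this
      rw [← this, nodeFactor, map_sub, coeff_conjSeries]
      simp [chi1]
    rw [hT, mul_assoc, mul_pow, mul_assoc, coeff_X_pow_mul', if_pos le_rfl, Nat.sub_self,
      coeff_zero_eq_constantCoeff_apply, map_mul, map_pow, map_mul, hT1, constantCoeff_invFactor,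
      div_eq_mul_inv]
  have hpq : ∀ l m, conj (P.chi l) - P.chi m ≠ 0 := fun l m => sub_ne_zero.mpr (hχ m l).symm
  have him : ∀ k : Fin 2, P.chi k - conj (P.chi k) = 2 * I * (P.chi k).im := by
    intro k; rw [Complex.sub_conj]; push_cast; ring
  -- Here n₀ is an order of vanishing of the full row product: n + 1 for block l and n' for block o.
  -- This is the reason for the row ranges in the last two claims.
  have hexp : ∀ k m a b n₀, X ^ n₀ ∣ B k (n' + n + 1) → a < n₀ →
      P.pEntry k m a b = ∑ v ∈ Finset.range (n' + n + 1), (2 * I * (P.chi (nd v)).im) *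
        (coeff a (B k v * P.invFactor k (nd v)) * conj (coeff b (B m v * P.invFactor m (nd v)))) := by
    intro k m a b n₀ hn₀ ha
    obtain ⟨κ, hκ⟩ := exists_mul_row_sub_col_eq_one
      (f := conjSeries (P.chiSeries k)) (g := P.chiSeries m) (by
        rw [constantCoeff_conjSeries_chiSeries]; exact (hχ m k).symm)
    rw [pEntry_eq_kernel_coeff hχ h1 hκ, kernel_coeff hχ hκ nd nd _ b hn₀ ha]
    exact Finset.sum_congr rfl fun v _ => by rw [him]
  -- The constant c₀ is the constant term of the factors not belonging to the powers of the node l;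
  -- it is nonzero because χ_l ≠ χ_o.
  refine ⟨fun k a v => coeff a (B k v * P.invFactor k (nd v)),
    ((conj (P.chi l) - conj (P.chi o)) / (conj (P.chi l) - P.chi o)) ^ n' /
      (conj (P.chi l) - P.chi l), ?_, ?_, ?_, ?_, ?_, ?_, ?_⟩
  · refine div_ne_zero (pow_ne_zero _ (div_ne_zero ?_ (hpq l o))) (hpq l l)
    rw [← map_sub]
    exact (map_ne_zero _).mpr (sub_ne_zero.mpr hlo)
  · intro a ha v hv
    rcases le_or_gt v n' with h | h
    · exact X_pow_dvd_iff.mp ((hdo v h).mul_right _) a hv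
    · exact X_pow_dvd_iff.mp ((hdo' v h.le).mul_right _) a ha
  · intro a v hv
    obtain ⟨w, rfl⟩ : ∃ w, v = n' + w := ⟨v - n', by omega⟩
    exact X_pow_dvd_iff.mp ((hdl w).mul_right _) a (by omega)
  · intro a ha
    simp only
    rw [hBo a ha.le, hlead, constantCoeff_invFactor]
    refine mul_ne_zero (pow_ne_zero _ (div_ne_zero ((map_ne_zero _).mpr (h1 o)) (hpq o o)))
      (inv_ne_zero (hpq _ _))
  · intro a
    simp only
    rw [hBl, mul_comm ((P.nodeFactor l o * P.invFactor l o) ^ n'), mul_assoc, hlead, map_mul,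
      map_pow, map_mul, constantCoeff_invFactor, constantCoeff_invFactor, constantCoeff_nodeFactor,
      ndl]
    simp only [div_eq_mul_inv]; ring
  · intro m a b ha
    exact hexp l m a b (n + 1) (by rw [add_assoc]; exact hdl (n + 1)) (by omega)
  · intro m a b ha
    exact hexp o m a b n' (hdo' _ (by omega)) ha

end Params

end

end CNLS

/-! ### Gram determinants with a modified last column -/

namespace CNLS

open Complex Filter Topology PowerSeries
open scoped ComplexConjugate

noncomputable section

namespace Params

variable {P : Params}

variable (P) in
/-- A common bound for the row indices of the factors of `τ`. -/
def rowBound : ℕ := 2 * (P.N 0 + P.N 1) + 2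

theorem lt_rowBound {l : Fin 2} {i : ℕ} (h : i ≤ 2 * P.N l + 1) : i < P.rowBound := by
  unfold rowBound
  fin_cases l <;> simp at h <;> omega

variable (P) in
/-- The block matrix with the blocks `G_l^† K_{lm} H_m`. -/
def gram (G H : ∀ l, Matrix ℕ (Fin (P.N l)) ℂ) :
    Matrix (Σ l : Fin 2, Fin (P.N l)) (Σ l : Fin 2, Fin (P.N l)) ℂ :=
  Matrix.of fun r s => ∑ a ∈ Finset.range P.rowBound, conj (G r.1 a r.2) *
    ∑ b ∈ Finset.range P.rowBound, P.pEntry r.1 s.1 a b * H s.1 b s.2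

variable (P) in
/-- The unit columns `1, …, N_k`. -/
def unitCols (k : Fin 2) : Matrix ℕ (Fin (P.N k)) ℂ := Matrix.of fun a c => if a = c then 1 else 0

variable (P) in
/-- The unit columns, where the last one of block `l` is replaced by `x e_{N_l} + e_{N_l + 1}`. -/
def modCols (l : Fin 2) (x : ℂ) (k : Fin 2) : Matrix ℕ (Fin (P.N k)) ℂ :=
  Matrix.of fun a c => if k = l ∧ (c : ℕ) + 1 = P.N k then
    (if a = c then x else if a = c + 1 then 1 else 0) else if a = c then 1 else 0

theorem sum_unitCols_mul (k : Fin 2) (c : Fin (P.N k)) (f : ℕ → ℂ) :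
    ∑ a ∈ Finset.range P.rowBound, P.unitCols k a c * f a = f c := by
  have : (c : ℕ) < P.rowBound := lt_rowBound (l := k) (by omega)
  simp [unitCols, this]

theorem sum_modCols_mul (l : Fin 2) (x : ℂ) (k : Fin 2) (c : Fin (P.N k)) (f : ℕ → ℂ) :
    ∑ a ∈ Finset.range P.rowBound, P.modCols l x k a c * f a =
      if k = l ∧ (c : ℕ) + 1 = P.N k then x * f c + f (c + 1) else f c := by
  have h1 : (c : ℕ) < P.rowBound := lt_rowBound (l := k) (by omega)
  have h2 : (c : ℕ) + 1 < P.rowBound := lt_rowBound (l := k) (by omega)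
  split_ifs with h
  · have : ∀ a : ℕ, P.modCols l x k a c * f a =
        (if a = (c : ℕ) then x * f a else 0) + if a = (c : ℕ) + 1 then f a else 0 := by
      intro a
      simp only [modCols, Matrix.of_apply, if_pos h]
      by_cases ha : a = (c : ℕ)
      · simp [ha]
      · simp [ha]
    simp only [this, Finset.sum_add_distrib, Finset.sum_ite_eq', Finset.mem_range, h1, h2, if_true]
  · simp [modCols, h, h1]

variable (P) in
/-- The position of an index in the order in which the block `l` comes last. -/
def position (l o : Fin 2) (s : Σ l : Fin 2, Fin (P.N l)) : ℕ :=
  if s.1 = l then P.N o + s.2 else s.2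

theorem eq_of_ne_of_ne {l o k : Fin 2} (hlo : l ≠ o) (h : k ≠ l) : k = o := by omega

theorem position_injective {l o : Fin 2} (hlo : l ≠ o) :
    Function.Injective (P.position l o) := by
  rintro ⟨k, a⟩ ⟨m, b⟩ h
  have ho : ∀ {k : Fin 2}, k ≠ l → k = o := fun h => eq_of_ne_of_ne hlo h
  unfold position at h
  by_cases hk : k = l <;> by_cases hm : m = l
  · subst hk; subst hm
    simp at h; rw [Fin.ext h]
  · obtain rfl := ho hm
    have := b.2
    simp [hk, hm] at h; omega
  · obtain rfl := ho hk
    have := a.2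
    simp [hk, hm] at h; omega
  · obtain rfl := ho hk
    obtain rfl := ho hm
    simp [hk] at h; rw [Fin.ext h]

theorem sum_range_position {l o : Fin 2} (hlo : l ≠ o) (f : ℕ → ℂ) :
    ∑ v ∈ Finset.range (P.N o + P.N l), f v = ∑ s, f (P.position l o s) := by
  rw [Fintype.sum_sigma, Finset.sum_range_add, Finset.sum_range, Finset.sum_range, Fin.sum_univ_two]
  have h1 : ∀ c : Fin (P.N l), P.position l o ⟨l, c⟩ = P.N o + c := fun c => by simp [position]
  have h2 : ∀ c : Fin (P.N o), P.position l o ⟨o, c⟩ = c := fun c => by simp [position, hlo.symm]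
  have hcases : (l = 0 ∧ o = 1) ∨ (l = 1 ∧ o = 0) := by omega
  rcases hcases with ⟨rfl, rfl⟩ | ⟨rfl, rfl⟩
  · simp only [h1, h2]; ring
  · simp only [h1, h2]

/-- The nonvanishing of the leading minor, and the determinant of the matrix in which the last
column of block `l` is modified. -/
theorem det_gram_modCols (hχ : ∀ l m, P.chi l ≠ conj (P.chi m))
    (h1 : ∀ l, P.chi1 l ≠ 0) {l o : Fin 2} (hlo : l ≠ o) (hne : P.chi l ≠ P.chi o) :
    P.pMinor (fun s => s.2) ≠ 0 ∧ (0 < P.N l → ∀ xm xp : ℂ,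
      (P.gram (P.modCols l xm) (P.modCols l xp)).det = P.pMinor (fun s => s.2) *
        (conj (xm + P.delta l) * (xp + P.delta l) +
          ((‖P.chi1 l‖ ^ 2 / (4 * (P.chi l).im ^ 2) : ℝ) : ℂ))) := by
  obtain ⟨F, c₀, hc₀, hFo, hFl, hFoo, hFll, hKl, hKo⟩ :=
    exists_triangular_decomposition hχ h1 hne (P.N o) (P.N l)
  set b := P.position l o with hb
  have hbinj : Function.Injective b := position_injective hlo
  set n := P.N o + P.N l with hn
  set D : ℕ → ℂ := fun v => 2 * I * (P.chi (if v < P.N o then o else l)).im with hD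
  have ho : ∀ {k : Fin 2}, k ≠ l → k = o := fun h => eq_of_ne_of_ne hlo h
  have him : ∀ k, (P.chi k).im ≠ 0 := by
    intro k hk
    exact hχ k k (Complex.conj_eq_iff_im.mpr hk).symm
  have hD0 : ∀ v, D v ≠ 0 := fun v => by
    simp only [hD]
    exact mul_ne_zero (mul_ne_zero two_ne_zero I_ne_zero) (by exact_mod_cast him _)
  have hblt : ∀ s, b s < n := by
    rintro ⟨k, a⟩
    simp only [hb, position]
    have := a.2
    split_ifs with hk
    · subst hk; omega
    · have := ho hk; subst this; simp; omega
  have htri : ∀ (s : Σ l : Fin 2, Fin (P.N l)) (v : ℕ), b s < v → F s.1 s.2 v = 0 := by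
    rintro ⟨k, a⟩ v hv
    simp only [hb, position] at hv
    split_ifs at hv with hk
    · subst hk; exact hFl _ _ hv
    · obtain rfl := ho hk; exact hFo _ a.2 _ hv
  have hdiag : ∀ s : Σ l : Fin 2, Fin (P.N l), F s.1 s.2 (b s) ≠ 0 := by
    rintro ⟨k, a⟩
    simp only [hb, position]
    split_ifs with hk
    · subst hk; simp only [hFll]
      exact mul_ne_zero hc₀ (pow_ne_zero _ (div_ne_zero ((map_ne_zero _).mpr (h1 _))
        (sub_ne_zero.mpr (hχ _ _).symm)))
    · obtain rfl := ho hk; exact hFoo _ a.2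
  have hK : ∀ (k m : Fin 2) (a c : ℕ), a < P.N k ∨ (k = l ∧ a ≤ P.N k) →
      P.pEntry k m a c = ∑ v ∈ Finset.range (n + 1), D v * (F k a v * conj (F m c v)) := by
    intro k m a c h
    by_cases hk : k = l
    · subst hk; exact hKl m a c (by omega)
    · obtain rfl := ho hk
      exact hKo m a c (by tauto)
  -- The factorization has one index more than the matrix, namely n. By triangularity the unmodified
  -- columns do not reach it.
  have hsum : ∀ f : ℕ → ℂ, ∑ v ∈ Finset.range (n + 1), f v = (∑ s, f (b s)) + f n := by
    intro f
    rw [Finset.sum_range_succ, hn, sum_range_position hlo]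
  have htri' : ∀ i j : Σ l : Fin 2, Fin (P.N l), b i < b j → F i.1 i.2 (b j) = 0 :=
    fun i j h => htri i _ h
  have hden : P.pMinor (fun s => s.2) =
      ∏ v, D (b v) * (F v.1 v.2 (b v) * conj (F v.1 v.2 (b v))) := by
    have h := det_sum_mul_triangular hbinj (fun v => D (b v))
      (G := fun r v => F r.1 r.2 (b v)) (H := fun r v => conj (F r.1 r.2 (b v))) htri'
      (fun i j hij => by simp [htri' i j hij])
    rw [← h, pMinor]
    congr 1
    ext r s
    simp only [Matrix.of_apply]
    rw [hK _ _ _ _ (Or.inl r.2.2), hsum, htri r n (hblt r)]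
    simp
  refine ⟨?_, ?_⟩
  · rw [hden]
    refine Finset.prod_ne_zero_iff.mpr fun v _ => mul_ne_zero (hD0 _) (mul_ne_zero (hdiag v) ?_)
    exact (map_ne_zero _).mpr (hdiag v)
  intro hN xm xp
  obtain ⟨N₁, hN₁⟩ : ∃ N₁, P.N l = N₁ + 1 := ⟨P.N l - 1, by omega⟩
  set L : Σ l : Fin 2, Fin (P.N l) := ⟨l, ⟨N₁, by omega⟩⟩ with hL
  have hisL : ∀ s : Σ l : Fin 2, Fin (P.N l), (s.1 = l ∧ (s.2 : ℕ) + 1 = P.N s.1) ↔ s = L := by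
    rintro ⟨k, a⟩
    constructor
    · rintro ⟨h, h'⟩
      simp only at h h'
      subst h
      have : a = ⟨N₁, by omega⟩ := Fin.ext (by simp; omega)
      rw [this]
    · intro h
      rw [h]; exact ⟨rfl, hN₁.symm⟩
  have hbL : b L = P.N o + N₁ := by simp [hb, position, hL]
  have hbmax : ∀ s, b s ≤ b L := fun s => by have := hblt s; omega
  set f := F l N₁ (b L) with hf
  set g := F l (N₁ + 1) (b L) with hg
  set q := conj (P.chi1 l) / (conj (P.chi l) - P.chi l) with hq
  have hf0 : f ≠ 0 := hdiag L
  -- Only the column factor of L changes, its pivot going from conj f to conj g. Triangularity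
  -- survives because L is the last index.
  have hnum : P.pMinor (fun s => if s.1 = l ∧ (s.2 : ℕ) + 1 = P.N l then s.2 + 1 else s.2) =
      (∏ v ∈ Finset.univ.erase L, D (b v) * (F v.1 v.2 (b v) * conj (F v.1 v.2 (b v)))) *
        (D (b L) * (f * conj g)) := by
    have h := det_sum_mul_triangular hbinj (fun v => D (b v))
      (G := fun r v => F r.1 r.2 (b v))
      (H := fun r v => conj (F r.1 (if r = L then r.2 + 1 else r.2) (b v))) htri' (by
        intro i j hij
        have : i ≠ L := by rintro rfl; have := hbmax j; omega
        simp [this, htri' i j hij])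
    rw [← Finset.mul_prod_erase _ _ (Finset.mem_univ L), mul_comm] at h
    have e1 : ∏ v ∈ Finset.univ.erase L, D (b v) * (F v.1 v.2 (b v) * conj (F v.1 v.2 (b v))) =
        ∏ v ∈ Finset.univ.erase L, D (b v) * (F v.1 v.2 (b v) *
          conj (F v.1 (if v = L then v.2 + 1 else v.2) (b v))) := by
      refine Finset.prod_congr rfl fun v hv => ?_
      rw [if_neg (Finset.ne_of_mem_erase hv)]
    have e2 : D (b L) * (f * conj g) = D (b L) * (F L.1 L.2 (b L) *
          conj (F L.1 (if L = L then L.2 + 1 else L.2) (b L))) := by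
      rw [if_pos rfl]
    rw [e1, e2]
    refine Eq.trans ?_ h
    rw [pMinor]
    congr 1
    ext r s
    simp only [Matrix.of_apply]
    have : (if s.1 = l ∧ (s.2 : ℕ) + 1 = P.N l then (s.2 : ℕ) + 1 else s.2) =
        if s = L then (s.2 : ℕ) + 1 else s.2 := by
      refine if_congr ?_ rfl rfl
      rw [← hisL s]
      constructor
      · rintro ⟨h, h'⟩; exact ⟨h, by rw [h']; rw [h]⟩
      · rintro ⟨h, h'⟩; exact ⟨h, by rw [h']; rw [h]⟩
    rw [this, hK _ _ _ _ (Or.inl r.2.2), hsum, htri r n (hblt r)]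
    simp
  rw [← Finset.mul_prod_erase _ _ (Finset.mem_univ L), mul_comm] at hden
  set Q := ∏ v ∈ Finset.univ.erase L, D (b v) * (F v.1 v.2 (b v) * conj (F v.1 v.2 (b v))) with hQ1
  have hQ0 : Q ≠ 0 := Finset.prod_ne_zero_iff.mpr fun v _ =>
    mul_ne_zero (hD0 _) (mul_ne_zero (hdiag v) ((map_ne_zero _).mpr (hdiag v)))
  have hcf0 : conj f ≠ 0 := (map_ne_zero _).mpr hf0
  have hdelta : P.delta l = conj g / conj f := by
    rw [delta, hnum, hden]
    change _ / (Q * (D (b L) * (f * conj f))) = _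
    have := hD0 (b L)
    field_simp
  -- Factor rows of the modified columns. The row of L has pivot conj x · f + g and is the only one
  -- with an entry at the extra index n; this produces the perturbation at (L, L).
  set Fx : ℂ → (Σ l : Fin 2, Fin (P.N l)) → ℕ → ℂ := fun x r v =>
    if r = L then conj x * F r.1 r.2 v + F r.1 (r.2 + 1) v else F r.1 r.2 v with hFx
  have hgram : P.gram (P.modCols l xm) (P.modCols l xp) = Matrix.of fun r s =>
      ∑ v, D (b v) * (Fx xm r (b v) * conj (Fx xp s (b v))) +
        if r = L ∧ s = L then D n * (F l (N₁ + 1) n * conj (F l (N₁ + 1) n)) else 0 := by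
    ext r s
    have hQ : ∀ a, a < P.N r.1 ∨ (r.1 = l ∧ a ≤ P.N r.1) →
        ∑ b ∈ Finset.range P.rowBound, P.pEntry r.1 s.1 a b * P.modCols l xp s.1 b s.2 =
          ∑ v ∈ Finset.range (n + 1), D v * (F r.1 a v * conj (Fx xp s v)) := by
      intro a ha
      simp only [mul_comm (P.pEntry _ _ _ _)]
      rw [sum_modCols_mul]
      simp only [hisL s, hFx]
      split_ifs with hs
      · rw [hK _ _ _ _ ha, hK _ _ _ _ ha, Finset.mul_sum, ← Finset.sum_add_distrib]
        refine Finset.sum_congr rfl fun v _ => ?_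
        simp only [map_add, map_mul, Complex.conj_conj]; ring
      · rw [hK _ _ _ _ ha]
    have hall : ∑ a ∈ Finset.range P.rowBound, conj (P.modCols l xm r.1 a r.2) *
        ∑ b ∈ Finset.range P.rowBound, P.pEntry r.1 s.1 a b * P.modCols l xp s.1 b s.2 =
        ∑ v ∈ Finset.range (n + 1), D v * (Fx xm r v * conj (Fx xp s v)) := by
      have hc : ∀ a, conj (P.modCols l xm r.1 a r.2) = P.modCols l (conj xm) r.1 a r.2 := by
        intro a
        simp only [modCols, Matrix.of_apply]
        split_ifs <;> simp
      simp only [hc]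
      rw [sum_modCols_mul]
      simp only [hisL r]
      split_ifs with hr
      · have h2 : r.1 = l := ((hisL r).mpr hr).1
        have h3 := ((hisL r).mpr hr).2
        rw [hQ _ (Or.inl r.2.2), hQ _ (Or.inr ⟨h2, by omega⟩), Finset.mul_sum,
          ← Finset.sum_add_distrib]
        refine Finset.sum_congr rfl fun v _ => ?_
        simp only [hFx, if_pos hr]; ring
      · rw [hQ _ (Or.inl r.2.2)]
        refine Finset.sum_congr rfl fun v _ => ?_
        simp only [hFx, if_neg hr]
    have hFn : ∀ x r, Fx x r n = if r = L then F l (N₁ + 1) n else 0 := by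
      intro x r
      simp only [hFx]
      rw [htri r n (hblt r)]
      split_ifs with h
      · rw [h, mul_zero, zero_add]
      · rfl
    simp only [gram, Matrix.of_apply]
    rw [hall, hsum, hFn, hFn]
    congr 1
    by_cases hr : r = L <;> by_cases hs : s = L <;> simp [hr, hs]
  have hFxtri : ∀ x (i j : Σ l : Fin 2, Fin (P.N l)), b i < b j → Fx x i (b j) = 0 := by
    intro x i j hij
    have : i ≠ L := by rintro rfl; have := hbmax j; omega
    simp only [hFx, if_neg this]
    exact htri' i j hij
  rw [hgram, det_sum_mul_triangular_add hbinj (fun v => D (b v))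
    (G := fun r v => Fx xm r (b v)) (H := fun r v => conj (Fx xp r (b v))) (hFxtri xm)
    (fun i j hij => by simp [hFxtri xp i j hij]) hbmax, hden, hdelta]
  have e1 : ∏ v ∈ Finset.univ.erase L, D (b v) * (Fx xm v (b v) * conj (Fx xp v (b v))) = Q := by
    refine Finset.prod_congr rfl fun v hv => ?_
    simp only [hFx, if_neg (Finset.ne_of_mem_erase hv)]
  have e2 : ∀ x, Fx x L (b L) = conj x * f + g := by
    intro x; simp only [hFx]; rw [if_pos trivial]
  -- Both indices carry a node of block l, hence the same weight.
  have eD : D n = D (b L) := by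
    simp only [hD]
    rw [if_neg (by omega), if_neg (by omega)]
  -- By `hFll` the extreme entries form a geometric sequence with ratio q, and `e4` identifies |q|²
  -- as the constant of the first-order wave.
  have e3 : F l (N₁ + 1) n = f * q := by
    have hh : n = P.N o + (N₁ + 1) := by omega
    rw [hh, hFll, hf, hbL, hFll]; ring
  have e4 : ((‖P.chi1 l‖ ^ 2 / (4 * (P.chi l).im ^ 2) : ℝ) : ℂ) = q * conj q := by
    rw [Complex.mul_conj, hq, Complex.normSq_div, Complex.normSq_conj, ← Complex.normSq_eq_norm_sq]
    congr 2
    have : conj (P.chi l) - P.chi l = (((-2 * (P.chi l).im : ℝ)) : ℂ) * I := by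
      rw [← neg_sub, Complex.sub_conj]; push_cast; ring
    rw [this, Complex.normSq_mul, Complex.normSq_I, Complex.normSq_ofReal]; ring
  rw [e1, e2, e2, eD, e3, e4]
  change _ = Q * (D (b L) * (f * conj f)) * _
  simp only [map_add, map_mul, map_div₀, Complex.conj_conj]
  field_simp

end Params

end

end CNLS

/-! ### The τ-functions as Gram determinants of Schur columns -/

namespace CNLS

open Complex Filter Topology PowerSeries
open scoped ComplexConjugate

noncomputable section

theorem det_blockDiagonal'_sigma {ι : Type*} [Fintype ι] [LinearOrder ι] {m : ι → Type*}
    [∀ i, Fintype (m i)] [∀ i, DecidableEq (m i)] (B : ∀ i, Matrix (m i) (m i) ℂ) :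
    (Matrix.blockDiagonal' B).det = ∏ i, (B i).det := by
  rw [(Matrix.blockTriangular_blockDiagonal' B).det_fintype]
  refine Finset.prod_congr rfl fun k _ => ?_
  rw [← Matrix.det_submatrix_equiv_self (Equiv.sigmaSubtype k).symm]
  congr 1
  ext i j
  simp [Matrix.toSquareBlock, Matrix.toSquareBlockProp, Equiv.sigmaSubtype,
    Matrix.blockDiagonal'_apply]

theorem sum_mul_blockDiagonal' {ι : Type*} [Fintype ι] [DecidableEq ι] {m : ι → Type*}
    [∀ i, Fintype (m i)] [∀ i, DecidableEq (m i)] (B : ∀ i, Matrix (m i) (m i) ℂ)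
    (f : (Σ i, m i) → ℂ) (s : Σ i, m i) :
    ∑ r, f r * Matrix.blockDiagonal' B r s = ∑ j, f ⟨s.1, j⟩ * B s.1 j s.2 := by
  obtain ⟨k, c⟩ := s
  rw [Fintype.sum_sigma, Finset.sum_eq_single k]
  · simp
  · intro i _ hi
    exact Finset.sum_eq_zero fun j _ => by rw [Matrix.blockDiagonal'_apply_ne _ _ _ hi, mul_zero]
  · simp

/-- The matrix of the columns `(S_{2j-1-b}(y))_b`, `j = 1, …, N`, with row index `b ≥ 0`. -/
def schurCols (N : ℕ) (y : ℕ → ℂ) : Matrix ℕ (Fin N) ℂ :=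
  Matrix.of fun b j => if b ≤ 2 * (j : ℕ) + 1 then schur (2 * j + 1 - b) y else 0

/-- The minor of `schurCols` with the rows `f`. -/
def schurMinor (N : ℕ) (f : Fin N → ℕ) (y : ℕ → ℂ) : ℂ := ((schurCols N y).submatrix f id).det

/-- The sequence with its even entries removed. -/
def oddPart (y : ℕ → ℂ) (r : ℕ) : ℂ := if Odd r then y r else 0

/-- Write y as its odd part plus its even part. The even part has nonzero Schur polynomials only at
even indices, so the column for 2j + 1 is a combination of the columns for 2i + 1 with i ≤ j, with
coefficient 1 at i = j. -/
theorem schurCols_eq_oddPart_mul (N : ℕ) (y : ℕ → ℂ) :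
    ∃ U : Matrix (Fin N) (Fin N) ℂ, U.det = 1 ∧ schurCols N y = schurCols N (oddPart y) * U := by
  set z : ℕ → ℂ := fun r => if Odd r then 0 else y r with hz
  refine ⟨Matrix.of fun i j => if i ≤ j then schur (2 * j - 2 * i) z else 0, ?_, ?_⟩
  · rw [Matrix.det_of_isUpperTriangular]
    · simp
    · intro i j hij
      have : ¬ i ≤ j := not_le.mpr hij
      simp [this]
  · ext b j
    have hy : y = oddPart y + z := by
      funext r; simp only [oddPart, hz, Pi.add_apply]; split_ifs <;> simp
    have hz0 : ∀ r, Odd r → z r = 0 := fun r hr => by simp [hz, hr]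
    simp only [schurCols, Matrix.of_apply, Matrix.mul_apply]
    set t : ℕ → ℂ := fun i => (if b ≤ 2 * i + 1 then schur (2 * i + 1 - b) (oddPart y) else 0) *
      (if i ≤ (j : ℕ) then schur (2 * j - 2 * i) z else 0) with ht
    have h1 : ∑ i : Fin N, (if b ≤ 2 * (i : ℕ) + 1 then schur (2 * i + 1 - b) (oddPart y) else 0) *
        (if i ≤ j then schur (2 * j - 2 * i) z else 0) = ∑ i ∈ Finset.range (j + 1), t i := by
      have : ∀ i : Fin N, (if b ≤ 2 * (i : ℕ) + 1 then schur (2 * i + 1 - b) (oddPart y) else 0) *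
        (if i ≤ j then schur (2 * j - 2 * i) z else 0) = t i := fun i => by simp [ht]
      simp only [this]
      rw [Fin.sum_univ_eq_sum_range (fun i => t i) N]
      symm
      apply Finset.sum_subset (Finset.range_subset_range.mpr j.2)
      intro i _ hi
      have : ¬ i ≤ (j : ℕ) := by rw [Finset.mem_range] at hi; omega
      simp [ht, this]
    rw [h1]
    split_ifs with hb
    · conv_lhs => rw [hy]
      rw [schur_add]
      symm
      have hinj : Set.InjOn (fun i : ℕ => 2 * i + 1 - b)
          ((Finset.range ((j : ℕ) + 1)).filter fun i => b ≤ 2 * i + 1) := by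
        intro i hi i' hi' h
        simp at hi hi' h; omega
      calc ∑ i ∈ Finset.range ((j : ℕ) + 1), t i
          = ∑ i ∈ (Finset.range ((j : ℕ) + 1)).filter fun i => b ≤ 2 * i + 1, t i := by
            rw [Finset.sum_filter_of_ne]
            intro i _ hi
            by_contra hb'
            simp [ht, hb'] at hi
        _ = ∑ k ∈ ((Finset.range ((j : ℕ) + 1)).filter fun i => b ≤ 2 * i + 1).image
            (fun i : ℕ => 2 * i + 1 - b),
              schur k (oddPart y) * schur (2 * j + 1 - b - k) z := by
            rw [Finset.sum_image hinj]
            refine Finset.sum_congr rfl fun i hi => ?_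
            simp only [Finset.mem_filter, Finset.mem_range] at hi
            simp only [ht]
            rw [if_pos hi.2, if_pos (by omega)]
            congr 2; omega
        _ = _ := by
            apply Finset.sum_subset
            · intro k hk
              simp only [Finset.mem_image, Finset.mem_filter, Finset.mem_range] at hk ⊢
              omega
            · intro k hk hk'
              simp only [Finset.mem_image, Finset.mem_filter, Finset.mem_range, not_exists,
                not_and] at hk hk'
              -- An index missing from the image leaves an odd index for z.
              rw [schur_odd_eq_zero hz0, mul_zero]
              by_contra hodd
              rw [Nat.not_odd_iff_even] at hodd
              obtain ⟨c, hc⟩ := hodd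
              exact hk' (j - c) ⟨by omega, by omega⟩ (by omega)
    · symm
      refine Finset.sum_eq_zero fun i hi => ?_
      have : ¬ b ≤ 2 * i + 1 := by rw [Finset.mem_range] at hi; omega
      simp [ht, this]

/-- The columns normalized so that the rows `f` form the unit matrix. -/
def normalizedCols (N : ℕ) (f : Fin N → ℕ) (y : ℕ → ℂ) : Matrix ℕ (Fin N) ℂ :=
  schurCols N y * ((schurCols N y).submatrix f id)⁻¹

theorem schurCols_eq_normalizedCols_mul {N : ℕ} {f : Fin N → ℕ} {y : ℕ → ℂ}
    (h : schurMinor N f y ≠ 0) :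
    schurCols N y = normalizedCols N f y * (schurCols N y).submatrix f id := by
  rw [normalizedCols, Matrix.mul_assoc, Matrix.nonsing_inv_mul _ (isUnit_iff_ne_zero.mpr h),
    Matrix.mul_one]

/-- Cramer's rule: the numerator has row a in the place of the pivot row f c. -/
theorem normalizedCols_apply {N : ℕ} (f : Fin N → ℕ) (y : ℕ → ℂ) (a : ℕ) (c : Fin N) :
    normalizedCols N f y a c = schurMinor N (Function.update f c a) y / schurMinor N f y := by
  set A := (schurCols N y).submatrix f id with hA
  have h1 : (schurCols N y).submatrix (Function.update f c a) id =
      A.updateRow c (schurCols N y a) := by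
    ext i j
    by_cases h : i = c
    · subst h; simp
    · simp [h, hA]
  rw [schurMinor, schurMinor, h1, ← hA, ← Matrix.cramer_transpose_apply,
    Matrix.cramer_eq_adjugate_mulVec, ← Matrix.adjugate_transpose, normalizedCols, ← hA,
    Matrix.inv_def, Matrix.mul_apply, Matrix.mulVec, dotProduct, Finset.sum_div]
  refine Finset.sum_congr rfl fun j _ => ?_
  simp only [Matrix.smul_apply, Matrix.transpose_apply, Ring.inverse_eq_inv', smul_eq_mul]
  ring

theorem normalizedCols_apply_row {N : ℕ} {f : Fin N → ℕ} {y : ℕ → ℂ} (h : schurMinor N f y ≠ 0)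
    (i c : Fin N) : normalizedCols N f y (f i) c = if i = c then 1 else 0 := by
  have : (normalizedCols N f y).submatrix f id = 1 := by
    have := Matrix.mul_nonsing_inv ((schurCols N y).submatrix f id) (isUnit_iff_ne_zero.mpr h)
    rw [← this]
    rfl
  have := congrFun (congrFun this i) c
  simpa [Matrix.one_apply] using this

namespace Params

variable {P : Params}

/-- Column operations inside the blocks multiply the Gram matrix by block diagonal matrices on both
sides. -/
theorem det_gram_mul (G H : ∀ l, Matrix ℕ (Fin (P.N l)) ℂ)
    (B B' : ∀ l, Matrix (Fin (P.N l)) (Fin (P.N l)) ℂ) :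
    (P.gram (fun l => G l * B l) (fun l => H l * B' l)).det =
      conj (∏ l, (B l).det) * (∏ l, (B' l).det) * (P.gram G H).det := by
  have h : P.gram (fun l => G l * B l) (fun l => H l * B' l) =
      (Matrix.blockDiagonal' B).conjTranspose * (P.gram G H * Matrix.blockDiagonal' B') := by
    ext r s
    rw [Matrix.mul_apply]
    have h1 : ∀ q, (P.gram G H * Matrix.blockDiagonal' B') q s =
        ∑ a ∈ Finset.range P.rowBound, conj (G q.1 a q.2) *
          ∑ b ∈ Finset.range P.rowBound, P.pEntry q.1 s.1 a b * (H s.1 * B' s.1) b s.2 := by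
      intro q
      rw [Matrix.mul_apply, sum_mul_blockDiagonal']
      simp only [gram, Matrix.of_apply, Matrix.mul_apply, Finset.mul_sum, Finset.sum_mul]
      rw [Finset.sum_comm]
      refine Finset.sum_congr rfl fun a _ => ?_
      rw [Finset.sum_comm]
      refine Finset.sum_congr rfl fun b _ => Finset.sum_congr rfl fun j _ => ?_
      ring
    simp only [h1, Matrix.conjTranspose_apply]
    have h2 : ∀ f : (Σ l : Fin 2, Fin (P.N l)) → ℂ,
        ∑ q, star (Matrix.blockDiagonal' B q r) * f q =
        ∑ j, star (B r.1 j r.2) * f ⟨r.1, j⟩ := by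
      intro f
      have := congrArg (starRingEnd ℂ) (sum_mul_blockDiagonal' B (fun q => conj (f q)) r)
      simp only [map_sum, map_mul, Complex.conj_conj] at this
      simp only [mul_comm (star _)]
      exact this
    rw [h2]
    simp only [gram, Matrix.of_apply]
    simp only [Matrix.mul_apply (M := G r.1), map_sum, map_mul, Finset.sum_mul]
    rw [Finset.sum_comm]
    refine Finset.sum_congr rfl fun j _ => ?_
    rw [Finset.mul_sum]
    refine Finset.sum_congr rfl fun a _ => ?_
    rw [starRingEnd_apply, starRingEnd_apply]
    ring
  rw [h, Matrix.det_mul, Matrix.det_mul, Matrix.det_conjTranspose, det_blockDiagonal'_sigma,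
    det_blockDiagonal'_sigma, starRingEnd_apply]
  ring

variable (P) in
/-- The argument `x_l^+ - h_3^{[l,k]}` of the rows of `τ^{(k)}`. -/
def rowArg (A : ℝ) (p : ℝ × ℝ) (k : Option (Fin 2)) (l : Fin 2) (r : ℕ) : ℂ :=
  P.xPlus A p l r - P.h3 l k r

variable (P) in
/-- The argument `x_l^+ + h_3^{[l,k]}` of the columns of `τ^{(k)}`. -/
def colArg (A : ℝ) (p : ℝ × ℝ) (k : Option (Fin 2)) (l : Fin 2) (r : ℕ) : ℂ :=
  P.xPlus A p l r + P.h3 l k r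

/-- `S_{i-v}(y)`, understood as `0` for `v > i`. -/
def shiftedSchur (y : ℕ → ℂ) (i v : ℕ) : ℂ := if v ≤ i then schur (i - v) y else 0

/-- The triangular Toeplitz matrices (S_{i-v}) multiply like their generating series. This separates
the factor depending on (x,t) from h₁ and h₂, which make up `pEntry`. -/
theorem shiftedSchur_add (y h : ℕ → ℂ) {i v T : ℕ} (hi : i < T) :
    shiftedSchur (y + h) i v =
      ∑ a ∈ Finset.range T, shiftedSchur y i a * shiftedSchur h a v := by
  have hzero : ∀ a, ¬ (v ≤ a ∧ a ≤ i) → shiftedSchur y i a * shiftedSchur h a v = 0 := by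
    intro a ha
    unfold shiftedSchur
    split_ifs with h1 h2
    · exact absurd ⟨h2, h1⟩ ha
    · simp
    · simp
    · simp
  by_cases hv : v ≤ i
  · have hsub : Finset.Ico v (i + 1) ⊆ Finset.range T := by
      intro a ha; simp at ha ⊢; omega
    rw [← Finset.sum_subset hsub]
    · rw [Finset.sum_Ico_eq_sum_range, shiftedSchur, if_pos hv, add_comm y h, schur_add,
        show i + 1 - v = i - v + 1 by omega]
      refine Finset.sum_congr rfl fun k hk => ?_
      rw [Finset.mem_range] at hk
      rw [shiftedSchur, shiftedSchur, if_pos (by omega), if_pos (by omega), mul_comm]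
      congr 2 <;> omega
    · intro a _ ha
      refine hzero a fun h => ha ?_
      simp; omega
  · rw [shiftedSchur, if_neg hv, Finset.sum_eq_zero]
    intro a _
    exact hzero a (by omega)

/-- The zero values of `shiftedSchur` let all sums run to a common bound, so that they can be
interchanged. -/
theorem sum_range_min_eq (c : ℂ) (y z : ℕ → ℕ → ℂ) {i j T : ℕ} (hi : i < T) :
    ∑ v ∈ Finset.range (min i j + 1), conj (schur (i - v) (y v)) * (c ^ v * schur (j - v) (z v)) =
      ∑ v ∈ Finset.range T,
        conj (shiftedSchur (y v) i v) * (c ^ v * shiftedSchur (z v) j v) := by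
  have hsub : Finset.range (min i j + 1) ⊆ Finset.range T := by
    intro a ha; simp at ha ⊢; omega
  rw [← Finset.sum_subset hsub]
  · refine Finset.sum_congr rfl fun v hv => ?_
    rw [Finset.mem_range] at hv
    rw [shiftedSchur, shiftedSchur, if_pos (by omega), if_pos (by omega)]
  · intro v _ hv
    rw [Finset.mem_range] at hv
    have : ¬ v ≤ i ∨ ¬ v ≤ j := by omega
    rcases this with h | h
    · simp [shiftedSchur, h]
    · simp [shiftedSchur, h]

theorem pEntry_eq_sum (l m : Fin 2) {a b T : ℕ} (ha : a < T) :
    P.pEntry l m a b = 1 / (conj (P.chi l) - P.chi m) * ∑ v ∈ Finset.range T,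
      conj (shiftedSchur (P.h1 l m + v • P.h2 l m) a v) *
        ((conj (P.cst l m) * P.cst m l) ^ v *
          shiftedSchur (P.h1 m l + v • P.h2 m l) b v) := by
  rw [← sum_range_min_eq (conj (P.cst l m) * P.cst m l) (fun v => P.h1 l m + v • P.h2 l m)
    (fun v => P.h1 m l + v • P.h2 m l) ha, pEntry]
  congr 1
  refine Finset.sum_congr rfl fun v _ => ?_
  rw [schur_congr (z := fun r => P.h1 l m r + v * P.h2 l m r) (w := P.h1 l m + v • P.h2 l m)
    (fun r _ => by simp), schur_congr (z := fun r => P.h1 m l r + v * P.h2 m l r)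
    (w := P.h1 m l + v • P.h2 m l) (fun r _ => by simp), map_mul, map_pow]
  ring

theorem tauEntry_eq_sum (A : ℝ) (p : ℝ × ℝ) (k : Option (Fin 2)) (l m : Fin 2) {i j T : ℕ}
    (hi : i < T) : P.tauEntry A p k l m i j = 1 / (conj (P.chi l) - P.chi m) *
      ∑ v ∈ Finset.range T,
      conj (shiftedSchur (P.rowArg A p k l + (P.h1 l m + v • P.h2 l m)) i v) *
        ((conj (P.cst l m) * P.cst m l) ^ v *
          shiftedSchur (P.colArg A p k m + (P.h1 m l + v • P.h2 m l)) j v) := by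
  rw [← sum_range_min_eq (conj (P.cst l m) * P.cst m l) (fun v => P.rowArg A p k l + (P.h1 l m + v • P.h2 l m))
    (fun v => P.colArg A p k m + (P.h1 m l + v • P.h2 m l)) hi, tauEntry]
  congr 1
  refine Finset.sum_congr rfl fun v _ => ?_
  rw [conj_schur, schur_congr (z := fun r => conj (P.xPlus A p l r) + conj (P.h1 l m r) +
        v * conj (P.h2 l m r) - conj (P.h3 l k r))
      (w := fun r => conj ((P.rowArg A p k l + (P.h1 l m + v • P.h2 l m)) r))
      (fun r _ => by simp [rowArg]; ring),
    schur_congr (z := fun r => P.xPlus A p m r + P.h1 m l r + v * P.h2 m l r + P.h3 m k r)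
      (w := P.colArg A p k m + (P.h1 m l + v • P.h2 m l)) (fun r _ => by simp [colArg]; ring)]
  ring

/-- `τ^{(k)}` as the determinant of a product of matrices. -/
theorem tau_eq_det_gram (A : ℝ) (p : ℝ × ℝ) (k : Option (Fin 2)) :
    P.tau A p k = (P.gram (fun l => schurCols (P.N l) (P.rowArg A p k l))
      (fun l => schurCols (P.N l) (P.colArg A p k l))).det := by
  rw [tau]
  congr 1
  ext ⟨l, i⟩ ⟨m, j⟩
  simp only [gram, Matrix.of_apply]
  set T := P.rowBound with hT
  have hi : 2 * (i : ℕ) + 1 < T := lt_rowBound (l := l) (by omega)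
  have hj : 2 * (j : ℕ) + 1 < T := lt_rowBound (l := m) (by omega)
  have hcols : ∀ (N : ℕ) (y : ℕ → ℂ) (b : ℕ) (c : Fin N),
      schurCols N y b c = shiftedSchur y (2 * c + 1) b := fun N y b c => rfl
  simp only [hcols]
  rw [tauEntry_eq_sum A p k l m hi]
  simp only [shiftedSchur_add _ _ hi, shiftedSchur_add _ _ hj]
  have hp : ∀ a ∈ Finset.range T,
      conj (shiftedSchur (P.rowArg A p k l) (2 * i + 1) a) * ∑ b ∈ Finset.range T,
        P.pEntry l m a b * shiftedSchur (P.colArg A p k m) (2 * j + 1) b =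
      conj (shiftedSchur (P.rowArg A p k l) (2 * i + 1) a) * ∑ b ∈ Finset.range T,
        (1 / (conj (P.chi l) - P.chi m) * ∑ v ∈ Finset.range T,
      conj (shiftedSchur (P.h1 l m + v • P.h2 l m) a v) *
        ((conj (P.cst l m) * P.cst m l) ^ v *
          shiftedSchur (P.h1 m l + v • P.h2 m l) b v)) *
            shiftedSchur (P.colArg A p k m) (2 * j + 1) b := by
    intro a ha
    congr 1
    refine Finset.sum_congr rfl fun b _ => ?_
    rw [pEntry_eq_sum l m (by simpa using ha)]
  rw [Finset.sum_congr rfl hp]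
  simp only [map_sum, map_mul, Finset.mul_sum, Finset.sum_mul]
  rw [Finset.sum_comm]
  rw [Finset.sum_congr rfl fun b _ => Finset.sum_comm]
  rw [Finset.sum_comm]
  refine Finset.sum_congr rfl fun a _ => ?_
  refine Finset.sum_congr rfl fun b _ => ?_
  refine Finset.sum_congr rfl fun v _ => ?_
  ring

/-- The column operations have determinant 1, so the even entries of x⁺, and of h₃ with them, have
no influence on τ. -/
theorem tau_eq_det_gram_oddPart (A : ℝ) (p : ℝ × ℝ) (k : Option (Fin 2)) :
    P.tau A p k = (P.gram (fun l => schurCols (P.N l) (oddPart (P.rowArg A p k l)))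
      (fun l => schurCols (P.N l) (oddPart (P.colArg A p k l)))).det := by
  choose U hU hU' using fun l => schurCols_eq_oddPart_mul (P.N l) (P.rowArg A p k l)
  choose V hV hV' using fun l => schurCols_eq_oddPart_mul (P.N l) (P.colArg A p k l)
  rw [tau_eq_det_gram]
  simp only [hU', hV']
  rw [det_gram_mul]
  simp [hU, hV]

/-- `τ^{(k)}` in terms of normalized columns. -/
theorem tau_eq_mul_det_gram_normalizedCols (A : ℝ) (p : ℝ × ℝ) (k : Option (Fin 2))
    (f : ∀ l, Fin (P.N l) → ℕ)
    (hr : ∀ l, schurMinor (P.N l) (f l) (oddPart (P.rowArg A p k l)) ≠ 0)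
    (hc : ∀ l, schurMinor (P.N l) (f l) (oddPart (P.colArg A p k l)) ≠ 0) :
    P.tau A p k = conj (∏ l, schurMinor (P.N l) (f l) (oddPart (P.rowArg A p k l))) *
      (∏ l, schurMinor (P.N l) (f l) (oddPart (P.colArg A p k l))) *
      (P.gram (fun l => normalizedCols (P.N l) (f l) (oddPart (P.rowArg A p k l)))
        (fun l => normalizedCols (P.N l) (f l) (oddPart (P.colArg A p k l)))).det := by
  rw [tau_eq_det_gram_oddPart]
  have h1 := fun l => schurCols_eq_normalizedCols_mul (hr l)
  have h2 := fun l => schurCols_eq_normalizedCols_mul (hc l)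
  have := det_gram_mul (fun l => normalizedCols (P.N l) (f l) (oddPart (P.rowArg A p k l)))
    (fun l => normalizedCols (P.N l) (f l) (oddPart (P.colArg A p k l)))
    (fun l => (schurCols (P.N l) (oddPart (P.rowArg A p k l))).submatrix (f l) id)
    (fun l => (schurCols (P.N l) (oddPart (P.colArg A p k l))).submatrix (f l) id)
  simp only [← h1, ← h2] at this
  exact this

end Params

end

end CNLS

/-! ### Adler–Moser polynomials as minors -/

namespace CNLS

open Complex Filter Topology PowerSeries
open scoped ComplexConjugate

noncomputable section

/-- The argument `(z, 0, κ₃, 0, κ₅, …)` of the Adler--Moser entries. -/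
def oddArg (κ : ℕ → ℂ) (z : ℂ) (j : ℕ) : ℂ := if j = 1 then z else if Odd j then κ j else 0

/-- The Schur polynomial `S_n(z, 0, κ₃, 0, …)` as a polynomial in `z`. -/
def schurPoly (κ : ℕ → ℂ) (n : ℕ) : Polynomial ℂ :=
  ∑ k ∈ Finset.range (n + 1),
    Polynomial.monomial k (schur (n - k) (oddArg κ 0) / (k.factorial : ℂ))

theorem eval_schurPoly (κ : ℕ → ℂ) (n : ℕ) (z : ℂ) :
    (schurPoly κ n).eval z = schur n (oddArg κ z) := by
  have : oddArg κ z = (fun r => if r = 1 then z else 0) + oddArg κ 0 := by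
    funext r; simp only [oddArg, Pi.add_apply]; split_ifs <;> simp
  rw [this, schur_add, schurPoly, Polynomial.eval_finsetSum]
  refine Finset.sum_congr rfl fun k _ => ?_
  rw [Polynomial.eval_monomial, schur_single]; ring

theorem natDegree_schurPoly_le (κ : ℕ → ℂ) (n : ℕ) : (schurPoly κ n).natDegree ≤ n := by
  refine Polynomial.natDegree_sum_le_of_forall_le _ _ fun k hk => ?_
  rw [Finset.mem_range] at hk
  exact (Polynomial.natDegree_monomial_le _).trans (by omega)

theorem coeff_schurPoly (κ : ℕ → ℂ) (n : ℕ) :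
    (schurPoly κ n).coeff n = 1 / (n.factorial : ℂ) := by
  simp [schurPoly, Polynomial.finsetSum_coeff, Polynomial.coeff_monomial]

theorem derivative_schurPoly_zero (κ : ℕ → ℂ) : Polynomial.derivative (schurPoly κ 0) = 0 := by
  simp [schurPoly]

/-- Differentiation in z multiplies the generating series by ε. -/
theorem derivative_schurPoly_succ (κ : ℕ → ℂ) (n : ℕ) :
    Polynomial.derivative (schurPoly κ (n + 1)) = schurPoly κ n := by
  rw [schurPoly, Finset.sum_range_succ', schurPoly]
  simp only [Polynomial.derivative_add, Polynomial.derivative_sum, Polynomial.derivative_monomial]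
  simp only [Nat.cast_zero, mul_zero, map_zero, add_zero]
  refine Finset.sum_congr rfl fun k _ => ?_
  have h1 : ((k : ℂ) + 1) ≠ 0 := Nat.cast_add_one_ne_zero k
  have h2 : (k.factorial : ℂ) ≠ 0 := by exact_mod_cast k.factorial_ne_zero
  rw [Nat.add_sub_cancel, Nat.add_sub_add_right, Nat.factorial_succ]
  congr 1
  push_cast
  field_simp

theorem coeff_prod_sum {ι : Type*} (s : Finset ι) (f : ι → Polynomial ℂ) (d : ι → ℕ)
    (h : ∀ i ∈ s, (f i).natDegree ≤ d i) :
    (∏ i ∈ s, f i).natDegree ≤ ∑ i ∈ s, d i ∧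
      (∏ i ∈ s, f i).coeff (∑ i ∈ s, d i) = ∏ i ∈ s, (f i).coeff (d i) := by
  classical
  induction s using Finset.induction_on with
  | empty => simp
  | insert i s hi ih =>
    obtain ⟨h1, h2⟩ := ih fun j hj => h j (Finset.mem_insert_of_mem hj)
    have h3 := h i (Finset.mem_insert_self i s)
    rw [Finset.prod_insert hi, Finset.sum_insert hi, Finset.prod_insert hi]
    refine ⟨Polynomial.natDegree_mul_le_of_le h3 h1, ?_⟩
    rw [Polynomial.coeff_mul_add_eq_of_natDegree_le h3 h1, h2]

/-- The degree bound ∑ u - ∑ w is the same for every permutation product, so the coefficient in this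
degree is the determinant of the top coefficients. -/
theorem coeff_det_of_weights {N : ℕ} (M : Matrix (Fin N) (Fin N) (Polynomial ℂ)) (u w : Fin N → ℕ)
    (h1 : ∀ i j, w i ≤ u j → (M i j).natDegree ≤ u j - w i)
    (h2 : ∀ i j, ¬ w i ≤ u j → M i j = 0) {D : ℕ} (hD : D + ∑ i, w i = ∑ j, u j) :
    M.det.natDegree ≤ D ∧
      M.det.coeff D = (Matrix.of fun i j => (M i j).coeff (u j - w i)).det := by
  have key : ∀ σ : Equiv.Perm (Fin N), (∏ i, M (σ i) i).natDegree ≤ D ∧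
      (∏ i, M (σ i) i).coeff D = ∏ i, (M (σ i) i).coeff (u i - w (σ i)) := by
    intro σ
    by_cases hσ : ∀ i, w (σ i) ≤ u i
    · have : D = ∑ i, (u i - w (σ i)) := by
        have e1 : ∑ i, (u i - w (σ i)) + ∑ i, w (σ i) = ∑ i, u i := by
          rw [← Finset.sum_add_distrib]
          exact Finset.sum_congr rfl fun i _ => Nat.sub_add_cancel (hσ i)
        have e2 : ∑ i, w (σ i) = ∑ i, w i := Equiv.sum_comp σ w
        omega
      rw [this]
      exact coeff_prod_sum _ _ _ fun i _ => h1 _ _ (hσ i)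
    · push Not at hσ
      obtain ⟨i, hi⟩ := hσ
      have hz := h2 (σ i) i (not_le.mpr hi)
      have e1 : ∏ i, M (σ i) i = 0 := Finset.prod_eq_zero (Finset.mem_univ i) hz
      have e2 : ∏ i, (M (σ i) i).coeff (u i - w (σ i)) = 0 :=
        Finset.prod_eq_zero (Finset.mem_univ i) (by rw [hz, Polynomial.coeff_zero])
      rw [e1, e2]
      simp
  constructor
  · rw [Matrix.det_apply']
    refine Polynomial.natDegree_sum_le_of_forall_le _ _ fun σ _ => ?_
    rw [← Polynomial.C_eq_intCast]
    exact (Polynomial.natDegree_C_mul_le _ _).trans (key σ).1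
  · rw [Matrix.det_apply', Matrix.det_apply', Polynomial.finsetSum_coeff]
    refine Finset.sum_congr rfl fun σ _ => ?_
    rw [← Polynomial.C_eq_intCast, Polynomial.coeff_C_mul, (key σ).2]
    simp

theorem derivative_det {N : ℕ} (M : Matrix (Fin N) (Fin N) (Polynomial ℂ)) :
    Polynomial.derivative M.det =
      ∑ i, (M.updateCol i fun k => Polynomial.derivative (M k i)).det := by
  simp only [Matrix.det_apply']
  rw [Polynomial.derivative_sum, Finset.sum_comm]
  refine Finset.sum_congr rfl fun σ _ => ?_
  rw [← Polynomial.C_eq_intCast, Polynomial.derivative_C_mul, Polynomial.derivative_prod_finset,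
    Finset.mul_sum]
  refine Finset.sum_congr rfl fun i _ => ?_
  rw [← Finset.mul_prod_erase _ _ (Finset.mem_univ i), Matrix.updateCol_self, mul_comm
    (Polynomial.derivative _)]
  congr 2
  refine Finset.prod_congr rfl fun j hj => ?_
  rw [Matrix.updateCol_ne (Finset.ne_of_mem_erase hj)]

/-- The minor `schurMinor N f` at `(z, 0, κ₃, 0, …)` as a polynomial in `z`. -/
def minorPoly (N : ℕ) (f : Fin N → ℕ) (κ : ℕ → ℂ) : Polynomial ℂ :=
  (Matrix.of fun i j : Fin N =>
    if f i ≤ 2 * (j : ℕ) + 1 then schurPoly κ (2 * j + 1 - f i) else 0).det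

theorem eval_minorPoly (N : ℕ) (f : Fin N → ℕ) (κ : ℕ → ℂ) (z : ℂ) :
    (minorPoly N f κ).eval z = schurMinor N f (oddArg κ z) := by
  rw [minorPoly, ← Polynomial.coe_evalRingHom, RingHom.map_det, schurMinor]
  congr 1
  ext i j
  simp only [RingHom.mapMatrix_apply, Matrix.map_apply, Matrix.of_apply, schurCols,
    Matrix.submatrix_apply, id]
  split_ifs
  · exact eval_schurPoly _ _ _
  · simp

/-- The rows `1, …, N`. -/
def baseRows (N : ℕ) (i : Fin N) : ℕ := i

/-- The rows `1, …, N - 1, N + 1`. -/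
def shiftedRows (N : ℕ) (i : Fin N) : ℕ := if (i : ℕ) + 1 = N then N else i

/-- Differentiating a row turns it into the next one. In every row but the last this creates two
equal rows, so a single term remains. -/
theorem derivative_minorPoly_baseRows {N : ℕ} (hN : 0 < N) (κ : ℕ → ℂ) :
    Polynomial.derivative (minorPoly N (baseRows N) κ) = minorPoly N (shiftedRows N) κ := by
  obtain ⟨n, rfl⟩ : ∃ n, N = n + 1 := ⟨N - 1, by omega⟩
  set E : ℕ → ℕ → Polynomial ℂ := fun b j =>
    if b ≤ 2 * j + 1 then schurPoly κ (2 * j + 1 - b) else 0 with hE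
  have hdE : ∀ b j, Polynomial.derivative (E b j) = E (b + 1) j := by
    intro b j
    simp only [hE]
    by_cases h : b + 1 ≤ 2 * j + 1
    · rw [if_pos h, if_pos (by omega), show 2 * j + 1 - b = (2 * j + 1 - (b + 1)) + 1 by omega,
        derivative_schurPoly_succ]
    · rw [if_neg h]
      split_ifs with h'
      · rw [show 2 * j + 1 - b = 0 by omega, derivative_schurPoly_zero]
      · simp
  rw [minorPoly, ← Matrix.det_transpose, derivative_det, Finset.sum_eq_single (Fin.last n)]
  · rw [minorPoly, ← Matrix.det_transpose (Matrix.of _)]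
    refine congrArg Matrix.det (Matrix.ext fun i j => ?_)
    change _ = E (shiftedRows (n + 1) j) i
    by_cases hj : j = Fin.last n
    · subst hj
      rw [Matrix.updateCol_self]
      change Polynomial.derivative (E (baseRows (n + 1) (Fin.last n)) i) = _
      rw [hdE]
      simp [baseRows, shiftedRows]
    · rw [Matrix.updateCol_ne hj]
      change E (baseRows (n + 1) j) i = _
      have : (j : ℕ) ≠ n := fun h => hj (Fin.ext (by simpa using h))
      simp [baseRows, shiftedRows, this]
  · intro i _ hi
    have hlt : (i : ℕ) + 1 < n + 1 := by
      have : (i : ℕ) ≠ n := fun h => hi (Fin.ext (by simpa using h))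
      omega
    refine Matrix.det_zero_of_column_eq (i := i) (j := ⟨i + 1, hlt⟩) ?_ fun k => ?_
    · intro h
      have := congrArg Fin.val h
      simp at this
    · rw [Matrix.updateCol_self, Matrix.updateCol_ne (by
        intro h; have := congrArg Fin.val h; simp at this)]
      change Polynomial.derivative (E (baseRows (n + 1) i) k) = E (i + 1) k
      rw [hdE]
      simp [baseRows]
  · simp

theorem sum_two_mul_add_one (N : ℕ) : ∑ j : Fin N, (2 * (j : ℕ) + 1) = N * N := by
  rw [Fin.sum_univ_eq_sum_range (fun j => 2 * j + 1) N]
  induction N with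
  | zero => simp
  | succ n ih => rw [Finset.sum_range_succ, ih]; ring

theorem half_add_sum_baseRows (N : ℕ) :
    N * (N + 1) / 2 + ∑ i, baseRows N i = ∑ j : Fin N, (2 * (j : ℕ) + 1) := by
  rw [sum_two_mul_add_one]
  have h : ∑ i, baseRows N i = ∑ i ∈ Finset.range N, i :=
    Fin.sum_univ_eq_sum_range (fun i => i) N
  have h2 := Finset.sum_range_id_mul_two N
  have h3 : 2 ∣ N * (N + 1) := (Nat.even_mul_succ_self N).two_dvd
  have h4 : N * (N + 1) + N * (N - 1) = 2 * (N * N) := by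
    cases N with
    | zero => simp
    | succ n => simp only [Nat.add_sub_cancel]; ring
  omega

/-- Since 1 / (m - i)! is the falling factorial of m of length i divided by m!, with m = 2j + 1, the
determinant is up to nonzero factors a Vandermonde determinant at distinct odd points. It is the
coefficient of degree N(N+1)/2 of the top minor. -/
theorem det_inv_factorial_ne_zero (N : ℕ) : (Matrix.of fun i j : Fin N =>
    if (i : ℕ) ≤ 2 * (j : ℕ) + 1 then
      1 / ((2 * (j : ℕ) + 1 - (i : ℕ)).factorial : ℂ) else 0).det ≠ 0 := by
  have h : (Matrix.of fun i j : Fin N => if (i : ℕ) ≤ 2 * (j : ℕ) + 1 then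
      1 / ((2 * (j : ℕ) + 1 - (i : ℕ)).factorial : ℂ) else 0) = Matrix.of fun i j : Fin N =>
      (fun j : Fin N => 1 / ((2 * (j : ℕ) + 1).factorial : ℂ)) j *
        (Matrix.of fun j i : Fin N => (descPochhammer ℂ i).eval
          ((2 * (j : ℕ) + 1 : ℕ) : ℂ)).transpose i j := by
    ext i j
    simp only [Matrix.of_apply, Matrix.transpose_apply]
    rw [descPochhammer_eval_eq_descFactorial]
    split_ifs with hij
    · have := Nat.factorial_mul_descFactorial hij
      have h1 : ((2 * (j : ℕ) + 1 - (i : ℕ)).factorial : ℂ) ≠ 0 := by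
        exact_mod_cast Nat.factorial_ne_zero _
      have h2 : ((2 * (j : ℕ) + 1).factorial : ℂ) ≠ 0 := by exact_mod_cast Nat.factorial_ne_zero _
      rw [← this] at h2 ⊢
      push_cast at h2 ⊢
      have h3 := right_ne_zero_of_mul h2
      field_simp
    · rw [Nat.descFactorial_of_lt (not_le.mp hij)]; simp
  rw [h, Matrix.det_mul_row, Matrix.det_transpose,
    ← Matrix.det_eval_matrixOfPolynomials_eq_det_vandermonde _ _
      (fun i => descPochhammer_natDegree _ _) (fun i => monic_descPochhammer ℂ _)]
  refine mul_ne_zero (Finset.prod_ne_zero_iff.mpr fun j _ => ?_) ?_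
  · exact div_ne_zero one_ne_zero (by exact_mod_cast Nat.factorial_ne_zero _)
  · rw [Matrix.det_vandermonde_ne_zero_iff]
    intro i j hij
    have hij' : ((2 * (i : ℕ) + 1 : ℕ) : ℂ) = ((2 * (j : ℕ) + 1 : ℕ) : ℂ) := hij
    have : 2 * (i : ℕ) + 1 = 2 * (j : ℕ) + 1 := by exact_mod_cast hij'
    exact Fin.ext (by omega)

theorem natDegree_minorPoly_baseRows (N : ℕ) (κ : ℕ → ℂ) :
    (minorPoly N (baseRows N) κ).natDegree = N * (N + 1) / 2 := by
  have h := coeff_det_of_weights (Matrix.of fun i j : Fin N =>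
    if baseRows N i ≤ 2 * (j : ℕ) + 1 then schurPoly κ (2 * j + 1 - baseRows N i) else 0)
    (fun j => 2 * j + 1) (baseRows N) (fun i j hij => by
      simp only [Matrix.of_apply, if_pos hij]; exact natDegree_schurPoly_le _ _)
    (fun i j hij => by simp only [Matrix.of_apply, if_neg hij]) (half_add_sum_baseRows N)
  apply Polynomial.natDegree_eq_of_le_of_coeff_ne_zero h.1
  rw [h.2]
  intro e
  apply det_inv_factorial_ne_zero N
  refine Eq.trans ?_ e
  refine congrArg Matrix.det (Matrix.ext fun i j => ?_)
  change (if (i : ℕ) ≤ 2 * (j : ℕ) + 1 then _ else _) = Polynomial.coeff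
    (if (i : ℕ) ≤ 2 * (j : ℕ) + 1 then schurPoly κ (2 * j + 1 - i) else 0) (2 * j + 1 - i)
  symm
  split_ifs
  · exact coeff_schurPoly _ _
  · simp

theorem minorPoly_baseRows_ne_zero (N : ℕ) (κ : ℕ → ℂ) : minorPoly N (baseRows N) κ ≠ 0 := by
  rcases Nat.eq_zero_or_pos N with rfl | hN
  · simp [minorPoly]
  · intro h
    have h1 := natDegree_minorPoly_baseRows N κ
    rw [h, Polynomial.natDegree_zero] at h1
    have : 2 ≤ N * (N + 1) := by nlinarith
    omega

/-- The normalization constant of the Adler--Moser polynomials. -/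
def adlerMoserConst (N : ℕ) : ℂ :=
  ∏ k ∈ Finset.Icc 1 N, (Nat.doubleFactorial (2 * k - 1) : ℂ)

theorem adlerMoserConst_ne_zero (N : ℕ) : adlerMoserConst N ≠ 0 :=
  Finset.prod_ne_zero_iff.mpr fun k _ => by
    exact_mod_cast (Nat.doubleFactorial_pos _).ne'

/-- Transposition turns φ_{2i-j} into the Schur columns; with indices from 0 both have the subscript
2j + 1 - i. -/
theorem adlerMoser_eq (N : ℕ) (κ : ℕ → ℂ) (z : ℂ) :
    adlerMoser N κ z = adlerMoserConst N * (minorPoly N (baseRows N) κ).eval z := by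
  rw [adlerMoser, adlerMoserConst, eval_minorPoly, schurMinor, ← Matrix.det_transpose]
  congr 2
  ext i j
  simp only [Matrix.transpose_apply, Matrix.of_apply, Matrix.submatrix_apply, schurCols,
    adlerMoserEntry, id, baseRows]
  by_cases h : (i : ℕ) ≤ 2 * (j : ℕ) + 1
  · rw [if_neg (by omega), if_pos h]
    congr 1
    omega
  · rw [if_pos (by omega), if_neg h]

section roots

variable {N : ℕ} {κ : ℕ → ℂ}

theorem adlerMoser_eq_zero_iff (z : ℂ) :
    adlerMoser N κ z = 0 ↔ (minorPoly N (baseRows N) κ).eval z = 0 := by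
  rw [adlerMoser_eq, mul_eq_zero, or_iff_right (adlerMoserConst_ne_zero N)]

theorem deriv_adlerMoser (z : ℂ) : deriv (adlerMoser N κ) z =
    adlerMoserConst N * (Polynomial.derivative (minorPoly N (baseRows N) κ)).eval z := by
  have : adlerMoser N κ = fun z => adlerMoserConst N * (minorPoly N (baseRows N) κ).eval z :=
    funext (adlerMoser_eq N κ)
  rw [this, deriv_const_mul _ (Polynomial.differentiableAt _), Polynomial.deriv]

variable (N κ) in
/-- The roots of the Adler--Moser polynomial as a finite set. -/
def rootSet : Finset ℂ := (minorPoly N (baseRows N) κ).roots.toFinset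

theorem mem_rootSet (z : ℂ) : z ∈ rootSet N κ ↔ adlerMoser N κ z = 0 := by
  rw [adlerMoser_eq_zero_iff, rootSet, Multiset.mem_toFinset,
    Polynomial.mem_roots (minorPoly_baseRows_ne_zero N κ), Polynomial.IsRoot.def]

theorem nodup_roots (h : ∀ z, adlerMoser N κ z = 0 → deriv (adlerMoser N κ) z ≠ 0) :
    (minorPoly N (baseRows N) κ).roots.Nodup := by
  rw [Multiset.nodup_iff_count_le_one]
  intro z
  rw [Polynomial.count_roots]
  by_contra hlt
  push Not at hlt
  rw [Polynomial.one_lt_rootMultiplicity_iff_isRoot (minorPoly_baseRows_ne_zero N κ)] at hlt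
  refine h z ((adlerMoser_eq_zero_iff z).mpr hlt.1) ?_
  rw [deriv_adlerMoser, Polynomial.IsRoot.def.mp hlt.2, mul_zero]

theorem card_rootSet (h : ∀ z, adlerMoser N κ z = 0 → deriv (adlerMoser N κ) z ≠ 0) :
    (rootSet N κ).card = N * (N + 1) / 2 := by
  rw [rootSet, Multiset.toFinset_card_of_nodup (nodup_roots h), ← natDegree_minorPoly_baseRows N κ]
  exact (IsAlgClosed.splits _).natDegree_eq_card_roots.symm

theorem eval_minorPoly_eq_prod (h : ∀ z, adlerMoser N κ z = 0 → deriv (adlerMoser N κ) z ≠ 0)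
    (x : ℂ) : (minorPoly N (baseRows N) κ).eval x =
      (minorPoly N (baseRows N) κ).leadingCoeff * ∏ z ∈ rootSet N κ, (x - z) := by
  conv_lhs => rw [(IsAlgClosed.splits (minorPoly N (baseRows N) κ)).eq_prod_roots]
  rw [Polynomial.eval_mul, Polynomial.eval_C, Polynomial.eval_multiset_prod, rootSet,
    Multiset.map_map, Finset.prod_eq_multiset_prod, Multiset.toFinset_val,
    (nodup_roots h).dedup]
  simp

end roots

end

end CNLS

/-! ### Weighted growth of Schur polynomials and minors -/

namespace CNLS

open Complex Filter Topology PowerSeries Asymptotics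
open scoped ComplexConjugate

noncomputable section

section general

variable {α : Type*} {F : Filter α}

/-- Telescoping over the factors. -/
theorem isBigO_prod_sub_prod {ι : Type*} (s : Finset ι) {f g : ι → α → ℂ} {h : ι → α → ℝ}
    {ε : α → ℝ} (hf : ∀ i ∈ s, f i =O[F] h i) (hg : ∀ i ∈ s, g i =O[F] h i)
    (hfg : ∀ i ∈ s, (fun a => f i a - g i a) =O[F] fun a => h i a * ε a) :
    (fun a => ∏ i ∈ s, f i a - ∏ i ∈ s, g i a) =O[F] fun a => (∏ i ∈ s, h i a) * ε a := by
  classical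
  induction s using Finset.induction_on with
  | empty => simpa using isBigO_zero _ _
  | insert i s hi ih =>
    simp only [Finset.prod_insert hi]
    have h1 := ih (fun j hj => hf j (Finset.mem_insert_of_mem hj))
      (fun j hj => hg j (Finset.mem_insert_of_mem hj))
      (fun j hj => hfg j (Finset.mem_insert_of_mem hj))
    have h2 : (fun a => ∏ j ∈ s, f j a) =O[F] fun a => ∏ j ∈ s, h j a :=
      IsBigO.finsetProd fun j hj => hf j (Finset.mem_insert_of_mem hj)
    have h3 := (hfg i (Finset.mem_insert_self i s)).mul h2
    have h4 := (hg i (Finset.mem_insert_self i s)).mul h1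
    have h5 : (fun a => (f i a - g i a) * ∏ j ∈ s, f j a) =O[F]
        fun a => h i a * (∏ j ∈ s, h j a) * ε a := h3.congr_right fun a => by ring
    have h6 : (fun a => g i a * (∏ j ∈ s, f j a - ∏ j ∈ s, g j a)) =O[F]
        fun a => h i a * (∏ j ∈ s, h j a) * ε a := h4.congr_right fun a => by ring
    exact (h5.add h6).congr_left fun a => by ring

theorem isBigO_det {n : Type*} [Fintype n] [DecidableEq n] {M : α → Matrix n n ℂ}
    {h : n → n → α → ℝ} {H : α → ℝ} (hM : ∀ i j, (fun a => M a i j) =O[F] h i j)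
    (hH : ∀ σ : Equiv.Perm n, (fun a => ∏ i, h (σ i) i a) =O[F] H) :
    (fun a => (M a).det) =O[F] H := by
  simp only [Matrix.det_apply']
  refine IsBigO.fun_sum fun σ _ => IsBigO.const_mul_left ?_ _
  exact (IsBigO.finsetProd fun i _ => hM (σ i) i).trans (hH σ)

theorem isBigO_det_sub_det {n : Type*} [Fintype n] [DecidableEq n] {M M' : α → Matrix n n ℂ}
    {h : n → n → α → ℝ} {H ε : α → ℝ} (hM : ∀ i j, (fun a => M a i j) =O[F] h i j)
    (hM' : ∀ i j, (fun a => M' a i j) =O[F] h i j)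
    (hMM' : ∀ i j, (fun a => M a i j - M' a i j) =O[F] fun a => h i j a * ε a)
    (hH : ∀ σ : Equiv.Perm n, (fun a => ∏ i, h (σ i) i a) =O[F] H) :
    (fun a => (M a).det - (M' a).det) =O[F] fun a => H a * ε a := by
  simp only [Matrix.det_apply', ← Finset.sum_sub_distrib, ← mul_sub]
  refine IsBigO.fun_sum fun σ _ => IsBigO.const_mul_left ?_ _
  exact (isBigO_prod_sub_prod _ (fun i _ => hM (σ i) i) (fun i _ => hM' (σ i) i)
    (fun i _ => hMM' (σ i) i)).trans ((hH σ).mul (isBigO_refl _ _))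

variable {Λ : α → ℝ}

theorem isBigO_schur {y : α → ℕ → ℂ}
    (hy : ∀ r, r ≠ 0 → (fun a => y a r) =O[F] fun a => Λ a ^ r) (n : ℕ) :
    (fun a => schur n (y a)) =O[F] fun a => Λ a ^ n := by
  induction n using Nat.strong_induction_on with
  | _ n ih =>
    cases n with
    | zero => simpa using isBigO_const_const (1 : ℂ) (one_ne_zero (α := ℝ)) F
    | succ n =>
      have hn : ((n : ℂ) + 1) ≠ 0 := Nat.cast_add_one_ne_zero n
      have : ∀ a, schur (n + 1) (y a) = ((n : ℂ) + 1)⁻¹ * ∑ k ∈ Finset.range (n + 1),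
          schur k (y a) * (((n - k : ℕ) + 1 : ℂ) * y a (n - k + 1)) := fun a => by
        rw [← schur_succ, inv_mul_cancel_left₀ hn]
      simp only [this]
      refine IsBigO.const_mul_left (IsBigO.fun_sum fun k hk => ?_) _
      rw [Finset.mem_range] at hk
      refine ((ih k hk).mul ((hy (n - k + 1) (by omega)).const_mul_left _)).congr_right fun a => ?_
      rw [← pow_add]; congr 1; omega

/-- The number e is a gain in weight. For n ≠ 0 every term of the recursion contains an entry of y,
so one gain survives. -/
theorem isBigO_schur_of_small (hΛ : ∀ a, 0 < Λ a) {y : α → ℕ → ℂ} {e : ℤ}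
    (hy : ∀ r, r ≠ 0 → (fun a => y a r) =O[F] fun a => Λ a ^ r)
    (hy' : ∀ r, r ≠ 0 → (fun a => y a r) =O[F] fun a => Λ a ^ ((r : ℤ) - e)) {n : ℕ} (hn : n ≠ 0) :
    (fun a => schur n (y a)) =O[F] fun a => Λ a ^ ((n : ℤ) - e) := by
  obtain ⟨n, rfl⟩ := Nat.exists_eq_succ_of_ne_zero hn
  have hn : ((n : ℂ) + 1) ≠ 0 := Nat.cast_add_one_ne_zero n
  have : ∀ a, schur (n + 1) (y a) = ((n : ℂ) + 1)⁻¹ * ∑ k ∈ Finset.range (n + 1),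
      schur k (y a) * (((n - k : ℕ) + 1 : ℂ) * y a (n - k + 1)) := fun a => by
    rw [← schur_succ, inv_mul_cancel_left₀ hn]
  simp only [Nat.succ_eq_add_one, this]
  refine IsBigO.const_mul_left (IsBigO.fun_sum fun k hk => ?_) _
  rw [Finset.mem_range] at hk
  refine ((isBigO_schur hy k).mul ((hy' (n - k + 1) (by omega)).const_mul_left _)).congr_right
    fun a => ?_
  rw [← zpow_natCast, ← zpow_add₀ (hΛ a).ne']; congr 1; push_cast [Nat.le_of_lt_succ hk]; ring

/-- By additivity the difference is ∑_{k<n} S_k(y') S_{n-k}(y - y'), where the second factor has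
positive index. -/
theorem isBigO_schur_sub (hΛ : ∀ a, 0 < Λ a) {y y' : α → ℕ → ℂ} {e : ℤ}
    (hy : ∀ r, r ≠ 0 → (fun a => y a r) =O[F] fun a => Λ a ^ r)
    (hy' : ∀ r, r ≠ 0 → (fun a => y' a r) =O[F] fun a => Λ a ^ r)
    (hyy' : ∀ r, r ≠ 0 → (fun a => y a r - y' a r) =O[F] fun a => Λ a ^ ((r : ℤ) - e)) (n : ℕ) :
    (fun a => schur n (y a) - schur n (y' a)) =O[F] fun a => Λ a ^ ((n : ℤ) - e) := by
  have : ∀ a, schur n (y a) - schur n (y' a) = ∑ k ∈ Finset.range n,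
      schur k (y' a) * schur (n - k) (y a - y' a) := fun a => by
    conv_lhs => rw [show y a = y' a + (y a - y' a) by ring]
    rw [schur_add, Finset.sum_range_succ, Nat.sub_self, schur_zero]; ring
  simp only [this]
  refine IsBigO.fun_sum fun k hk => ?_
  rw [Finset.mem_range] at hk
  have h1 := isBigO_schur_of_small hΛ (y := fun a => y a - y' a)
    (fun r hr => (hy r hr).sub (hy' r hr)) hyy' (n := n - k) (by omega)
  refine ((isBigO_schur hy' k).mul h1).congr_right fun a => ?_
  rw [← zpow_natCast, ← zpow_add₀ (hΛ a).ne']; congr 1; push_cast [hk.le]; ring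

/-- The weight `∑ (2j-1) - ∑ (row indices)` of the minor `schurMinor N f`. -/
def minorWeight (N : ℕ) (f : Fin N → ℕ) : ℤ := ∑ j : Fin N, (2 * (j : ℤ) + 1) - ∑ i, (f i : ℤ)

theorem isBigO_schurCols {y : α → ℕ → ℂ}
    (hy : ∀ r, r ≠ 0 → (fun a => y a r) =O[F] fun a => Λ a ^ r) {N : ℕ} (b : ℕ) (j : Fin N) :
    (fun a => schurCols N (y a) b j) =O[F] fun a => Λ a ^ (2 * (j : ℤ) + 1 - b) := by
  simp only [schurCols, Matrix.of_apply]
  split_ifs with h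
  · refine (isBigO_schur hy _).congr_right fun a => ?_
    rw [← zpow_natCast]; congr 1; push_cast [h]; ring
  · exact isBigO_zero _ _

theorem isBigO_schurCols_sub (hΛ : ∀ a, 0 < Λ a) {y y' : α → ℕ → ℂ} {e : ℤ}
    (hy : ∀ r, r ≠ 0 → (fun a => y a r) =O[F] fun a => Λ a ^ r)
    (hy' : ∀ r, r ≠ 0 → (fun a => y' a r) =O[F] fun a => Λ a ^ r)
    (hyy' : ∀ r, r ≠ 0 → (fun a => y a r - y' a r) =O[F] fun a => Λ a ^ ((r : ℤ) - e))
    {N : ℕ} (b : ℕ) (j : Fin N) :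
    (fun a => schurCols N (y a) b j - schurCols N (y' a) b j) =O[F]
      fun a => Λ a ^ (2 * (j : ℤ) + 1 - b) * Λ a ^ (-e) := by
  simp only [schurCols, Matrix.of_apply]
  split_ifs with h
  · refine (isBigO_schur_sub hΛ hy hy' hyy' _).congr_right fun a => ?_
    rw [← zpow_add₀ (hΛ a).ne']; congr 1; push_cast [h]; ring
  · simpa using isBigO_zero _ _

theorem prod_weights (hΛ : ∀ a, 0 < Λ a) {N : ℕ} (f : Fin N → ℕ) (σ : Equiv.Perm (Fin N)) (a : α) :
    ∏ i : Fin N, Λ a ^ (2 * (i : ℤ) + 1 - f (σ i)) = Λ a ^ minorWeight N f := by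
  have : ∀ (s : Finset (Fin N)) (g : Fin N → ℤ), ∏ i ∈ s, Λ a ^ g i = Λ a ^ ∑ i ∈ s, g i := by
    intro s g
    induction s using Finset.induction_on with
    | empty => simp
    | insert i s hi ih => rw [Finset.prod_insert hi, Finset.sum_insert hi, ih, zpow_add₀ (hΛ a).ne']
  rw [this, minorWeight, Finset.sum_sub_distrib, Equiv.sum_comp σ fun i : Fin N => (f i : ℤ)]

theorem isBigO_schurMinor (hΛ : ∀ a, 0 < Λ a) {y : α → ℕ → ℂ}
    (hy : ∀ r, r ≠ 0 → (fun a => y a r) =O[F] fun a => Λ a ^ r) {N : ℕ} (f : Fin N → ℕ) :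
    (fun a => schurMinor N f (y a)) =O[F] fun a => Λ a ^ minorWeight N f := by
  refine isBigO_det (h := fun (i j : Fin N) a => Λ a ^ (2 * (j : ℤ) + 1 - f i)) (fun i j => ?_) fun σ => ?_
  · exact isBigO_schurCols hy (f i) j
  · simp only [prod_weights hΛ]; exact isBigO_refl _ _

theorem isBigO_schurMinor_sub (hΛ : ∀ a, 0 < Λ a) {y y' : α → ℕ → ℂ} {e : ℤ}
    (hy : ∀ r, r ≠ 0 → (fun a => y a r) =O[F] fun a => Λ a ^ r)
    (hy' : ∀ r, r ≠ 0 → (fun a => y' a r) =O[F] fun a => Λ a ^ r)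
    (hyy' : ∀ r, r ≠ 0 → (fun a => y a r - y' a r) =O[F] fun a => Λ a ^ ((r : ℤ) - e))
    {N : ℕ} (f : Fin N → ℕ) :
    (fun a => schurMinor N f (y a) - schurMinor N f (y' a)) =O[F]
      fun a => Λ a ^ (minorWeight N f - e) := by
  have := isBigO_det_sub_det (F := F) (M := fun a => (schurCols N (y a)).submatrix f id)
    (M' := fun a => (schurCols N (y' a)).submatrix f id)
    (h := fun (i j : Fin N) a => Λ a ^ (2 * (j : ℤ) + 1 - f i)) (H := fun a => Λ a ^ minorWeight N f)
    (ε := fun a => Λ a ^ (-e)) (fun i j => isBigO_schurCols hy (f i) j)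
    (fun i j => isBigO_schurCols hy' (f i) j)
    (fun i j => isBigO_schurCols_sub hΛ hy hy' hyy' (f i) j) (fun σ => by
      simp only [prod_weights hΛ]; exact isBigO_refl _ _)
  refine this.congr_right fun a => ?_
  rw [← zpow_add₀ (hΛ a).ne', sub_eq_add_neg]

theorem minorWeight_update {N : ℕ} (f : Fin N → ℕ) (c : Fin N) (b : ℕ) :
    minorWeight N (Function.update f c b) = minorWeight N f + f c - b := by
  have h : ∑ i, ((Function.update f c b i : ℕ) : ℤ) + f c = ∑ i, (f i : ℤ) + b := by
    rw [← Finset.add_sum_erase _ _ (Finset.mem_univ c),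
      ← Finset.add_sum_erase (a := c) _ (fun i => (f i : ℤ)) (Finset.mem_univ c)]
    have : ∑ i ∈ Finset.univ.erase c, ((Function.update f c b i : ℕ) : ℤ) =
        ∑ i ∈ Finset.univ.erase c, (f i : ℤ) :=
      Finset.sum_congr rfl fun i hi => by
        rw [Function.update_of_ne (Finset.ne_of_mem_erase hi)]
    rw [this, Function.update_self]; ring
  unfold minorWeight
  linarith

/-- Entries of the normalized columns below the pivot rows are small. -/
theorem isBigO_normalizedCols (hΛ : ∀ a, 1 ≤ Λ a) {y : α → ℕ → ℂ}
    (hy : ∀ r, r ≠ 0 → (fun a => y a r) =O[F] fun a => Λ a ^ r) {N : ℕ} (f : Fin N → ℕ)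
    {b : ℕ} {c : Fin N} (hb : f c < b) :
    (fun a => normalizedCols N f (y a) b c) =O[F]
      fun a => Λ a ^ (minorWeight N f - 1) * ‖schurMinor N f (y a)‖⁻¹ := by
  have hΛ0 : ∀ a, 0 < Λ a := fun a => one_pos.trans_le (hΛ a)
  simp only [normalizedCols_apply, div_eq_mul_inv]
  refine IsBigO.mul ?_ (isBigO_of_le _ fun a => by simp)
  refine (isBigO_schurMinor hΛ0 hy _).trans (isBigO_of_le _ fun a => ?_)
  rw [Real.norm_of_nonneg (zpow_nonneg (hΛ0 a).le _), Real.norm_of_nonneg (zpow_nonneg (hΛ0 a).le _),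
    minorWeight_update]
  exact zpow_le_zpow_right₀ (hΛ a) (by omega)

end general

/-- Weighted homogeneity of the minors. -/
theorem schurMinor_scale {N : ℕ} (f : Fin N → ℕ) {c : ℂ} (hc : c ≠ 0) (y : ℕ → ℂ) :
    schurMinor N f (fun r => c ^ r * y r) = c ^ minorWeight N f * schurMinor N f y := by
  have h : (schurCols N fun r => c ^ r * y r).submatrix f id = Matrix.of fun i j =>
      (fun i => c ^ (-(f i : ℤ))) i * (Matrix.of fun i j =>
        (fun j : Fin N => c ^ (2 * (j : ℤ) + 1)) j * (schurCols N y).submatrix f id i j) i j := by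
    ext i j
    simp only [schurCols, Matrix.of_apply, Matrix.submatrix_apply, id]
    split_ifs with h
    · rw [schur_scale, ← mul_assoc, ← zpow_add₀ hc, ← zpow_natCast]
      congr 2; push_cast [h]; ring
    · simp
  have hp : ∀ (s : Finset (Fin N)) (g : Fin N → ℤ), ∏ i ∈ s, c ^ g i = c ^ ∑ i ∈ s, g i := by
    intro s g
    induction s using Finset.induction_on with
    | empty => simp
    | insert i s hi ih => rw [Finset.prod_insert hi, Finset.sum_insert hi, ih, zpow_add₀ hc]
  rw [schurMinor, h, Matrix.det_mul_column, Matrix.det_mul_row, schurMinor, ← mul_assoc, hp, hp,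
    ← zpow_add₀ hc, minorWeight, Finset.sum_neg_distrib]
  congr 2; ring

theorem minorWeight_baseRows (N : ℕ) : minorWeight N (baseRows N) = (N * (N + 1) / 2 : ℕ) := by
  have := half_add_sum_baseRows N
  unfold minorWeight
  zify at this ⊢
  linarith

theorem minorWeight_shiftedRows {N : ℕ} (hN : 0 < N) :
    minorWeight N (shiftedRows N) = minorWeight N (baseRows N) - 1 := by
  have h : shiftedRows N = Function.update (baseRows N) ⟨N - 1, by omega⟩ N := by
    funext i
    simp only [shiftedRows, baseRows, Function.update_apply, Fin.ext_iff]
    refine if_congr (by omega) rfl rfl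
  rw [h, minorWeight_update]
  simp only [baseRows]
  push_cast [hN]
  ring

end

end CNLS

/-! ### Scaling in A, x and t -/

namespace CNLS

open Complex Filter Topology PowerSeries Asymptotics
open scoped ComplexConjugate

noncomputable section

/-- The size `1 + |A| + |x| + |t|`. -/
def size (q : ℝ × ℝ × ℝ) : ℝ := 1 + |q.1| + |q.2.1| + |q.2.2|

theorem one_le_size (q : ℝ × ℝ × ℝ) : 1 ≤ size q := by
  unfold size; have := abs_nonneg q.1; have := abs_nonneg q.2.1; have := abs_nonneg q.2.2; linarith

theorem size_pos (q : ℝ × ℝ × ℝ) : 0 < size q := one_pos.trans_le (one_le_size q)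

theorem size_zpow_le {a b : ℤ} (h : a ≤ b) (F : Filter (ℝ × ℝ × ℝ)) :
    (fun q => size q ^ a) =O[F] fun q => size q ^ b :=
  isBigO_of_le _ fun q => by
    rw [Real.norm_of_nonneg (zpow_nonneg (size_pos q).le _),
      Real.norm_of_nonneg (zpow_nonneg (size_pos q).le _)]
    exact zpow_le_zpow_right₀ (one_le_size q) h

theorem isBigO_size_fst (F : Filter (ℝ × ℝ × ℝ)) : (fun q => (q.1 : ℂ)) =O[F] size :=
  isBigO_of_le _ fun q => by
    rw [Real.norm_of_nonneg (size_pos q).le, Complex.norm_real, Real.norm_eq_abs]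
    unfold size; have := abs_nonneg q.2.1; have := abs_nonneg q.2.2; linarith

theorem isBigO_size_x (F : Filter (ℝ × ℝ × ℝ)) : (fun q => (q.2.1 : ℂ)) =O[F] size :=
  isBigO_of_le _ fun q => by
    rw [Real.norm_of_nonneg (size_pos q).le, Complex.norm_real, Real.norm_eq_abs]
    unfold size; have := abs_nonneg q.1; have := abs_nonneg q.2.2; linarith

theorem isBigO_size_t (F : Filter (ℝ × ℝ × ℝ)) : (fun q => (q.2.2 : ℂ)) =O[F] size :=
  isBigO_of_le _ fun q => by
    rw [Real.norm_of_nonneg (size_pos q).le, Complex.norm_real, Real.norm_eq_abs]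
    unfold size; have := abs_nonneg q.1; have := abs_nonneg q.2.1; linarith

theorem isBigO_const_size_zpow (c : ℂ) {e : ℤ} (he : 0 ≤ e) (F : Filter (ℝ × ℝ × ℝ)) :
    (fun _ => c) =O[F] fun q => size q ^ e := by
  refine (isBigO_const_const c (one_ne_zero (α := ℝ)) F).trans ?_
  simpa using size_zpow_le he F

namespace Params

variable (P : Params)

/-- The odd part of `x_l^+ + w` for a constant sequence `w`. -/
def argOdd (l : Fin 2) (w : ℕ → ℂ) (q : ℝ × ℝ × ℝ) : ℕ → ℂ :=
  oddPart fun r => P.xPlus q.1 q.2 l r + w r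

/-- The leading part of `argOdd`. -/
def argLead (l : Fin 2) (w : ℕ → ℂ) (q : ℝ × ℝ × ℝ) (r : ℕ) : ℂ :=
  if r = 1 then P.xPlus q.1 q.2 l 1 + w 1 else if Odd r then P.κ l r * (q.1 : ℂ) ^ r else 0

variable {P} {F : Filter (ℝ × ℝ × ℝ)}

theorem isBigO_linear (l : Fin 2) (w : ℂ) (r : ℕ) :
    (fun q : ℝ × ℝ × ℝ => P.alpha l r * q.2.1 + P.beta l r * I * q.2.2 + w) =O[F]
      fun q => size q ^ (1 : ℤ) := by
  simp only [zpow_one]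
  refine (((isBigO_size_x F).const_mul_left _).add ((isBigO_size_t F).const_mul_left _)).add ?_
  simpa using isBigO_const_size_zpow w (e := 1) (by norm_num) F

theorem isBigO_kappa_mul_pow (l : Fin 2) (r : ℕ) :
    (fun q : ℝ × ℝ × ℝ => P.κ l r * (q.1 : ℂ) ^ r) =O[F] fun q => size q ^ r :=
  ((isBigO_size_fst F).pow r).const_mul_left _

theorem isBigO_argOdd (l : Fin 2) (w : ℕ → ℂ) (r : ℕ) (hr : r ≠ 0) :
    (fun q => P.argOdd l w q r) =O[F] fun q => size q ^ r := by
  unfold argOdd oddPart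
  split_ifs with h
  · have h1 := isBigO_linear (P := P) (F := F) l (w r) r
    have h2 := h1.trans (size_zpow_le (b := (r : ℤ)) (by omega) F)
    simp only [zpow_natCast] at h2
    refine (h2.add (isBigO_kappa_mul_pow (P := P) l r)).congr_left fun q => ?_
    simp only [xPlus, d, if_pos h]; ring
  · exact isBigO_zero _ _

theorem argOdd_sub_argLead (l : Fin 2) (w : ℕ → ℂ) (q : ℝ × ℝ × ℝ) (r : ℕ) :
    P.argOdd l w q r - P.argLead l w q r = if r = 1 ∨ ¬ Odd r then 0 else
      P.alpha l r * q.2.1 + P.beta l r * I * q.2.2 + w r := by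
  unfold argOdd argLead oddPart
  by_cases h1 : r = 1
  · subst h1; simp
  · by_cases h2 : Odd r
    · simp only [h1, h2, if_true, if_false, xPlus, d, not_true, or_self]; ring
    · simp [h1, h2]

/-- The two arguments differ only at odd r ≥ 3, by an affine function of (x,t), and 1 ≤ r - 2. The
gain of two powers, rather than one, leaves an error O(1/A) after division by the derivative minor.
-/
theorem isBigO_argOdd_sub_argLead (l : Fin 2) (w : ℕ → ℂ) (r : ℕ) :
    (fun q => P.argOdd l w q r - P.argLead l w q r) =O[F] fun q => size q ^ ((r : ℤ) - 2) := by
  simp only [argOdd_sub_argLead]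
  split_ifs with h
  · exact isBigO_zero _ _
  · push Not at h
    obtain ⟨h1, k, hk⟩ := h
    exact (isBigO_linear (P := P) (F := F) l (w r) r).trans (size_zpow_le (by omega) F)

theorem isBigO_argLead (l : Fin 2) (w : ℕ → ℂ) (r : ℕ) (hr : r ≠ 0) :
    (fun q => P.argLead l w q r) =O[F] fun q => size q ^ r := by
  have h := (isBigO_argOdd_sub_argLead (P := P) (F := F) l w r).trans
    (size_zpow_le (b := (r : ℤ)) (by omega) F)
  simp only [zpow_natCast] at h
  exact ((isBigO_argOdd l w r hr).sub h).congr_left fun q => by ring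

/-- A change of the constant shift is bounded, so for r ≥ 1 it is at least one power below the r-th
entry. The shifts in question are ∓h₃. -/
theorem isBigO_argOdd_sub_argOdd (l : Fin 2) (w w' : ℕ → ℂ) (r : ℕ) (hr : r ≠ 0) :
    (fun q => P.argOdd l w q r - P.argOdd l w' q r) =O[F] fun q => size q ^ ((r : ℤ) - 1) := by
  unfold argOdd oddPart
  split_ifs with h
  · refine (isBigO_const_size_zpow (w r - w' r) (by omega) F).congr_left fun q => ?_
    ring
  · simpa using isBigO_zero _ _

variable (P) in
/-- The value of `argLead` as a point in the plane of the Adler--Moser polynomial. -/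
def scaledArg (l : Fin 2) (w : ℕ → ℂ) (q : ℝ × ℝ × ℝ) : ℂ :=
  (P.xPlus q.1 q.2 l 1 + w 1) / q.1

/-- Homogeneity with c = A: the choice d_{l,r} = κ_{l,r} A^r turns the leading argument into the
Adler–Moser argument. -/
theorem schurMinor_argLead (l : Fin 2) (w : ℕ → ℂ) {q : ℝ × ℝ × ℝ} (hq : q.1 ≠ 0)
    (f : Fin (P.N l) → ℕ) : schurMinor (P.N l) f (P.argLead l w q) =
      (q.1 : ℂ) ^ minorWeight (P.N l) f *
        (minorPoly (P.N l) f (P.κ l)).eval (P.scaledArg l w q) := by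
  have hq' : (q.1 : ℂ) ≠ 0 := by exact_mod_cast hq
  rw [eval_minorPoly, ← schurMinor_scale f hq']
  congr 1
  funext r
  simp only [argLead, oddArg, scaledArg]
  by_cases h1 : r = 1
  · subst h1; simp; field_simp
  · by_cases h2 : Odd r
    · simp [h1, h2]; ring
    · simp [h1, h2]

theorem isBigO_schurMinor_argOdd_sub (l : Fin 2) (w w' : ℕ → ℂ) (f : Fin (P.N l) → ℕ) :
    (fun q => schurMinor (P.N l) f (P.argOdd l w q) -
      schurMinor (P.N l) f (P.argOdd l w' q)) =O[F]
      fun q => size q ^ (minorWeight (P.N l) f - 1) :=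
  isBigO_schurMinor_sub size_pos (isBigO_argOdd l w) (isBigO_argOdd l w')
    (isBigO_argOdd_sub_argOdd l w w') f

theorem isBigO_schurMinor_argOdd_sub_lead (hF : Tendsto Prod.fst F atTop) (l : Fin 2) (w : ℕ → ℂ)
    (f : Fin (P.N l) → ℕ) : (fun q => schurMinor (P.N l) f (P.argOdd l w q) -
      (q.1 : ℂ) ^ minorWeight (P.N l) f *
        (minorPoly (P.N l) f (P.κ l)).eval (P.scaledArg l w q)) =O[F]
      fun q => size q ^ (minorWeight (P.N l) f - 2) := by
  refine (isBigO_schurMinor_sub size_pos (isBigO_argOdd (P := P) l w) (isBigO_argLead l w)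
    (fun r _ => isBigO_argOdd_sub_argLead l w r) f).congr' ?_ EventuallyEq.rfl
  filter_upwards [hF.eventually_ne_atTop 0] with q hq
  rw [schurMinor_argLead l w hq]

theorem tendsto_size (hF : Tendsto Prod.fst F atTop) : Tendsto size F atTop := by
  refine tendsto_atTop_mono (fun q => ?_) hF
  unfold size
  have := le_abs_self q.1; have := abs_nonneg q.2.1; have := abs_nonneg q.2.2; linarith

theorem isLittleO_size_zpow (hF : Tendsto Prod.fst F atTop) {a b : ℤ} (h : a < b) :
    (fun q => size q ^ a) =o[F] fun q => size q ^ b := by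
  have h1 : (fun q => size q ^ a) =O[F] fun q => size q ^ (b - 1) := size_zpow_le (by omega) F
  refine h1.trans_isLittleO ?_
  have h2 : (fun q => size q ^ (b - 1)) = fun q => size q ^ b * (size q)⁻¹ := by
    funext q; rw [zpow_sub₀ (size_pos q).ne', zpow_one, div_eq_mul_inv]
  rw [h2]
  have h3 : (fun q => (size q)⁻¹) =o[F] fun _ => (1 : ℝ) := by
    rw [isLittleO_one_iff]
    exact (tendsto_size hF).inv_tendsto_atTop
  simpa using (isBigO_refl (fun q => size q ^ b) F).mul_isLittleO h3

/-- Lower bound for a minor near a point where its polynomial does not vanish. -/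
theorem isBigO_size_schurMinor (hF : Tendsto Prod.fst F atTop)
    (hΛ : size =O[F] fun q => q.1) (l : Fin 2) (w : ℕ → ℂ) (f : Fin (P.N l) → ℕ) {z : ℂ}
    (hz : Tendsto (P.scaledArg l w) F (𝓝 z))
    (hne : (minorPoly (P.N l) f (P.κ l)).eval z ≠ 0) (hw : 0 ≤ minorWeight (P.N l) f) :
    (fun q => size q ^ minorWeight (P.N l) f) =O[F]
      fun q => schurMinor (P.N l) f (P.argOdd l w q) := by
  set W := minorWeight (P.N l) f with hW
  set p := minorPoly (P.N l) f (P.κ l) with hp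
  have h1 : Tendsto (fun q => p.eval (P.scaledArg l w q)) F (𝓝 (p.eval z)) :=
    (p.continuous.tendsto z).comp hz
  have h2 : (fun _ => (1 : ℝ)) =O[F] fun q => p.eval (P.scaledArg l w q) := by
    refine IsBigO.of_bound (2 * ‖p.eval z‖⁻¹) ?_
    have hlt : ‖p.eval z‖ / 2 < ‖p.eval z‖ := half_lt_self (norm_pos_iff.mpr hne)
    filter_upwards [h1.norm.eventually (lt_mem_nhds hlt)] with q hq
    have : 0 < ‖p.eval z‖ := norm_pos_iff.mpr hne
    rw [norm_one, mul_assoc, ← div_eq_inv_mul, mul_div_assoc', le_div_iff₀ this]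
    linarith
  obtain ⟨n, hn⟩ := Int.eq_ofNat_of_zero_le hw
  have h3 : (fun q => size q ^ W) =O[F] fun q => (q.1 : ℂ) ^ W * p.eval (P.scaledArg l w q) := by
    have h4 : size =O[F] fun q => (q.1 : ℂ) := hΛ.trans (isBigO_of_le _ fun q => by simp)
    have := (h4.pow n).mul h2
    rw [hn]
    simpa using this
  have h5 : (fun q => schurMinor (P.N l) f (P.argOdd l w q) -
      (q.1 : ℂ) ^ W * p.eval (P.scaledArg l w q)) =o[F]
      fun q => (q.1 : ℂ) ^ W * p.eval (P.scaledArg l w q) :=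
    ((isBigO_schurMinor_argOdd_sub_lead hF l w f).trans_isLittleO
      (isLittleO_size_zpow hF (by omega : W - 2 < W))).trans_isBigO h3
  exact h3.trans (IsEquivalent.isBigO_symm h5)

end Params

/-- Lower bound for `∏ (ξ - A z)` over a finite set of points `z`. -/
theorem exists_prod_lower_bound (Z : Finset ℂ) (hZ : Z.Nonempty) :
    ∃ c > 0, ∀ (A : ℝ) (ξ : ℂ) (M : ℝ), 0 ≤ A → 0 ≤ M → (∀ z ∈ Z, M ≤ ‖ξ - A * z‖) →
      c * (A + ‖ξ‖) ^ (Z.card - 1) * M ≤ ∏ z ∈ Z, ‖ξ - A * z‖ := by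
  set B := ∑ z ∈ Z, ‖z‖ with hB
  have hB0 : 0 ≤ B := Finset.sum_nonneg fun _ _ => norm_nonneg _
  have hBz : ∀ z ∈ Z, ‖z‖ ≤ B := fun z hz =>
    Finset.single_le_sum (f := fun z => ‖z‖) (fun _ _ => norm_nonneg _) hz
  set E := ∑ y ∈ Z ×ˢ Z, 2 / ‖y.2 - y.1‖ with hE
  have hE0 : 0 ≤ E := Finset.sum_nonneg fun _ _ => div_nonneg zero_le_two (norm_nonneg _)
  have hEz : ∀ z ∈ Z, ∀ z' ∈ Z, 2 / ‖z' - z‖ ≤ E := fun z hz z' hz' =>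
    Finset.single_le_sum (f := fun y : ℂ × ℂ => 2 / ‖y.2 - y.1‖)
      (fun _ _ => div_nonneg zero_le_two (norm_nonneg _)) (Finset.mk_mem_product hz hz')
  set K := (1 + B) * E + 1 with hK
  have hK0 : 0 < K := by positivity
  refine ⟨K⁻¹ ^ (Z.card - 1), by positivity, fun A ξ M hA hM hMz => ?_⟩
  obtain ⟨z, hz, hmin⟩ := Z.exists_min_image (fun z => ‖ξ - A * z‖) hZ
  -- A root other than the nearest one has distance comparable to A + ‖ξ‖, because distinct scaled
  -- roots are at least a fixed multiple of A apart.
  have key : ∀ z' ∈ Z.erase z, K⁻¹ * (A + ‖ξ‖) ≤ ‖ξ - A * z'‖ := by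
    intro z' hz'
    have hz'Z := Finset.mem_of_mem_erase hz'
    have hne : 0 < ‖z' - z‖ := norm_pos_iff.mpr (sub_ne_zero.mpr (Finset.ne_of_mem_erase hz'))
    have h1 : A * ‖z' - z‖ ≤ 2 * ‖ξ - A * z'‖ := by
      calc A * ‖z' - z‖ = ‖(ξ - A * z) - (ξ - A * z')‖ := by
            rw [show (ξ - A * z) - (ξ - A * z') = A * (z' - z) by ring, norm_mul,
              Complex.norm_real, Real.norm_of_nonneg hA]
        _ ≤ ‖ξ - A * z‖ + ‖ξ - A * z'‖ := norm_sub_le _ _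
        _ ≤ 2 * ‖ξ - A * z'‖ := by linarith [hmin z' hz'Z]
    have h2 : A ≤ E * ‖ξ - A * z'‖ := by
      have : A ≤ 2 / ‖z' - z‖ * ‖ξ - A * z'‖ := by
        rw [div_mul_eq_mul_div, le_div_iff₀ hne]; exact h1
      exact this.trans (mul_le_mul_of_nonneg_right (hEz z hz z' hz'Z) (norm_nonneg _))
    have h3 : ‖ξ‖ ≤ ‖ξ - A * z'‖ + A * B := by
      calc ‖ξ‖ = ‖(ξ - A * z') + A * z'‖ := by congr 1; ring
        _ ≤ ‖ξ - A * z'‖ + ‖(A : ℂ) * z'‖ := norm_add_le _ _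
        _ ≤ _ := by
          rw [norm_mul, Complex.norm_real, Real.norm_of_nonneg hA]
          gcongr
          exact hBz z' hz'Z
    rw [inv_mul_le_iff₀ hK0]
    calc A + ‖ξ‖ ≤ (1 + B) * A + ‖ξ - A * z'‖ := by linarith
      _ ≤ (1 + B) * (E * ‖ξ - A * z'‖) + ‖ξ - A * z'‖ := by gcongr
      _ = K * ‖ξ - A * z'‖ := by rw [hK]; ring
  rw [← Finset.mul_prod_erase _ _ hz, ← mul_pow, mul_comm]
  refine mul_le_mul (hMz z hz) ?_ (by positivity) (norm_nonneg _)
  rw [← Finset.card_erase_of_mem hz, ← Finset.prod_const]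
  exact Finset.prod_le_prod (fun _ _ => by positivity) key

end

end CNLS

/-! ### Minors away from the roots and near a root -/

namespace CNLS

open Complex Filter Topology PowerSeries Asymptotics
open scoped ComplexConjugate

noncomputable section

namespace Params

variable {P : Params} {F : Filter (ℝ × ℝ × ℝ)}

theorem alpha_one (l : Fin 2) : P.alpha l 1 = I * P.chi1 l := by
  have : coeff 1 (P.lamSeries l) = 0 := by
    simp [lamSeries, coeff_X_pow]
  rw [alpha, coeff_C_mul, map_sub, this, sub_zero, chi1]

theorem coeff_one_sq (f : PowerSeries ℂ) : coeff 1 (f ^ 2) = 2 * constantCoeff f * coeff 1 f := by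
  rw [pow_two, coeff_mul, Finset.Nat.sum_antidiagonal_eq_sum_range_succ_mk]
  simp [Finset.sum_range_succ]; ring

theorem beta_one (l : Fin 2) : P.beta l 1 = P.chi l * P.chi1 l := by
  have : coeff 1 (P.lamSeries l) = 0 := by
    simp [lamSeries, coeff_X_pow]
  rw [beta, map_sub, map_sub, coeff_C_mul, coeff_one_sq, coeff_one_sq, this]
  simp [chi, chi1]; ring

/-- As λ_l(ε) has no linear term, the first argument sees (x,t) only through x + χ_l t. The root
points and the centres come from this formula. -/
theorem xPlus_one (A : ℝ) (p : ℝ × ℝ) (l : Fin 2) :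
    P.xPlus A p l 1 = I * P.chi1 l * (p.1 + P.chi l * p.2) + P.κ l 1 * A := by
  rw [xPlus, alpha_one, beta_one, d, if_pos odd_one]; ring

/-- Since Im χ_l ≠ 0, both x and t are controlled by the complex number x + χ_l t, hence by x⁺_{l,1}
and A. -/
theorem size_le_mul {l : Fin 2} (h1 : P.chi1 l ≠ 0) (him : (P.chi l).im ≠ 0) (w : ℂ) :
    ∃ K > 0, ∀ q : ℝ × ℝ × ℝ, 1 ≤ q.1 → size q ≤ K * (q.1 + ‖P.xPlus q.1 q.2 l 1 + w‖) := by
  set a := ‖P.chi1 l‖ with ha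
  have ha0 : 0 < a := norm_pos_iff.mpr h1
  set c := |(P.chi l).im| with hc
  have hc0 : 0 < c := abs_pos.mpr him
  set K₁ := (1 + (1 + ‖P.chi l‖) / c) / a with hK₁
  have hK₁0 : 0 < K₁ := by positivity
  refine ⟨2 + K₁ * (1 + ‖w‖ + ‖P.κ l 1‖), by positivity, fun q hq => ?_⟩
  set v : ℂ := q.2.1 + P.chi l * q.2.2 with hv
  have ht : |q.2.2| ≤ ‖v‖ / c := by
    rw [le_div_iff₀ hc0, mul_comm, ← abs_mul]
    have : (P.chi l).im * q.2.2 = v.im := by simp [hv]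
    rw [this]; exact Complex.abs_im_le_norm v
  have hx : |q.2.1| ≤ ‖v‖ + ‖P.chi l‖ * |q.2.2| := by
    calc |q.2.1| = ‖v - P.chi l * q.2.2‖ := by
          rw [hv, add_sub_cancel_right, Complex.norm_real, Real.norm_eq_abs]
      _ ≤ ‖v‖ + ‖P.chi l * q.2.2‖ := norm_sub_le _ _
      _ = _ := by rw [norm_mul, Complex.norm_real, Real.norm_eq_abs]
  have hva : a * ‖v‖ ≤ ‖P.xPlus q.1 q.2 l 1 + w‖ + ‖w‖ + ‖P.κ l 1‖ * q.1 := by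
    calc a * ‖v‖ = ‖(P.xPlus q.1 q.2 l 1 + w) - w - P.κ l 1 * q.1‖ := by
          rw [xPlus_one, ha, show I * P.chi1 l * (q.2.1 + P.chi l * q.2.2) + P.κ l 1 * q.1 + w - w -
            P.κ l 1 * q.1 = I * (P.chi1 l * v) by rw [hv]; ring, norm_mul, norm_mul, Complex.norm_I,
            one_mul]
      _ ≤ ‖(P.xPlus q.1 q.2 l 1 + w) - w‖ + ‖P.κ l 1 * q.1‖ := norm_sub_le _ _
      _ ≤ ‖P.xPlus q.1 q.2 l 1 + w‖ + ‖w‖ + ‖P.κ l 1 * q.1‖ := by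
          gcongr; exact norm_sub_le _ _
      _ = _ := by
          rw [norm_mul, Complex.norm_real, Real.norm_of_nonneg (by linarith)]
  have hxt : |q.2.1| + |q.2.2| ≤ K₁ * (a * ‖v‖) := by
    calc |q.2.1| + |q.2.2| ≤ ‖v‖ + (1 + ‖P.chi l‖) * |q.2.2| := by linarith
      _ ≤ ‖v‖ + (1 + ‖P.chi l‖) * (‖v‖ / c) := by gcongr
      _ = K₁ * (a * ‖v‖) := by rw [hK₁]; field_simp
  set m := ‖P.xPlus q.1 q.2 l 1 + w‖ with hm
  have hm0 : 0 ≤ m := norm_nonneg _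
  have h2 : K₁ * (a * ‖v‖) ≤ K₁ * (m + ‖w‖ + ‖P.κ l 1‖ * q.1) := by gcongr
  have hw := norm_nonneg w
  have hk := norm_nonneg (P.κ l 1)
  have h3 : m + ‖w‖ + ‖P.κ l 1‖ * q.1 ≤ (1 + ‖w‖ + ‖P.κ l 1‖) * (q.1 + m) := by
    have e1 : ‖w‖ ≤ ‖w‖ * q.1 := le_mul_of_one_le_right hw hq
    have e2 : 0 ≤ ‖w‖ * m := mul_nonneg hw hm0
    have e3 : 0 ≤ ‖P.κ l 1‖ * m := mul_nonneg hk hm0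
    linarith
  have h4 := mul_le_mul_of_nonneg_left h3 hK₁0.le
  unfold size
  rw [abs_of_nonneg (by linarith : (0 : ℝ) ≤ q.1)]
  linarith

/-- Lower bound for the leading minor away from the roots. -/
theorem isLittleO_size_schurMinor (hF : Tendsto Prod.fst F atTop) {l : Fin 2}
    (h1 : P.chi1 l ≠ 0) (him : (P.chi l).im ≠ 0)
    (hs : ∀ z, adlerMoser (P.N l) (P.κ l) z = 0 → deriv (adlerMoser (P.N l) (P.κ l)) z ≠ 0)
    (hfar : ∀ z ∈ rootSet (P.N l) (P.κ l),
      Tendsto (fun q : ℝ × ℝ × ℝ => ‖P.xPlus q.1 q.2 l 1 - q.1 * z‖) F atTop) (w : ℕ → ℂ) :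
    (fun q => size q ^ (minorWeight (P.N l) (baseRows (P.N l)) - 1)) =o[F]
      fun q => schurMinor (P.N l) (baseRows (P.N l)) (P.argOdd l w q) := by
  set W := minorWeight (P.N l) (baseRows (P.N l)) with hW
  set p := minorPoly (P.N l) (baseRows (P.N l)) (P.κ l) with hp
  set Z := rootSet (P.N l) (P.κ l) with hZ
  have hWZ : W = Z.card := by rw [hW, minorWeight_baseRows, hZ, card_rootSet hs]
  set L := p.leadingCoeff with hL
  have hL0 : L ≠ 0 := Polynomial.leadingCoeff_ne_zero.mpr (minorPoly_baseRows_ne_zero _ _)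
  have hprod : ∀ q : ℝ × ℝ × ℝ, q.1 ≠ 0 → (q.1 : ℂ) ^ W * p.eval (P.scaledArg l w q) =
      L * ∏ z ∈ Z, (P.xPlus q.1 q.2 l 1 + w 1 - q.1 * z) := by
    intro q hq
    have hq' : (q.1 : ℂ) ≠ 0 := by exact_mod_cast hq
    rw [hp, eval_minorPoly_eq_prod hs, hWZ, zpow_natCast, mul_left_comm, ← Finset.prod_const,
      ← Finset.prod_mul_distrib]
    congr 1
    refine Finset.prod_congr rfl fun z _ => ?_
    rw [scaledArg]; field_simp
  have key : (fun q => size q ^ (W - 1)) =o[F]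
      fun q => (q.1 : ℂ) ^ W * p.eval (P.scaledArg l w q) := by
    have hev : (fun q => (q.1 : ℂ) ^ W * p.eval (P.scaledArg l w q)) =ᶠ[F]
        fun q => L * ∏ z ∈ Z, (P.xPlus q.1 q.2 l 1 + w 1 - q.1 * z) := by
      filter_upwards [hF.eventually_ne_atTop 0] with q hq using hprod q hq
    refine IsLittleO.congr' ?_ EventuallyEq.rfl hev.symm
    rcases Z.eq_empty_or_nonempty with hZe | hZne
    · have hW0 : W = 0 := by rw [hWZ, hZe]; simp
      simp only [hZe, Finset.prod_empty, mul_one]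
      refine (isLittleO_size_zpow hF (by omega : W - 1 < 0)).trans_isBigO ?_
      simpa using isBigO_const_const (1 : ℝ) hL0 F
    · obtain ⟨c₀, hc₀, hlow⟩ := exists_prod_lower_bound Z hZne
      obtain ⟨K, hK, hsize⟩ := size_le_mul h1 him (w 1)
      have hcard : 1 ≤ Z.card := Finset.card_pos.mpr hZne
      have hWn : W - 1 = ((Z.card - 1 : ℕ) : ℤ) := by rw [hWZ]; push_cast [hcard]; ring
      rw [isLittleO_iff]
      intro c hc
      have hLp : 0 < ‖L‖ := norm_pos_iff.mpr hL0
      -- Chosen so that the constants in the estimate below reduce to c. All roots are eventually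
      -- farther away than M, even after the shift by w 1.
      set M := K ^ (Z.card - 1) / (c₀ * ‖L‖ * c) with hM
      have hM0 : 0 < M := by positivity
      have hall : ∀ᶠ q in F, ∀ z ∈ Z, M + ‖w 1‖ ≤ ‖P.xPlus q.1 q.2 l 1 - q.1 * z‖ :=
        (eventually_all_finset Z).mpr fun z hz => (hfar z hz).eventually_ge_atTop _
      filter_upwards [hall, hF.eventually_ge_atTop 1] with q hq hq1
      have h2 : ∀ z ∈ Z, M ≤ ‖P.xPlus q.1 q.2 l 1 + w 1 - q.1 * z‖ := by
        intro z hz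
        have e1 := hq z hz
        have e2 := norm_sub_le (P.xPlus q.1 q.2 l 1 + w 1 - q.1 * z) (w 1)
        rw [show P.xPlus q.1 q.2 l 1 + w 1 - q.1 * z - w 1 = P.xPlus q.1 q.2 l 1 - q.1 * z by
          ring] at e2
        linarith
      have h3 := hlow q.1 _ M (by linarith) hM0.le h2
      rw [hWn, zpow_natCast, Real.norm_of_nonneg (pow_nonneg (size_pos q).le _), norm_mul,
        norm_prod]
      calc size q ^ (Z.card - 1)
          ≤ (K * (q.1 + ‖P.xPlus q.1 q.2 l 1 + w 1‖)) ^ (Z.card - 1) :=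
            pow_le_pow_left₀ (size_pos q).le (hsize q hq1) _
        _ = c * ‖L‖ * (c₀ * (q.1 + ‖P.xPlus q.1 q.2 l 1 + w 1‖) ^ (Z.card - 1) * M) := by
            rw [mul_pow, hM]; field_simp
        _ ≤ c * ‖L‖ * ∏ z ∈ Z, ‖P.xPlus q.1 q.2 l 1 + w 1 - q.1 * z‖ := by gcongr
        _ = _ := by ring
  have h5 : (fun q => schurMinor (P.N l) (baseRows (P.N l)) (P.argOdd l w q) -
      (q.1 : ℂ) ^ W * p.eval (P.scaledArg l w q)) =o[F]
      fun q => (q.1 : ℂ) ^ W * p.eval (P.scaledArg l w q) :=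
    ((isBigO_schurMinor_argOdd_sub_lead hF l w _).trans
      (size_zpow_le (by omega : W - 2 ≤ W - 1) F)).trans_isLittleO key
  exact key.trans_isBigO (IsEquivalent.isBigO_symm h5)

theorem isBigO_fst_zpow (hΛ : size =O[F] fun q => q.1) (k : ℤ) :
    (fun q => (q.1 : ℂ) ^ k) =O[F] fun q => size q ^ k := by
  have h1 : size =O[F] fun q => (q.1 : ℂ) := hΛ.trans (isBigO_of_le _ fun q => by simp)
  obtain ⟨n, rfl | rfl⟩ := k.eq_nat_or_neg
  · simpa using (isBigO_size_fst F).pow n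
  · simp only [zpow_neg, zpow_natCast]
    refine IsBigO.inv_rev (h1.pow n) (Eventually.of_forall fun q hq => ?_)
    exact absurd hq (pow_ne_zero _ (size_pos q).ne')

theorem tendsto_scaledArg (hF : Tendsto Prod.fst F atTop) {l : Fin 2} {z : ℂ}
    (hX : (fun q : ℝ × ℝ × ℝ => P.xPlus q.1 q.2 l 1 - q.1 * z) =O[F] fun _ => (1 : ℝ))
    (w : ℕ → ℂ) : Tendsto (P.scaledArg l w) F (𝓝 z) := by
  have h1 : (fun q : ℝ × ℝ × ℝ => P.xPlus q.1 q.2 l 1 - q.1 * z + w 1) =O[F] fun _ => (1 : ℝ) :=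
    hX.add (isBigO_const_const _ one_ne_zero _)
  have h2 : Tendsto (fun q : ℝ × ℝ × ℝ => (q.1 : ℂ)⁻¹) F (𝓝 0) := by
    have : Tendsto (fun q : ℝ × ℝ × ℝ => ((q.1⁻¹ : ℝ) : ℂ)) F (𝓝 ((0 : ℝ) : ℂ)) :=
      (Complex.continuous_ofReal.tendsto 0).comp hF.inv_tendsto_atTop
    simpa using this
  have h3 : Tendsto (fun q : ℝ × ℝ × ℝ => (P.xPlus q.1 q.2 l 1 - q.1 * z + w 1) * (q.1 : ℂ)⁻¹) F
      (𝓝 0) := by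
    rw [← isLittleO_one_iff ℝ]
    simpa using h1.mul_isLittleO ((isLittleO_one_iff ℝ).mpr h2)
  have h4 := h3.const_add z
  rw [add_zero] at h4
  refine h4.congr' ?_
  filter_upwards [hF.eventually_ne_atTop 0] with q hq
  have hq' : (q.1 : ℂ) ≠ 0 := by exact_mod_cast hq
  rw [scaledArg]; field_simp; ring

/-- The quotient of the two leading minors near a root. -/
theorem isBigO_minor_quotient (hF : Tendsto Prod.fst F atTop) (hΛ : size =O[F] fun q => q.1)
    {l : Fin 2} (hN : 0 < P.N l) {z : ℂ}
    (hX : (fun q : ℝ × ℝ × ℝ => P.xPlus q.1 q.2 l 1 - q.1 * z) =O[F] fun _ => (1 : ℝ))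
    (hz : (minorPoly (P.N l) (baseRows (P.N l)) (P.κ l)).eval z = 0)
    (hz' : (minorPoly (P.N l) (shiftedRows (P.N l)) (P.κ l)).eval z ≠ 0) (w : ℕ → ℂ) :
    (fun q => schurMinor (P.N l) (baseRows (P.N l)) (P.argOdd l w q) /
        schurMinor (P.N l) (shiftedRows (P.N l)) (P.argOdd l w q) -
      (P.xPlus q.1 q.2 l 1 - q.1 * z + w 1)) =O[F] fun q => (size q)⁻¹ := by
  set W := minorWeight (P.N l) (baseRows (P.N l)) with hW
  have hW1 : minorWeight (P.N l) (shiftedRows (P.N l)) = W - 1 := minorWeight_shiftedRows hN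
  have hWpos : 1 ≤ W := by
    rw [hW, minorWeight_baseRows]
    have : 2 ≤ P.N l * (P.N l + 1) := by nlinarith
    omega
  set p := minorPoly (P.N l) (baseRows (P.N l)) (P.κ l) with hp
  have hdp : minorPoly (P.N l) (shiftedRows (P.N l)) (P.κ l) = Polynomial.derivative p :=
    (derivative_minorPoly_baseRows hN _).symm
  set s : ℝ × ℝ × ℝ → ℂ := fun q => P.xPlus q.1 q.2 l 1 - q.1 * z + w 1 with hs
  have hsO : s =O[F] fun _ => (1 : ℝ) := hX.add (isBigO_const_const _ one_ne_zero _)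
  -- Second-order Taylor remainder at the root: if p = (X - z) g, then r = -g'.
  obtain ⟨r, hr⟩ : ∃ r : Polynomial ℂ, ∀ y,
      p.eval y - (y - z) * (Polynomial.derivative p).eval y = (y - z) ^ 2 * r.eval y := by
    obtain ⟨g, hg⟩ := Polynomial.dvd_iff_isRoot.mpr hz
    refine ⟨-Polynomial.derivative g, fun y => ?_⟩
    rw [hg]
    simp [Polynomial.derivative_mul]; ring
  set ζ := P.scaledArg l w with hζ
  have hζz : Tendsto ζ F (𝓝 z) := tendsto_scaledArg hF hX w
  have hζs : ∀ q : ℝ × ℝ × ℝ, q.1 ≠ 0 → ζ q - z = s q / q.1 := by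
    intro q hq
    have hq' : (q.1 : ℂ) ≠ 0 := by exact_mod_cast hq
    rw [hζ, scaledArg, hs]; field_simp; ring
  set D₀ := fun q => schurMinor (P.N l) (baseRows (P.N l)) (P.argOdd l w q) with hD₀
  set D₁ := fun q => schurMinor (P.N l) (shiftedRows (P.N l)) (P.argOdd l w q) with hD₁
  have e0 := isBigO_schurMinor_argOdd_sub_lead (P := P) hF l w (baseRows (P.N l))
  have e1 := isBigO_schurMinor_argOdd_sub_lead (P := P) hF l w (shiftedRows (P.N l))
  rw [hW1, hdp] at e1
  have hlow : (fun q => size q ^ (W - 1)) =O[F] D₁ := by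
    have := isBigO_size_schurMinor (P := P) hF hΛ l w (shiftedRows (P.N l)) hζz hz' (by omega)
    rwa [hW1] at this
  have hne : ∀ᶠ q in F, D₁ q ≠ 0 := by
    filter_upwards [hlow.eq_zero_imp] with q hq h
    exact (zpow_ne_zero _ (size_pos q).ne') (hq h)
  have e2 : (fun q => s q * (D₁ q - (q.1 : ℂ) ^ (W - 1) *
      (Polynomial.derivative p).eval (ζ q))) =O[F] fun q => size q ^ (W - 2) := by
    refine (hsO.mul (e1.trans (size_zpow_le (by omega : W - 1 - 2 ≤ W - 2) F))).congr_right
      fun q => one_mul _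
  have e3 : (fun q => (q.1 : ℂ) ^ (W - 2) * (s q ^ 2 * r.eval (ζ q))) =O[F]
      fun q => size q ^ (W - 2) := by
    have h1 : (fun q => r.eval (ζ q)) =O[F] fun _ => (1 : ℝ) :=
      ((r.continuous.tendsto z).comp hζz).isBigO_one ℝ
    refine ((isBigO_fst_zpow hΛ (W - 2)).mul ((hsO.pow 2).mul h1)).congr_right fun q => ?_
    simp
  -- Since D₁ has exact order W - 1, an error of order W - 2 becomes 1 / size in the quotient.
  have e4 : (fun q => D₀ q - s q * D₁ q) =O[F] fun q => size q ^ (W - 2) := by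
    refine ((e0.sub e2).add e3).congr' ?_ EventuallyEq.rfl
    filter_upwards [hF.eventually_ne_atTop 0] with q hq
    have hq' : (q.1 : ℂ) ≠ 0 := by exact_mod_cast hq
    have h1 := hr (ζ q)
    rw [hζs q hq] at h1
    have h2 : (q.1 : ℂ) ^ (W - 1) = q.1 ^ (W - 2) * q.1 := by
      rw [← zpow_add_one₀ hq']; congr 1; ring
    have h3 : (q.1 : ℂ) ^ W = q.1 ^ (W - 2) * q.1 ^ 2 := by
      rw [pow_two, ← mul_assoc, ← zpow_add_one₀ hq', ← zpow_add_one₀ hq']; congr 1; ring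
    rw [← hW, h2, h3]
    field_simp at h1
    simp only [hD₀, hD₁]
    linear_combination (-(q.1 : ℂ) ^ (W - 2)) * h1
  have e5 : (fun q => (D₁ q)⁻¹) =O[F] fun q => (size q ^ (W - 1))⁻¹ :=
    hlow.inv_rev (Eventually.of_forall fun q hq => absurd hq (zpow_ne_zero _ (size_pos q).ne'))
  refine (e4.mul e5).congr' ?_ (Eventually.of_forall fun q => ?_)
  · filter_upwards [hne] with q hq
    change (D₀ q - s q * D₁ q) * (D₁ q)⁻¹ = D₀ q / D₁ q - s q
    field_simp
  · have := (size_pos q).ne'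
    change size q ^ (W - 2) * (size q ^ (W - 1))⁻¹ = (size q)⁻¹
    rw [← zpow_neg, ← zpow_add₀ this, ← zpow_neg_one]; congr 1; ring

end Params

end

end CNLS

/-! ### Perturbation of the τ-quotient -/

namespace CNLS

open Complex Filter Topology PowerSeries Asymptotics
open scoped ComplexConjugate

noncomputable section

section general

variable {α : Type*} {F : Filter α} {ε : α → ℝ}

theorem isBigO_one_of_tendsto_zero (hε : Tendsto ε F (𝓝 0)) : ε =O[F] fun _ => (1 : ℝ) :=
  ((isLittleO_one_iff ℝ).mpr hε).isBigO

theorem isBigO_one_of_sub (hε : Tendsto ε F (𝓝 0)) {f f' : α → ℂ}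
    (h : (fun a => f a - f' a) =O[F] ε) (hf' : f' =O[F] fun _ => (1 : ℝ)) :
    f =O[F] fun _ => (1 : ℝ) :=
  ((h.trans (isBigO_one_of_tendsto_zero hε)).add hf').congr_left fun a => by ring

theorem isBigO_mul_sub_mul (hε : Tendsto ε F (𝓝 0)) {f f' g g' : α → ℂ}
    (hf : (fun a => f a - f' a) =O[F] ε) (hg : (fun a => g a - g' a) =O[F] ε)
    (hf' : f' =O[F] fun _ => (1 : ℝ)) (hg' : g' =O[F] fun _ => (1 : ℝ)) :
    (fun a => f a * g a - f' a * g' a) =O[F] ε := by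
  have h1 := hf.mul (isBigO_one_of_sub hε hg hg')
  have h2 := hf'.mul hg
  simp only [mul_one, one_mul] at h1 h2
  exact (h1.add h2).congr_left fun a => by ring

theorem isBigO_conj {E : Type*} [Norm E] {f : α → ℂ} {g : α → E} (h : f =O[F] g) :
    (fun a => conj (f a)) =O[F] g :=
  (isBigO_of_le F fun a => (RCLike.norm_conj (f a)).le).trans h

theorem isBigO_one_of_sub_of_lower (hε : Tendsto ε F (𝓝 0)) {g g' : α → ℂ}
    (hg : (fun a => g a - g' a) =O[F] ε) (hlow : (fun _ => (1 : ℝ)) =O[F] g') :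
    (fun _ => (1 : ℝ)) =O[F] g := by
  have h : (fun a => g a - g' a) =o[F] g' :=
    (hg.trans_isLittleO ((isLittleO_one_iff ℝ).mpr hε)).trans_isBigO hlow
  exact hlow.trans (IsEquivalent.isBigO_symm h)

theorem isBigO_inv_of_lower {g : α → ℂ} (hlow : (fun _ => (1 : ℝ)) =O[F] g) :
    (fun a => (g a)⁻¹) =O[F] fun _ => (1 : ℝ) := by
  simpa using hlow.inv_rev (Eventually.of_forall fun a ha => absurd ha one_ne_zero)

theorem eventually_ne_zero_of_lower {g : α → ℂ} (hlow : (fun _ => (1 : ℝ)) =O[F] g) :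
    ∀ᶠ a in F, g a ≠ 0 := by
  filter_upwards [hlow.eq_zero_imp] with a ha h
  exact one_ne_zero (ha h)

theorem isBigO_div_sub_div (hε : Tendsto ε F (𝓝 0)) {f f' g g' : α → ℂ}
    (hf : (fun a => f a - f' a) =O[F] ε) (hg : (fun a => g a - g' a) =O[F] ε)
    (hf' : f' =O[F] fun _ => (1 : ℝ)) (hg' : g' =O[F] fun _ => (1 : ℝ))
    (hlow : (fun _ => (1 : ℝ)) =O[F] g') :
    (fun a => f a / g a - f' a / g' a) =O[F] ε := by
  have hlow' := isBigO_one_of_sub_of_lower hε hg hlow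
  have h1 := ((hf.mul hg').sub (hf'.mul hg |>.congr_right fun a => by rw [mul_comm])).mul
    ((isBigO_inv_of_lower hlow').mul (isBigO_inv_of_lower hlow))
  refine h1.congr' ?_ (Eventually.of_forall fun a => by simp)
  filter_upwards [eventually_ne_zero_of_lower hlow, eventually_ne_zero_of_lower hlow'] with a h h'
  field_simp; ring

end general

namespace Params

variable {P : Params} {F : Filter (ℝ × ℝ × ℝ)} {ε : ℝ × ℝ × ℝ → ℝ}

theorem isBigO_gram {α : Type*} {F : Filter α} {G H : α → ∀ l, Matrix ℕ (Fin (P.N l)) ℂ}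
    (hG : ∀ l b c, (fun a => G a l b c) =O[F] fun _ => (1 : ℝ))
    (hH : ∀ l b c, (fun a => H a l b c) =O[F] fun _ => (1 : ℝ)) (r s) :
    (fun a => P.gram (G a) (H a) r s) =O[F] fun _ => (1 : ℝ) := by
  simp only [gram, Matrix.of_apply, Finset.mul_sum]
  refine IsBigO.fun_sum fun i _ => IsBigO.fun_sum fun j _ => ?_
  simpa using (isBigO_conj (hG r.1 i r.2)).mul ((hH s.1 j s.2).const_mul_left _)

theorem isBigO_gram_sub {α : Type*} {F : Filter α} {ε : α → ℝ} (hε : Tendsto ε F (𝓝 0))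
    {G G' H H' : α → ∀ l, Matrix ℕ (Fin (P.N l)) ℂ}
    (hG' : ∀ l b c, (fun a => G' a l b c) =O[F] fun _ => (1 : ℝ))
    (hH' : ∀ l b c, (fun a => H' a l b c) =O[F] fun _ => (1 : ℝ))
    (hG : ∀ l b c, (fun a => G a l b c - G' a l b c) =O[F] ε)
    (hH : ∀ l b c, (fun a => H a l b c - H' a l b c) =O[F] ε) (r s) :
    (fun a => P.gram (G a) (H a) r s - P.gram (G' a) (H' a) r s) =O[F] ε := by
  simp only [gram, Matrix.of_apply, Finset.mul_sum, ← Finset.sum_sub_distrib]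
  refine IsBigO.fun_sum fun i _ => IsBigO.fun_sum fun j _ => ?_
  refine isBigO_mul_sub_mul hε ?_ ?_ (isBigO_conj (hG' _ _ _)) ((hH' _ _ _).const_mul_left _)
  · simpa only [map_sub] using isBigO_conj (hG r.1 i r.2)
  · simpa only [mul_sub] using (hH s.1 j s.2).const_mul_left (P.pEntry r.1 s.1 i j)

theorem isBigO_det_gram {α : Type*} {F : Filter α} {G H : α → ∀ l, Matrix ℕ (Fin (P.N l)) ℂ}
    (hG : ∀ l b c, (fun a => G a l b c) =O[F] fun _ => (1 : ℝ))
    (hH : ∀ l b c, (fun a => H a l b c) =O[F] fun _ => (1 : ℝ)) :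
    (fun a => (P.gram (G a) (H a)).det) =O[F] fun _ => (1 : ℝ) :=
  isBigO_det (h := fun _ _ _ => 1) (isBigO_gram hG hH) fun σ => by
    simpa using isBigO_refl (fun _ => (1 : ℝ)) F

theorem isBigO_det_gram_sub {α : Type*} {F : Filter α} {ε : α → ℝ} (hε : Tendsto ε F (𝓝 0))
    {G G' H H' : α → ∀ l, Matrix ℕ (Fin (P.N l)) ℂ}
    (hG' : ∀ l b c, (fun a => G' a l b c) =O[F] fun _ => (1 : ℝ))
    (hH' : ∀ l b c, (fun a => H' a l b c) =O[F] fun _ => (1 : ℝ))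
    (hG : ∀ l b c, (fun a => G a l b c - G' a l b c) =O[F] ε)
    (hH : ∀ l b c, (fun a => H a l b c - H' a l b c) =O[F] ε) :
    (fun a => (P.gram (G a) (H a)).det - (P.gram (G' a) (H' a)).det) =O[F] ε := by
  have := isBigO_det_sub_det (h := fun _ _ _ => 1) (H := fun _ => 1) (ε := ε)
    (isBigO_gram (P := P) (fun l b c => isBigO_one_of_sub hε (hG l b c) (hG' l b c))
      (fun l b c => isBigO_one_of_sub hε (hH l b c) (hH' l b c)))
    (isBigO_gram hG' hH') (fun r s => by simpa using isBigO_gram_sub hε hG' hH' hG hH r s)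
    (fun σ => by simpa using isBigO_refl (fun _ => (1 : ℝ)) F)
  simpa using this

variable (P) in
/-- The leading minors of the rows `f` dominate the remaining ones up to a factor `ε`. -/
def Dominates (F : Filter (ℝ × ℝ × ℝ)) (ε : ℝ × ℝ × ℝ → ℝ) (f : ∀ l, Fin (P.N l) → ℕ) : Prop :=
  ∀ l w, (fun q => size q ^ (minorWeight (P.N l) (f l) - 1)) =O[F]
    fun q => ε q * ‖schurMinor (P.N l) (f l) (P.argOdd l w q)‖

theorem Dominates.eventually_ne_zero {f : ∀ l, Fin (P.N l) → ℕ} (hD : P.Dominates F ε f) (l : Fin 2)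
    (w : ℕ → ℂ) : ∀ᶠ q in F, schurMinor (P.N l) (f l) (P.argOdd l w q) ≠ 0 := by
  filter_upwards [(hD l w).eq_zero_imp] with q hq h
  exact (zpow_ne_zero _ (size_pos q).ne') (hq (by simp [h]))

theorem Dominates.isBigO_mul_inv {f : ∀ l, Fin (P.N l) → ℕ} (hD : P.Dominates F ε f) (l : Fin 2)
    (w : ℕ → ℂ) : (fun q => size q ^ (minorWeight (P.N l) (f l) - 1) *
      ‖schurMinor (P.N l) (f l) (P.argOdd l w q)‖⁻¹) =O[F] ε := by
  refine ((hD l w).mul (isBigO_refl (fun q =>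
    ‖schurMinor (P.N l) (f l) (P.argOdd l w q)‖⁻¹) F)).trans_eventuallyEq ?_
  filter_upwards [hD.eventually_ne_zero l w] with q hq
  have := norm_ne_zero_iff.mpr hq
  field_simp

/-- A different constant shift changes the minor by one power less, which domination bounds by ε.
Hence the prefactors of τ^{(n)} and τ^{(0)} have a quotient close to 1. -/
theorem Dominates.isBigO_ratio_sub_one {f : ∀ l, Fin (P.N l) → ℕ} (hD : P.Dominates F ε f)
    (l : Fin 2) (w w' : ℕ → ℂ) : (fun q => schurMinor (P.N l) (f l) (P.argOdd l w q) /
      schurMinor (P.N l) (f l) (P.argOdd l w' q) - 1) =O[F] ε := by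
  have h1 := (isBigO_schurMinor_argOdd_sub (P := P) (F := F) l w w' (f l)).mul
    (isBigO_of_le F fun q => (by simp : ‖(schurMinor (P.N l) (f l) (P.argOdd l w' q))⁻¹‖ ≤
      ‖‖schurMinor (P.N l) (f l) (P.argOdd l w' q)‖⁻¹‖))
  refine (h1.trans (hD.isBigO_mul_inv l w')).congr' ?_ EventuallyEq.rfl
  filter_upwards [hD.eventually_ne_zero l w'] with q hq
  field_simp

theorem Dominates.isBigO_prod_ratio_sub_one (hε : Tendsto ε F (𝓝 0)) {f : ∀ l, Fin (P.N l) → ℕ}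
    (hD : P.Dominates F ε f) (w w' : Fin 2 → ℕ → ℂ) :
    (fun q => (∏ l, schurMinor (P.N l) (f l) (P.argOdd l (w l) q)) /
      (∏ l, schurMinor (P.N l) (f l) (P.argOdd l (w' l) q)) - 1) =O[F] ε := by
  have h1 : (fun _ : ℝ × ℝ × ℝ => (1 : ℂ)) =O[F] fun _ => (1 : ℝ) :=
    isBigO_const_const _ one_ne_zero _
  have := isBigO_prod_sub_prod (Finset.univ : Finset (Fin 2)) (h := fun _ _ => 1)
    (f := fun l q => schurMinor (P.N l) (f l) (P.argOdd l (w l) q) /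
      schurMinor (P.N l) (f l) (P.argOdd l (w' l) q)) (g := fun _ _ => 1) (ε := ε)
    (fun l _ => isBigO_one_of_sub hε (hD.isBigO_ratio_sub_one l (w l) (w' l)) h1)
    (fun l _ => h1) (fun l _ => by simpa using hD.isBigO_ratio_sub_one l (w l) (w' l))
  simpa [Finset.prod_div_distrib] using this

/-- The quotient of the `τ`-functions, when the normalized columns have the limits `R`. -/
theorem isBigO_tau_div_sub (hε : Tendsto ε F (𝓝 0)) {f : ∀ l, Fin (P.N l) → ℕ}
    (hD : P.Dominates F ε f)
    {R : (Fin 2 → ℕ → ℂ) → ℝ × ℝ × ℝ → ∀ l, Matrix ℕ (Fin (P.N l)) ℂ}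
    (hR' : ∀ w l b c, (fun q => R w q l b c) =O[F] fun _ => (1 : ℝ))
    (hR : ∀ w l b c, (fun q => normalizedCols (P.N l) (f l) (P.argOdd l (w l) q) b c -
      R w q l b c) =O[F] ε)
    (hlow : (fun _ => (1 : ℝ)) =O[F] fun q => (P.gram (R (fun l r => -P.h3 l none r) q)
      (R (fun l => P.h3 l none) q)).det) (n : Fin 2) :
    (fun q => P.tau q.1 q.2 (some n) / P.tau q.1 q.2 none -
      (P.gram (R (fun l r => -P.h3 l (some n) r) q) (R (fun l => P.h3 l (some n)) q)).det /
      (P.gram (R (fun l r => -P.h3 l none r) q) (R (fun l => P.h3 l none) q)).det) =O[F] ε := by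
  set M : (Fin 2 → ℕ → ℂ) → ℝ × ℝ × ℝ → ∀ l, Matrix ℕ (Fin (P.N l)) ℂ :=
    fun w q l => normalizedCols (P.N l) (f l) (P.argOdd l (w l) q) with hM
  set D : (Fin 2 → ℕ → ℂ) → ℝ × ℝ × ℝ → ℂ :=
    fun w q => ∏ l, schurMinor (P.N l) (f l) (P.argOdd l (w l) q) with hDdef
  set T : Option (Fin 2) → ℝ × ℝ × ℝ → ℂ := fun k q =>
    (P.gram (M (fun l r => -P.h3 l k r) q) (M (fun l => P.h3 l k) q)).det with hT
  set T' : Option (Fin 2) → ℝ × ℝ × ℝ → ℂ := fun k q =>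
    (P.gram (R (fun l r => -P.h3 l k r) q) (R (fun l => P.h3 l k) q)).det with hT'
  have hTT' : ∀ k, (fun q => T k q - T' k q) =O[F] ε := fun k =>
    isBigO_det_gram_sub hε (hR' _) (hR' _) (hR _) (hR _)
  have hT'1 : ∀ k, T' k =O[F] fun _ => (1 : ℝ) := fun k => isBigO_det_gram (hR' _) (hR' _)
  have hne : ∀ w : Fin 2 → ℕ → ℂ, ∀ᶠ q in F, ∀ l, schurMinor (P.N l) (f l) (P.argOdd l (w l) q) ≠ 0 := fun w =>
    eventually_all.mpr fun l => hD.eventually_ne_zero l (w l)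
  have htau : ∀ k, ∀ᶠ q in F, P.tau q.1 q.2 k =
      conj (D (fun l r => -P.h3 l k r) q) * D (fun l => P.h3 l k) q * T k q := by
    intro k
    filter_upwards [hne (fun l r => -P.h3 l k r), hne (fun l => P.h3 l k)] with q h1 h2
    have hrow : ∀ l, oddPart (P.rowArg q.1 q.2 k l) = P.argOdd l (fun r => -P.h3 l k r) q := by
      intro l; rw [argOdd]; congr 1
    have hcol : ∀ l, oddPart (P.colArg q.1 q.2 k l) = P.argOdd l (P.h3 l k) q := fun l => rfl
    rw [tau_eq_mul_det_gram_normalizedCols q.1 q.2 k f (fun l => by rw [hrow]; exact h1 l)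
      (fun l => by rw [hcol]; exact h2 l)]
    simp only [hrow, hcol, hDdef, hT, hM]
  have hone : (fun _ : ℝ × ℝ × ℝ => (1 : ℂ)) =O[F] fun _ => (1 : ℝ) :=
    isBigO_const_const _ one_ne_zero _
  have hρ₁ : (fun q => conj (D (fun l r => -P.h3 l (some n) r) q /
      D (fun l r => -P.h3 l none r) q) - 1) =O[F] ε := by
    have := isBigO_conj (hD.isBigO_prod_ratio_sub_one hε (fun l r => -P.h3 l (some n) r)
      (fun l r => -P.h3 l none r))
    simpa only [map_sub, map_one] using this
  have hρ₂ := hD.isBigO_prod_ratio_sub_one hε (fun l => P.h3 l (some n)) (fun l => P.h3 l none)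
  have hnum := isBigO_mul_sub_mul hε (isBigO_mul_sub_mul hε hρ₁ hρ₂ hone hone) (hTT' (some n))
    (by simpa using hone) (hT'1 (some n))
  simp only [one_mul] at hnum
  refine (isBigO_div_sub_div hε hnum (hTT' none) (hT'1 (some n)) (hT'1 none) hlow).congr' ?_
    EventuallyEq.rfl
  filter_upwards [htau (some n), htau none, hne (fun l r => -P.h3 l none r),
    hne (fun l => P.h3 l none)] with q h1 h2 h3 h4
  have h5 : D (fun l r => -P.h3 l none r) q ≠ 0 := Finset.prod_ne_zero_iff.mpr fun l _ => h3 l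
  have h6 : D (fun l => P.h3 l none) q ≠ 0 := Finset.prod_ne_zero_iff.mpr fun l _ => h4 l
  have h7 : conj (D (fun l r => -P.h3 l none r) q) ≠ 0 := (map_ne_zero _).mpr h5
  rw [h1, h2, map_div₀]
  congr 1
  change conj (D (fun l r => -P.h3 l (some n) r) q) / conj (D (fun l r => -P.h3 l none r) q) *
    (D (fun l => P.h3 l (some n)) q / D (fun l => P.h3 l none) q) * T (some n) q / T none q = _
  -- If the normalized denominator vanishes, both sides are 0 by the convention for division.
  by_cases h8 : T none q = 0
  · simp [h8]
  · field_simp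

end Params

end

end CNLS

/-! ### Limits of the τ-quotient -/

namespace CNLS

open Complex Filter Topology PowerSeries Asymptotics
open scoped ComplexConjugate

noncomputable section

namespace Params

variable {P : Params} {F : Filter (ℝ × ℝ × ℝ)} {ε : ℝ × ℝ × ℝ → ℝ}

/-- Replacing a pivot row by a lower one costs at least one unit of weight, which domination turns
into ε. -/
theorem Dominates.isBigO_normalizedCols_below {f : ∀ l, Fin (P.N l) → ℕ}
    (hD : P.Dominates F ε f) (l : Fin 2) (w : ℕ → ℂ) {b : ℕ} {c : Fin (P.N l)} (hb : f l c < b) :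
    (fun q => normalizedCols (P.N l) (f l) (P.argOdd l w q) b c) =O[F] ε :=
  (isBigO_normalizedCols one_le_size (isBigO_argOdd l w) (f l) hb).trans (hD.isBigO_mul_inv l w)

theorem Dominates.isBigO_normalizedCols_pivot {f : ∀ l, Fin (P.N l) → ℕ}
    (hD : P.Dominates F ε f) (l : Fin 2) (w : ℕ → ℂ) (i c : Fin (P.N l)) :
    (fun q => normalizedCols (P.N l) (f l) (P.argOdd l w q) (f l i) c -
      if i = c then 1 else 0) =O[F] ε := by
  refine (isBigO_zero ε F).congr' ?_ EventuallyEq.rfl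
  filter_upwards [hD.eventually_ne_zero l w] with q hq
  rw [normalizedCols_apply_row hq, sub_self]

/-- The pivots fill the first N rows, so each remaining row lies below all of them. -/
theorem Dominates.isBigO_normalizedCols_sub_unitCols {f : ∀ l, Fin (P.N l) → ℕ}
    (hD : P.Dominates F ε f) (l : Fin 2) (hf : f l = baseRows (P.N l)) (w : ℕ → ℂ) (b : ℕ)
    (c : Fin (P.N l)) : (fun q => normalizedCols (P.N l) (f l) (P.argOdd l w q) b c -
      P.unitCols l b c) =O[F] ε := by
  by_cases hb : b < P.N l
  · have h := hD.isBigO_normalizedCols_pivot l w ⟨b, hb⟩ c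
    rw [hf] at h ⊢
    simpa [baseRows, unitCols, Fin.ext_iff] using h
  · have h : f l c < b := by rw [hf, baseRows]; omega
    have h0 : P.unitCols l b c = 0 := by simp [unitCols, show b ≠ c by omega]
    simpa only [h0, sub_zero] using hD.isBigO_normalizedCols_below l w h

theorem det_gram_unitCols : (P.gram P.unitCols P.unitCols).det = P.pMinor (fun s => s.2) := by
  rw [pMinor]
  congr 1
  ext r s
  have h1 : ∀ a, ∑ b ∈ Finset.range P.rowBound, P.pEntry r.1 s.1 a b * P.unitCols s.1 b s.2 =
      P.pEntry r.1 s.1 a s.2 := fun a => by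
    simpa only [mul_comm] using sum_unitCols_mul s.1 s.2 (P.pEntry r.1 s.1 a)
  have h2 : ∀ a, conj (P.unitCols r.1 a r.2) = P.unitCols r.1 a r.2 := fun a => by
    simp only [unitCols, Matrix.of_apply]; split_ifs <;> simp
  simp only [gram, Matrix.of_apply, h1, h2]
  exact sum_unitCols_mul r.1 r.2 fun a => P.pEntry r.1 s.1 a s.2

theorem isBigO_unitCols (l : Fin 2) (b : ℕ) (c : Fin (P.N l)) :
    (fun _ : ℝ × ℝ × ℝ => P.unitCols l b c) =O[F] fun _ => (1 : ℝ) :=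
  isBigO_const_const _ one_ne_zero _

/-- Away from all roots the quotient of the `τ`-functions tends to `1`. -/
theorem tendsto_tau_div (hF : Tendsto Prod.fst F atTop) (h1 : ∀ l, P.chi1 l ≠ 0)
    (him : ∀ l, (P.chi l).im ≠ 0) (hmin : P.pMinor (fun s => s.2) ≠ 0)
    (hs : ∀ l z, adlerMoser (P.N l) (P.κ l) z = 0 → deriv (adlerMoser (P.N l) (P.κ l)) z ≠ 0)
    (hfar : ∀ l, ∀ z ∈ rootSet (P.N l) (P.κ l),
      Tendsto (fun q : ℝ × ℝ × ℝ => ‖P.xPlus q.1 q.2 l 1 - q.1 * z‖) F atTop) (n : Fin 2) :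
    Tendsto (fun q : ℝ × ℝ × ℝ => P.tau q.1 q.2 (some n) / P.tau q.1 q.2 none) F (𝓝 1) := by
  set W : Fin 2 → ℤ := fun l => minorWeight (P.N l) (baseRows (P.N l)) with hW
  set D : ∀ _ : Fin 2, (ℕ → ℂ) → ℝ × ℝ × ℝ → ℂ :=
    fun l w q => schurMinor (P.N l) (baseRows (P.N l)) (P.argOdd l w q) with hDdef
  have hlo : ∀ l w, (fun q => size q ^ (W l - 1)) =o[F] D l w := fun l w =>
    isLittleO_size_schurMinor hF (h1 l) (him l) (hs l) (hfar l) w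
  -- No rate is known here, so ε is assembled from the ratios that are required to be small.
  set g : Fin 2 → ℝ × ℝ × ℝ → ℝ := fun l q => size q ^ (W l - 1) / ‖D l 0 q‖ with hg
  have hg0 : ∀ l, Tendsto (g l) F (𝓝 0) := fun l => by
    exact (hlo l 0).norm_right.tendsto_div_nhds_zero
  set ε : ℝ × ℝ × ℝ → ℝ := fun q => ∑ l, g l q with hεdef
  have hε : Tendsto ε F (𝓝 0) := by
    have := tendsto_finsetSum Finset.univ fun l (_ : l ∈ Finset.univ) => hg0 l
    rwa [Finset.sum_const_zero] at this
  have hgε : ∀ l, g l =O[F] ε := fun l => isBigO_of_le _ fun q => by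
    have hpos : ∀ l, 0 ≤ g l q := fun l =>
      div_nonneg (zpow_nonneg (size_pos q).le _) (norm_nonneg _)
    rw [Real.norm_of_nonneg (hpos l), Real.norm_of_nonneg (Finset.sum_nonneg fun l _ => hpos l)]
    exact Finset.single_le_sum (fun l _ => hpos l) (Finset.mem_univ l)
  have hD : P.Dominates F ε fun l => baseRows (P.N l) := by
    intro l w
    -- The ratios use the shift 0 only. Minors with other shifts differ from it by a negligible
    -- amount.
    have h0w : D l 0 =O[F] D l w :=
      (IsEquivalent.isBigO (v := D l w)
        ((isBigO_schurMinor_argOdd_sub l 0 w _).trans_isLittleO (hlo l w)))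
    refine IsBigO.trans ?_ ((hgε l).mul h0w.norm_norm)
    refine EventuallyEq.isBigO ?_
    filter_upwards [(hlo l 0).isBigO.eq_zero_imp] with q hq
    have : ‖D l 0 q‖ ≠ 0 := fun h =>
      zpow_ne_zero _ (size_pos q).ne' (hq (norm_eq_zero.mp h))
    rw [hg]; field_simp; rfl
  have key := isBigO_tau_div_sub hε hD (R := fun _ _ => P.unitCols)
    (fun w l b c => isBigO_unitCols l b c)
    (fun w l b c => hD.isBigO_normalizedCols_sub_unitCols l rfl (w l) b c)
    (by simpa only [det_gram_unitCols] using isBigO_const_const (1 : ℝ) hmin F) n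
  simp only [det_gram_unitCols, div_self hmin] at key
  have := (key.trans_tendsto hε).add_const 1
  simpa using this

theorem size_inv_tendsto (hF : Tendsto Prod.fst F atTop) :
    Tendsto (fun q => (size q)⁻¹) F (𝓝 0) := (tendsto_size hF).inv_tendsto_atTop

/-- Near a root of block `l` the quotient of the `τ`-functions is that of a fundamental wave. -/
theorem isBigO_tau_div_sub_fundamental (hF : Tendsto Prod.fst F atTop)
    (hΛ : size =O[F] fun q => q.1) (hχ : ∀ l m, P.chi l ≠ conj (P.chi m))
    (h1 : ∀ l, P.chi1 l ≠ 0) {l o : Fin 2} (hlo : l ≠ o) (hne : P.chi l ≠ P.chi o)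
    (hN : 0 < P.N l) {z : ℂ} (hz : adlerMoser (P.N l) (P.κ l) z = 0)
    (hz' : deriv (adlerMoser (P.N l) (P.κ l)) z ≠ 0)
    (hX : (fun q : ℝ × ℝ × ℝ => P.xPlus q.1 q.2 l 1 - q.1 * z) =O[F] fun _ => (1 : ℝ))
    {z₁ : ℂ} (hz₁ : adlerMoser (P.N o) (P.κ o) z₁ ≠ 0)
    (ho : ∀ w, Tendsto (P.scaledArg o w) F (𝓝 z₁)) (n : Fin 2) :
    (fun q : ℝ × ℝ × ℝ => P.tau q.1 q.2 (some n) / P.tau q.1 q.2 none -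
      (conj (P.xPlus q.1 q.2 l 1 - q.1 * z + P.delta l - P.h3 l (some n) 1) *
          (P.xPlus q.1 q.2 l 1 - q.1 * z + P.delta l + P.h3 l (some n) 1) +
          ((‖P.chi1 l‖ ^ 2 / (4 * (P.chi l).im ^ 2) : ℝ) : ℂ)) /
        (conj (P.xPlus q.1 q.2 l 1 - q.1 * z + P.delta l) *
          (P.xPlus q.1 q.2 l 1 - q.1 * z + P.delta l) +
          ((‖P.chi1 l‖ ^ 2 / (4 * (P.chi l).im ^ 2) : ℝ) : ℂ))) =O[F] fun q => (size q)⁻¹ := by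
  obtain ⟨hmin, hdet⟩ := det_gram_modCols hχ h1 hlo hne
  have hdet := hdet hN
  set k2 : ℝ := ‖P.chi1 l‖ ^ 2 / (4 * (P.chi l).im ^ 2) with hk2
  have him : (P.chi l).im ≠ 0 := fun h => hχ l l (Complex.conj_eq_iff_im.mpr h).symm
  have hk2pos : 0 < k2 := by
    have := norm_pos_iff.mpr (h1 l)
    positivity
  have hε := size_inv_tendsto hF
  set X : ℝ × ℝ × ℝ → ℂ := fun q => P.xPlus q.1 q.2 l 1 - q.1 * z with hXdef
  -- In block l the top minor degenerates at z, but simplicity of the root keeps the shifted minor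
  -- large. In block o the point is not a root and the top minor is used.
  set f : ∀ k, Fin (P.N k) → ℕ := fun k => if k = l then shiftedRows (P.N k) else baseRows (P.N k)
    with hf
  have hfl : f l = shiftedRows (P.N l) := if_pos rfl
  have hfo : f o = baseRows (P.N o) := if_neg hlo.symm
  have hz1 : (minorPoly (P.N l) (shiftedRows (P.N l)) (P.κ l)).eval z ≠ 0 := by
    rw [deriv_adlerMoser, derivative_minorPoly_baseRows hN] at hz'
    exact (mul_ne_zero_iff.mp hz').2
  have hlow : ∀ k w, (fun q => size q ^ minorWeight (P.N k) (f k)) =O[F]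
      fun q => schurMinor (P.N k) (f k) (P.argOdd k w q) := by
    intro k w
    by_cases hk : k = l
    · subst hk
      rw [hfl]
      refine isBigO_size_schurMinor hF hΛ k w _ (tendsto_scaledArg hF hX w) hz1 ?_
      rw [minorWeight_shiftedRows hN, minorWeight_baseRows]
      have : 2 ≤ P.N k * (P.N k + 1) := by nlinarith
      omega
    · obtain rfl := eq_of_ne_of_ne hlo hk
      rw [hfo]
      refine isBigO_size_schurMinor hF hΛ k w _ (ho w)
        (fun h => hz₁ ((adlerMoser_eq_zero_iff z₁).mpr h)) ?_
      rw [minorWeight_baseRows]; positivity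
  have hD : P.Dominates F (fun q => (size q)⁻¹) f := by
    intro k w
    refine ((isBigO_refl (fun q => (size q)⁻¹) F).mul (hlow k w).norm_right).congr_left fun q => ?_
    rw [zpow_sub_one₀ (size_pos q).ne', mul_comm]
  set R : (Fin 2 → ℕ → ℂ) → ℝ × ℝ × ℝ → ∀ k, Matrix ℕ (Fin (P.N k)) ℂ :=
    fun w q => P.modCols l (X q + w l 1) with hR
  have hR1 : ∀ w k b c, (fun q => R w q k b c) =O[F] fun _ => (1 : ℝ) := by
    intro w k b c
    simp only [hR, modCols, Matrix.of_apply]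
    split_ifs
    · exact hX.add (isBigO_const_const _ one_ne_zero _)
    all_goals exact isBigO_const_const _ one_ne_zero _
  have hRM : ∀ w k b c, (fun q => normalizedCols (P.N k) (f k) (P.argOdd k (w k) q) b c -
      R w q k b c) =O[F] fun q => (size q)⁻¹ := by
    intro w k b c
    by_cases hk : k = l
    swap
    · obtain rfl := eq_of_ne_of_ne hlo hk
      have : ∀ q, R w q k b c = P.unitCols k b c := fun q => by simp [hR, modCols, unitCols, hk]
      simp only [this]
      exact hD.isBigO_normalizedCols_sub_unitCols k hfo (w k) b c
    subst hk
    have hrow : ∀ i : Fin (P.N k), f k i = if (i : ℕ) + 1 = P.N k then P.N k else i := fun i => by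
      rw [hfl, shiftedRows]
    -- Counted from 0, N - 1 is the only row up to N that is not a pivot. In the last column it
    -- carries the quotient of the two leading minors; in the other columns it lies below the pivot.
    by_cases hb : b + 1 = P.N k
    · by_cases hc : (c : ℕ) + 1 = P.N k
      · have hbc : b = c := by omega
        have hval : ∀ q, normalizedCols (P.N k) (f k) (P.argOdd k (w k) q) b c =
            schurMinor (P.N k) (baseRows (P.N k)) (P.argOdd k (w k) q) /
            schurMinor (P.N k) (shiftedRows (P.N k)) (P.argOdd k (w k) q) := by
          intro q
          rw [normalizedCols_apply, hfl]
          congr 2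
          funext i
          by_cases hi : i = c
          · subst hi; simp [baseRows, hbc]
          · have : (i : ℕ) + 1 ≠ P.N k := fun h => hi (Fin.ext (by omega))
            simp [Function.update_of_ne hi, shiftedRows, baseRows, this]
        have hRv : ∀ q, R w q k b c = P.xPlus q.1 q.2 k 1 - q.1 * z + w k 1 := fun q => by
          simp [hR, modCols, hc, hbc, hXdef]
        simp only [hval, hRv]
        exact isBigO_minor_quotient hF hΛ hN hX ((adlerMoser_eq_zero_iff z).mp hz) hz1 (w k)
      · have hRv : ∀ q, R w q k b c = 0 := fun q => by
          simp [hR, modCols, hc, show b ≠ c by omega]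
        simp only [hRv, sub_zero]
        refine hD.isBigO_normalizedCols_below k (w k) ?_
        rw [hrow, if_neg hc]; omega
    by_cases hb' : P.N k < b
    · have hRv : ∀ q, R w q k b c = 0 := fun q => by
        have h2 : b ≠ c := by omega
        have h3 : b ≠ c + 1 := by omega
        simp [hR, modCols, h2, h3]
      simp only [hRv, sub_zero]
      refine hD.isBigO_normalizedCols_below k (w k) ?_
      rw [hrow]; split_ifs <;> omega
    · have hpiv : ∃ i : Fin (P.N k), f k i = b := by
        by_cases hbN : b = P.N k
        · exact ⟨⟨P.N k - 1, by omega⟩, by rw [hrow, if_pos (by simp; omega), hbN]⟩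
        · exact ⟨⟨b, by omega⟩, by rw [hrow, if_neg hb]⟩
      obtain ⟨i, hi⟩ := hpiv
      have hRv : ∀ q, R w q k b c = if i = c then 1 else 0 := fun q => by
        rw [hrow] at hi
        have hic : i = c ↔ (i : ℕ) = c := Fin.ext_iff
        simp only [hR, modCols, Matrix.of_apply, hic, true_and]
        by_cases hc : (c : ℕ) + 1 = P.N k
        · rw [if_pos hc, if_neg (by omega)]
          refine if_congr ?_ rfl rfl
          split_ifs at hi <;> omega
        · rw [if_neg hc]
          refine if_congr ?_ rfl rfl
          split_ifs at hi <;> omega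
      simp only [hRv]
      rw [← hi]
      exact hD.isBigO_normalizedCols_pivot k (w k) i c
  have hT : ∀ (w w' : Fin 2 → ℕ → ℂ) q, (P.gram (R w q) (R w' q)).det =
      P.pMinor (fun s => s.2) * (conj (X q + w l 1 + P.delta l) * (X q + w' l 1 + P.delta l) +
        (k2 : ℂ)) := fun w w' q => hdet _ _
  have hzero : ∀ m, P.h3 m none = 0 := fun m => rfl
  have hden : ∀ q, conj (X q + P.delta l) * (X q + P.delta l) + (k2 : ℂ) =
      ((‖X q + P.delta l‖ ^ 2 + k2 : ℝ) : ℂ) := fun q => by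
    rw [mul_comm, Complex.mul_conj, Complex.normSq_eq_norm_sq]; push_cast; ring
  have key := isBigO_tau_div_sub hε hD hR1 hRM ?_ n
  · refine key.congr_left fun q => ?_
    simp only [hT, hzero, Pi.zero_apply, neg_zero, add_zero]
    rw [mul_div_mul_left _ _ hmin]
    rw [show X q + -P.h3 l (some n) 1 + P.delta l = X q + P.delta l - P.h3 l (some n) 1 by ring,
      show X q + P.h3 l (some n) 1 + P.delta l = X q + P.delta l + P.h3 l (some n) 1 by ring]
  · simp only [hT, hzero, Pi.zero_apply, neg_zero, add_zero, hden]
    -- The denominator is at least k2 > 0, whatever the phase.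
    have h2 : (fun _ => (1 : ℝ)) =O[F] fun q => ((‖X q + P.delta l‖ ^ 2 + k2 : ℝ) : ℂ) := by
      refine IsBigO.of_bound k2⁻¹ (Eventually.of_forall fun q => ?_)
      rw [norm_one, Complex.norm_real, Real.norm_of_nonneg (by positivity), ← div_eq_inv_mul,
        le_div_iff₀ hk2pos]
      nlinarith [sq_nonneg ‖X q + P.delta l‖]
    simpa using (isBigO_const_const (1 : ℝ) hmin F).mul h2

end Params

end

end CNLS

/-! ### Positions of the centres and the splitting -/

namespace CNLS

open Complex Filter Topology PowerSeries Asymptotics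
open scoped ComplexConjugate

noncomputable section

/-- The complex coordinate `x + χ t`. -/
def phase (χ : ℂ) (p : ℝ × ℝ) : ℂ := p.1 + χ * p.2

theorem phase_sub (χ : ℂ) (p r : ℝ × ℝ) : phase χ (p - r) = phase χ p - phase χ r := by
  simp only [phase, Prod.fst_sub, Prod.snd_sub]; push_cast; ring

theorem phase_planePoint {χ : ℂ} (h : χ.im ≠ 0) (w : ℂ) : phase χ (Params.planePoint χ w) = w := by
  apply Complex.ext
  · simp [phase, Params.planePoint]
  · simp [phase, Params.planePoint]; field_simp

theorem abs_fst_le_planeDist (p r : ℝ × ℝ) : |p.1 - r.1| ≤ planeDist p r :=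
  Real.abs_le_sqrt (by nlinarith [sq_nonneg (p.2 - r.2)])

theorem abs_snd_le_planeDist (p r : ℝ × ℝ) : |p.2 - r.2| ≤ planeDist p r :=
  Real.abs_le_sqrt (by nlinarith [sq_nonneg (p.1 - r.1)])

theorem planeDist_le_add (p r : ℝ × ℝ) : planeDist p r ≤ |p.1 - r.1| + |p.2 - r.2| := by
  rw [planeDist, Real.sqrt_le_left (by positivity)]
  nlinarith [sq_abs (p.1 - r.1), sq_abs (p.2 - r.2),
    mul_nonneg (abs_nonneg (p.1 - r.1)) (abs_nonneg (p.2 - r.2))]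

theorem planeDist_self (p : ℝ × ℝ) : planeDist p p = 0 := by simp [planeDist]

theorem norm_phase_sub_le (χ : ℂ) (p r : ℝ × ℝ) :
    ‖phase χ p - phase χ r‖ ≤ (1 + ‖χ‖) * planeDist p r := by
  rw [← phase_sub, phase]
  calc ‖((p - r).1 : ℂ) + χ * (p - r).2‖ ≤ |p.1 - r.1| + ‖χ‖ * |p.2 - r.2| := by
        refine (norm_add_le _ _).trans_eq ?_
        rw [norm_mul, Complex.norm_real, Complex.norm_real]; rfl
    _ ≤ planeDist p r + ‖χ‖ * planeDist p r := by
        gcongr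
        · exact abs_fst_le_planeDist p r
        · exact abs_snd_le_planeDist p r
    _ = _ := by ring

/-- For Im χ ≠ 0 the phase is a real linear isomorphism: t is recovered from the imaginary part,
then x from the real part. -/
theorem planeDist_le_norm_phase {χ : ℂ} (h : χ.im ≠ 0) (p r : ℝ × ℝ) :
    planeDist p r ≤ (1 + (1 + ‖χ‖) / |χ.im|) * ‖phase χ p - phase χ r‖ := by
  have hc : 0 < |χ.im| := abs_pos.mpr h
  rw [← phase_sub]
  set v := phase χ (p - r) with hv
  have ht : |p.2 - r.2| ≤ ‖v‖ / |χ.im| := by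
    rw [le_div_iff₀ hc, mul_comm, ← abs_mul]
    have : χ.im * (p.2 - r.2) = v.im := by simp [hv, phase]
    rw [this]; exact Complex.abs_im_le_norm v
  have hx : |p.1 - r.1| ≤ ‖v‖ + ‖χ‖ * |p.2 - r.2| := by
    calc |p.1 - r.1| = ‖v - χ * ((p.2 - r.2 : ℝ) : ℂ)‖ := by
          rw [hv, phase, Prod.snd_sub, add_sub_cancel_right, Complex.norm_real]; rfl
      _ ≤ ‖v‖ + ‖χ * ((p.2 - r.2 : ℝ) : ℂ)‖ := norm_sub_le _ _
      _ = _ := by rw [norm_mul, Complex.norm_real, Real.norm_eq_abs]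
  calc planeDist p r ≤ |p.1 - r.1| + |p.2 - r.2| := planeDist_le_add p r
    _ ≤ ‖v‖ + (1 + ‖χ‖) * |p.2 - r.2| := by linarith
    _ ≤ ‖v‖ + (1 + ‖χ‖) * (‖v‖ / |χ.im|) := by gcongr
    _ = _ := by field_simp

theorem phase_injective {χ : ℂ} (h : χ.im ≠ 0) : Function.Injective (phase χ) := by
  intro p r hpr
  have := planeDist_le_norm_phase h p r
  rw [hpr, sub_self, norm_zero, mul_zero] at this
  have h1 := (abs_fst_le_planeDist p r).trans this
  have h2 := (abs_snd_le_planeDist p r).trans this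
  rw [abs_nonpos_iff, sub_eq_zero] at h1 h2
  exact Prod.ext h1 h2

/-- The quotient that describes a fundamental rogue wave. -/
theorem fundamental_eq_firstOrder {b : ℝ} {χ s : ℂ} {n : Fin 2} (him : χ.im ≠ 0) (hs : s ≠ 0)
    (p : ℝ × ℝ) :
    (conj (I * s * phase χ p - -s / (χ + waveNumber b n)) *
        (I * s * phase χ p + -s / (χ + waveNumber b n)) + ((‖s‖ ^ 2 / (4 * χ.im ^ 2) : ℝ) : ℂ)) /
      (conj (I * s * phase χ p) * (I * s * phase χ p) + ((‖s‖ ^ 2 / (4 * χ.im ^ 2) : ℝ) : ℂ)) =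
    firstOrder b χ n p := by
  set a : ℂ := χ + waveNumber b n with ha
  set V := phase χ p with hV
  have ha0 : a ≠ 0 := fun h => him (by simpa [ha] using congrArg Complex.im h)
  have hs' : conj s ≠ 0 := (map_ne_zero _).mpr hs
  have ha' : conj a ≠ 0 := (map_ne_zero _).mpr ha0
  have hns : ((‖s‖ : ℝ) : ℂ) ^ 2 = conj s * s := by
    rw [mul_comm, Complex.mul_conj, Complex.normSq_eq_norm_sq]; push_cast; rfl
  have hna : ((‖a‖ : ℝ) : ℂ) ^ 2 = conj a * a := by
    rw [mul_comm, Complex.mul_conj, Complex.normSq_eq_norm_sq]; push_cast; rfl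
  have himC : (χ.im : ℂ) ≠ 0 := by exact_mod_cast him
  have hden : (((p.1 + χ.re * p.2) ^ 2 + χ.im ^ 2 * p.2 ^ 2 + 1 / (4 * χ.im ^ 2) : ℝ) : ℂ) =
      conj V * V + 1 / (4 * (χ.im : ℂ) ^ 2) := by
    have : conj V * V = (((p.1 + χ.re * p.2) ^ 2 + χ.im ^ 2 * p.2 ^ 2 : ℝ) : ℂ) := by
      rw [mul_comm, Complex.mul_conj, Complex.normSq_apply]
      congr 1
      simp [hV, phase]; ring
    rw [this]; push_cast; ring
  have hden0 : conj V * V + 1 / (4 * (χ.im : ℂ) ^ 2) ≠ 0 := by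
    rw [← hden]
    have : 0 < (p.1 + χ.re * p.2) ^ 2 + χ.im ^ 2 * p.2 ^ 2 + 1 / (4 * χ.im ^ 2) := by positivity
    exact_mod_cast this.ne'
  have hnum : ((((χ.re + waveNumber b n) * (p.1 + χ.re * p.2) - χ.im ^ 2 * p.2 : ℝ) : ℂ)) =
      (V * a + conj V * conj a) / 2 := by
    have h1 : V * a + conj V * conj a = ((2 * (V * a).re : ℝ) : ℂ) := by
      rw [← map_mul, Complex.add_conj]
    rw [h1, eq_div_iff two_ne_zero]
    norm_cast
    simp [hV, phase, ha]; ring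
  rw [firstOrder, hden, hnum, ← ha]
  -- Numerator and denominator both contain the factor |s|², so χ_l^{[1]} drops out of the profile.
  have e1 : conj (I * s * V - -s / a) * (I * s * V + -s / a) +
      ((‖s‖ ^ 2 / (4 * χ.im ^ 2) : ℝ) : ℂ) = conj s * s * ((conj V * V + 1 / (4 * (χ.im : ℂ) ^ 2)) +
        2 * I / (conj a * a) * ((V * a + conj V * conj a) / 2 + I / 2)) := by
    push_cast
    rw [hns]
    simp only [map_sub, map_mul, map_div₀, map_neg, Complex.conj_I]
    field_simp
    ring_nf
    simp only [Complex.I_sq]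
    ring
  have e2 : conj (I * s * V) * (I * s * V) + ((‖s‖ ^ 2 / (4 * χ.im ^ 2) : ℝ) : ℂ) =
      conj s * s * (conj V * V + 1 / (4 * (χ.im : ℂ) ^ 2)) := by
    push_cast
    rw [hns]
    simp only [map_mul, Complex.conj_I]
    ring_nf
    simp only [Complex.I_sq]
    ring
  rw [e1, e2, mul_div_mul_left _ _ (mul_ne_zero hs' hs), add_div, div_self hden0]
  push_cast
  rw [hna]
  ring

theorem norm_planeWave (b : ℝ) (n : Fin 2) (p : ℝ × ℝ) : ‖planeWave b n p‖ = 1 := by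
  rw [planeWave, mul_comm, Complex.norm_exp_ofReal_mul_I]

namespace Params

variable {P : Params}

/-- For real χ the double-root equation is 1 plus a sum of squares equal to 0. Poles need no
separate treatment, since 1 / 0 = 0. -/
theorem Admissible.chi_im_ne_zero (hP : P.Admissible) (l : Fin 2) : (P.chi l).im ≠ 0 := by
  intro h
  have h1 := hP.double_root l
  have h2 : P.chi l = ((P.chi l).re : ℂ) := Complex.ext rfl (by simp [h])
  rw [h2, Fin.sum_univ_two] at h1
  have h3 : (1 : ℝ) + (1 / ((P.chi l).re + waveNumber P.b 0) ^ 2 +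
      1 / ((P.chi l).re + waveNumber P.b 1) ^ 2) = 0 := by exact_mod_cast h1
  have : (0 : ℝ) ≤ 1 / ((P.chi l).re + waveNumber P.b 0) ^ 2 := by positivity
  have : (0 : ℝ) ≤ 1 / ((P.chi l).re + waveNumber P.b 1) ^ 2 := by positivity
  linarith

theorem Admissible.chi_add_ne_zero (hP : P.Admissible) (l n : Fin 2) :
    P.chi l + waveNumber P.b n ≠ 0 := fun h =>
  hP.chi_im_ne_zero l (by simpa using congrArg Complex.im h)

theorem Admissible.ne_conj (hP : P.Admissible) (l m : Fin 2) : P.chi l ≠ conj (P.chi m) := by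
  have hself : ∀ k, P.chi k ≠ conj (P.chi k) := fun k h =>
    hP.chi_im_ne_zero k (Complex.conj_eq_iff_im.mp h.symm)
  fin_cases l <;> fin_cases m
  · exact hself 0
  · exact fun h => hP.chi_ne_conj (by simpa using (congrArg conj h).symm)
  · exact hP.chi_ne_conj
  · exact hself 1

theorem Admissible.double_root_eq (hP : P.Admissible) (l : Fin 2) :
    (P.chi l ^ 2 - P.b ^ 2) ^ 2 + 2 * P.chi l ^ 2 + 2 * P.b ^ 2 = 0 := by
  have h := hP.double_root l
  have h0 := hP.chi_add_ne_zero l 0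
  have h1 := hP.chi_add_ne_zero l 1
  simp only [Fin.sum_univ_two, waveNumber, Fin.val_zero, Fin.val_one, pow_zero, pow_one, one_mul,
    neg_mul, Complex.ofReal_neg] at h h0 h1
  field_simp at h
  linear_combination h

/-- If χ_l^{[1]} = 0, the root moves only at order ε². At a double root the χ-derivative of the
characteristic polynomial vanishes, so at order ε² only the λ-variation λ_l^{[2]} (χ_l² - b²) is
left, and it would have to be 0. -/
theorem Admissible.chi1_ne_zero (hP : P.Admissible) (l : Fin 2) : P.chi1 l ≠ 0 := by
  intro hc1
  have h0 := hP.chi_add_ne_zero l 0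
  have h1 := hP.chi_add_ne_zero l 1
  have hdbl := hP.double_root_eq l
  have hlam : 2 * P.lam l = P.chi l - ∑ n : Fin 2, 1 / (P.chi l + waveNumber P.b n) := by
    rw [lam]; ring
  simp only [Fin.sum_univ_two, waveNumber, Fin.val_zero, Fin.val_one, pow_zero, pow_one, one_mul,
    neg_mul, Complex.ofReal_neg] at hlam h0 h1
  obtain ⟨g, hg⟩ : (X : PowerSeries ℂ) ^ 2 ∣ P.chiSeries l - C (P.chi l) := by
    rw [X_pow_dvd_iff]
    intro m hm
    interval_cases m
    · simp [chi]
    · simpa [coeff_C, chi1] using hc1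
  have hser : P.chiSeries l = C (P.chi l) + X ^ 2 * g := by rw [← hg]; ring
  have h := hP.char_eq l
  simp only [chiAddWave, lamSeries, hser, waveNumber, Fin.val_zero, Fin.val_one, pow_zero, pow_one,
    one_mul, neg_mul, Complex.ofReal_neg, map_neg] at h
  set c := P.chi l
  set μ := P.lam l
  set ν := P.lam2 l
  set β : ℂ := (P.b : ℂ)
  obtain ⟨k₀, hk₀⟩ : ∃ k, k = (c - 2 * μ) * (c ^ 2 - β ^ 2) - 2 * c := ⟨_, rfl⟩
  have h2 : C k₀ + X ^ 2 *
      (g * C (c ^ 2 - β ^ 2) + C (c - 2 * μ) * C (2 * c) * g - C 2 * C ν * C (c ^ 2 - β ^ 2) -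
        C 2 * g + X ^ 2 * (C (c - 2 * μ) * g ^ 2 + (g - C 2 * C ν) * (C (2 * c) * g + X ^ 2 * g ^ 2)))
      = 0 := by
    rw [← h, hk₀]
    simp only [map_sub, map_mul, map_pow]
    have : (C 2 : PowerSeries ℂ) = 2 := map_ofNat C 2
    rw [this]; ring
  have h3 := congrArg (coeff 2) h2
  rw [map_add, coeff_X_pow_mul', if_pos le_rfl, Nat.sub_self, map_zero] at h3
  rw [coeff_C_of_ne_zero two_ne_zero, zero_add] at h3
  simp at h3
  have hD : c ^ 2 - β ^ 2 ≠ 0 := by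
    rw [show c ^ 2 - β ^ 2 = (c + β) * (c + -β) by ring]; exact mul_ne_zero h0 h1
  have h5 : (c - 2 * μ) * (c ^ 2 - β ^ 2) = 2 * c := by
    rw [hlam]; field_simp; ring
  have h4 : ν * (c ^ 2 - β ^ 2) ^ 2 = 0 := by
    linear_combination (-(c ^ 2 - β ^ 2) / 2) * h3 + constantCoeff g * c * h5 +
      constantCoeff g / 2 * hdbl
  exact mul_ne_zero (hP.lam2_ne l) (pow_ne_zero 2 hD) h4

theorem Admissible.h3_one (hP : P.Admissible) (l n : Fin 2) :
    P.h3 l (some n) 1 = -P.chi1 l / (P.chi l + waveNumber P.b n) := by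
  set a := P.chi l + waveNumber P.b n with ha
  have ha0 : a ≠ 0 := hP.chi_add_ne_zero l n
  have hc : constantCoeff (P.chiAddWave l n) = a := by simp [chiAddWave, ha, chi]
  set f := C a * (P.chiAddWave l n)⁻¹ with hf
  have hf0 : constantCoeff f = 1 := by simp [hf, hc, ha0]
  have hmul : f * P.chiAddWave l n = C a := by
    rw [hf, mul_assoc, PowerSeries.inv_mul_cancel _ (by rw [hc]; exact ha0), mul_one]
  have h1 := congrArg (coeff 1) hmul
  rw [coeff_mul, Finset.Nat.sum_antidiagonal_eq_sum_range_succ_mk] at h1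
  simp [Finset.sum_range_succ, hf0, hc] at h1
  have h2 : coeff 1 (P.chiAddWave l n) = P.chi1 l := by simp [chiAddWave, chi1]
  have h3 : P.h3 l (some n) 1 = coeff 1 f := by
    have := schur_coeff_logOf hf0 1
    rw [schur_one] at this
    exact this
  rw [h3, eq_div_iff ha0]
  rw [h2] at h1
  linear_combination h1

theorem phase_rootPoint (him : ∀ l, (P.chi l).im ≠ 0) (A : ℝ) (l : Fin 2) (z : ℂ) :
    phase (P.chi l) (P.rootPoint A l z) = (z - P.κ l 1) * A / (I * P.chi1 l) :=
  phase_planePoint (him l) _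

theorem phase_centre (him : ∀ l, (P.chi l).im ≠ 0) (A : ℝ) (l : Fin 2) (z : ℂ) :
    phase (P.chi l) (P.centre A l z) = ((z - P.κ l 1) * A - P.delta l) / (I * P.chi1 l) :=
  phase_planePoint (him l) _

theorem phase_smul_add (χ : ℂ) (A : ℝ) (p r : ℝ × ℝ) :
    phase χ (A • p + r) = A * phase χ p + phase χ r := by
  simp [phase]; ring

theorem rootPoint_eq_smul (him : ∀ l, (P.chi l).im ≠ 0) (A : ℝ) (l : Fin 2) (z : ℂ) :
    P.rootPoint A l z = A • P.rootPoint 1 l z + 0 := by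
  apply phase_injective (him l)
  rw [phase_smul_add, phase_rootPoint him, phase_rootPoint him]
  simp [phase]; ring

/-- The displacement of the centres from the scaled roots. -/
theorem centre_eq_smul (him : ∀ l, (P.chi l).im ≠ 0) (A : ℝ) (l : Fin 2) (z : ℂ) :
    P.centre A l z =
      A • P.rootPoint 1 l z + planePoint (P.chi l) (-P.delta l / (I * P.chi1 l)) := by
  apply phase_injective (him l)
  rw [phase_smul_add, phase_rootPoint him, phase_centre him, phase_planePoint (him l)]
  push_cast; ring

theorem xPlus_one_eq_phase (A : ℝ) (p : ℝ × ℝ) (l : Fin 2) :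
    P.xPlus A p l 1 = I * P.chi1 l * phase (P.chi l) p + P.κ l 1 * A := xPlus_one A p l

/-- The centre is defined so that the shift Δ_l from `det_gram_modCols` is absorbed and only the
phase relative to the centre remains. -/
theorem xPlus_sub_add_delta (him : ∀ l, (P.chi l).im ≠ 0) (h1 : ∀ l, P.chi1 l ≠ 0) (A : ℝ)
    (p : ℝ × ℝ) (l : Fin 2) (z : ℂ) : P.xPlus A p l 1 - A * z + P.delta l =
      I * P.chi1 l * phase (P.chi l) (p - P.centre A l z) := by
  have := h1 l
  rw [phase_sub, phase_centre him, xPlus_one_eq_phase]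
  field_simp
  ring

/-- Root points are homogeneous in A, so a coincidence at A = 1 would persist for all A and
contradict the separation hypothesis. -/
theorem Admissible.rootPoint_ne (hP : P.Admissible) {l o : Fin 2} (hlo : l ≠ o) {z z' : ℂ}
    (hz : adlerMoser (P.N l) (P.κ l) z = 0) (hz' : adlerMoser (P.N o) (P.κ o) z' = 0) :
    P.rootPoint 1 l z ≠ P.rootPoint 1 o z' := by
  intro h
  have hA : ∀ A, P.rootPoint A l z = P.rootPoint A o z' := fun A => by
    rw [rootPoint_eq_smul hP.chi_im_ne_zero, h, ← rootPoint_eq_smul hP.chi_im_ne_zero]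
  obtain ⟨c, hc, hsep⟩ := hP.separated
  obtain ⟨A, hA'⟩ := hsep.exists
  have key : ∀ {y y' : ℂ}, y ∈ P.roots 0 → y' ∈ P.roots 1 →
      P.rootPoint A 0 y ≠ P.rootPoint A 1 y' := by
    intro y y' hy hy' heq
    have := hA' y hy y' hy'
    rw [heq, planeDist_self] at this
    linarith
  fin_cases l <;> fin_cases o
  · exact hlo rfl
  · exact key hz hz' (hA A)
  · exact key hz' hz (hA A).symm
  · exact hlo rfl

theorem Admissible.rootPoint_injective (hP : P.Admissible) :
    Function.Injective fun i : Σ l : Fin 2, P.roots l => P.rootPoint 1 i.1 i.2 := by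
  rintro ⟨l, z, hz⟩ ⟨o, z', hz'⟩ h
  by_cases hlo : l = o
  · subst hlo
    have h2 := congrArg (phase (P.chi l)) h
    have h1 := hP.chi1_ne_zero l
    simp only [phase_rootPoint hP.chi_im_ne_zero] at h2
    have : z = z' := by
      field_simp at h2
      simpa using h2
    subst this; rfl
  · exact absurd h (hP.rootPoint_ne hlo hz hz')

theorem tendsto_planeDist_smul_add {p r : ℝ × ℝ} (h : p ≠ r) (e e' : ℝ × ℝ) :
    Tendsto (fun A : ℝ => planeDist (A • p + e) (A • r + e')) atTop atTop := by
  have key : ∀ a b : ℝ, a ≠ 0 → Tendsto (fun A : ℝ => |A * a + b|) atTop atTop := by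
    intro a b ha
    have h1 : Tendsto (fun A : ℝ => A * |a| - |b|) atTop atTop :=
      tendsto_atTop_add_const_right _ _ (tendsto_id.atTop_mul_const (abs_pos.mpr ha))
    refine tendsto_atTop_mono' _ ?_ h1
    filter_upwards [eventually_ge_atTop 0] with A hA
    have h2 := abs_sub_abs_le_abs_sub (A * a) (-b)
    rw [abs_mul, abs_of_nonneg hA, abs_neg, sub_neg_eq_add] at h2
    exact h2
  by_cases h1 : p.1 = r.1
  · have h2 : p.2 - r.2 ≠ 0 := sub_ne_zero.mpr fun h2 => h (Prod.ext h1 h2)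
    refine tendsto_atTop_mono (fun A => ?_) (key _ (e.2 - e'.2) h2)
    refine le_trans (le_of_eq ?_) (abs_snd_le_planeDist _ _)
    congr 1; simp; ring
  · refine tendsto_atTop_mono (fun A => ?_) (key _ (e.1 - e'.1) (sub_ne_zero.mpr h1))
    refine le_trans (le_of_eq ?_) (abs_fst_le_planeDist _ _)
    congr 1; simp; ring

theorem Admissible.apart (hP : P.Admissible) (i j : Σ l : Fin 2, P.roots l) (hij : i ≠ j) :
    Tendsto (fun A => planeDist (P.centre A i.1 i.2) (P.centre A j.1 j.2)) atTop atTop := by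
  simp only [centre_eq_smul hP.chi_im_ne_zero]
  exact tendsto_planeDist_smul_add (fun h => hij (hP.rootPoint_injective h)) _ _

theorem Admissible.simple (hP : P.Admissible) (l : Fin 2) (z : ℂ)
    (hz : adlerMoser (P.N l) (P.κ l) z = 0) : deriv (adlerMoser (P.N l) (P.κ l)) z ≠ 0 :=
  hP.simple_roots l z hz

theorem Admissible.pMinor_ne_zero (hP : P.Admissible) : P.pMinor (fun s => s.2) ≠ 0 :=
  (det_gram_modCols hP.ne_conj hP.chi1_ne_zero zero_ne_one hP.chi_ne.symm).1

/-- Uniformity by contradiction: counterexamples with A ≥ k and distance at least k from all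
centres, for every k, form a sequence along which all root distances diverge, and `tendsto_tau_div`
applies to it. -/
theorem Admissible.away (hP : P.Admissible) (n : Fin 2) {η : ℝ} (hη : 0 < η) :
    ∃ R A₀ : ℝ, ∀ A ≥ A₀, ∀ p, (∀ i : Σ l : Fin 2, P.roots l,
      R ≤ planeDist p (P.centre A i.1 i.2)) → ‖P.solution n A p - planeWave P.b n p‖ ≤ η := by
  by_contra! hcon
  choose A hA p hp hbad using fun k : ℕ => hcon k k
  set q : ℕ → ℝ × ℝ × ℝ := fun k => (A k, p k) with hq
  have hF : Tendsto Prod.fst (map q atTop) atTop :=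
    tendsto_map'_iff.mpr (tendsto_atTop_mono hA tendsto_natCast_atTop_atTop)
  have hfar : ∀ l, ∀ z ∈ rootSet (P.N l) (P.κ l),
      Tendsto (fun q : ℝ × ℝ × ℝ => ‖P.xPlus q.1 q.2 l 1 - q.1 * z‖) (map q atTop) atTop := by
    intro l z hz
    rw [tendsto_map'_iff]
    rw [mem_rootSet] at hz
    have him := hP.chi_im_ne_zero l
    set K := 1 + (1 + ‖P.chi l‖) / |(P.chi l).im| with hK
    have hK0 : 0 < K := by have := abs_pos.mpr him; positivity
    have ha0 : 0 < ‖P.chi1 l‖ := norm_pos_iff.mpr (hP.chi1_ne_zero l)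
    have h1 : Tendsto (fun k : ℕ => ‖P.chi1 l‖ * ((k : ℝ) / K) - ‖P.delta l‖) atTop atTop :=
      tendsto_atTop_add_const_right _ _
        ((tendsto_natCast_atTop_atTop.atTop_div_const hK0).const_mul_atTop ha0)
    refine tendsto_atTop_mono (fun k => ?_) h1
    have h2 : (k : ℝ) / K ≤ ‖phase (P.chi l) (p k - P.centre (A k) l z)‖ := by
      rw [div_le_iff₀' hK0, phase_sub]
      exact (hp k ⟨l, z, hz⟩).trans (planeDist_le_norm_phase him _ _)
    have h3 := xPlus_sub_add_delta hP.chi_im_ne_zero hP.chi1_ne_zero (A k) (p k) l z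
    have h4 := norm_add_le (P.xPlus (A k) (p k) l 1 - A k * z) (P.delta l)
    rw [h3, norm_mul, norm_mul, Complex.norm_I, one_mul] at h4
    have h5 := mul_le_mul_of_nonneg_left h2 ha0.le
    change _ ≤ ‖P.xPlus (A k) (p k) l 1 - A k * z‖
    linarith
  have key := tendsto_tau_div hF hP.chi1_ne_zero hP.chi_im_ne_zero hP.pMinor_ne_zero hP.simple hfar n
  rw [tendsto_map'_iff] at key
  have h6 := (tendsto_iff_norm_sub_tendsto_zero.mp key).eventually (gt_mem_nhds hη)
  obtain ⟨k, hk⟩ := h6.exists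
  refine absurd hk (not_lt.mpr (le_of_lt ?_))
  refine (hbad k).trans_eq ?_
  rw [solution, ← mul_sub_one, norm_mul, norm_planeWave, one_mul]
  rfl

theorem Admissible.near (hP : P.Admissible) (n : Fin 2) (i : Σ l : Fin 2, P.roots l) (R : ℝ) :
    ∃ K A₀ : ℝ, 0 < A₀ ∧ ∀ A ≥ A₀, ∀ p, planeDist p (P.centre A i.1 i.2) ≤ R →
      ‖P.solution n A p - firstOrder P.b (P.chi i.1) n (p - P.centre A i.1 i.2) *
        planeWave P.b n p‖ ≤ K * A⁻¹ := by
  obtain ⟨l, z, hz⟩ := i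
  change adlerMoser (P.N l) (P.κ l) z = 0 at hz
  simp only
  have him := hP.chi_im_ne_zero
  have h1 := hP.chi1_ne_zero
  obtain ⟨o, hlo⟩ : ∃ o : Fin 2, l ≠ o := ⟨l + 1, by fin_cases l <;> decide⟩
  have hne : P.chi l ≠ P.chi o := by
    fin_cases l <;> fin_cases o
    · exact absurd rfl hlo
    · exact hP.chi_ne.symm
    · exact hP.chi_ne
    · exact absurd rfl hlo
  -- Θ_0 = 1 has no roots.
  have hN : 0 < P.N l := by
    rcases Nat.eq_zero_or_pos (P.N l) with h | h
    · rw [h] at hz; simp [adlerMoser] at hz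
    · exact h
  -- A bound along this filter is uniform over all p within distance R of the moving centre, for all
  -- large A.
  set F : Filter (ℝ × ℝ × ℝ) := comap Prod.fst atTop ⊓
    𝓟 {q | planeDist q.2 (P.centre q.1 l z) ≤ R} with hFdef
  have hF : Tendsto Prod.fst F atTop := tendsto_comap.mono_left inf_le_left
  have hmem : ∀ᶠ q in F, planeDist q.2 (P.centre q.1 l z) ≤ R := by
    rw [hFdef]; exact mem_inf_of_right (mem_principal_self _)
  have hphase : ∀ χ : ℂ, (fun q : ℝ × ℝ × ℝ => phase χ (q.2 - P.centre q.1 l z)) =O[F]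
      fun _ => (1 : ℝ) := by
    intro χ
    refine IsBigO.of_bound ((1 + ‖χ‖) * R) ?_
    filter_upwards [hmem] with q hq
    rw [phase_sub, norm_one, mul_one]
    exact (norm_phase_sub_le χ _ _).trans (by gcongr)
  have hc : ∀ c : ℂ, (fun _ : ℝ × ℝ × ℝ => c) =O[F] fun _ => (1 : ℝ) := fun c =>
    isBigO_const_const _ one_ne_zero _
  have hX : (fun q : ℝ × ℝ × ℝ => P.xPlus q.1 q.2 l 1 - q.1 * z) =O[F] fun _ => (1 : ℝ) := by
    refine (((hphase (P.chi l)).const_mul_left (I * P.chi1 l)).sub (hc (P.delta l))).congr_left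
      fun q => ?_
    rw [← xPlus_sub_add_delta him h1]; ring
  have hΛ : size =O[F] fun q => q.1 := by
    obtain ⟨K, hK, hsize⟩ := size_le_mul (h1 l) (him l) 0
    have h2 : size =O[F] fun q => q.1 + ‖P.xPlus q.1 q.2 l 1‖ := by
      refine IsBigO.of_bound K ?_
      filter_upwards [hF.eventually_ge_atTop 1] with q hq
      have := hsize q hq
      rw [add_zero] at this
      rwa [Real.norm_of_nonneg (size_pos q).le, Real.norm_of_nonneg (by positivity)]
    refine h2.trans ((isBigO_refl _ _).add ?_)
    have h3 : (fun _ : ℝ × ℝ × ℝ => (1 : ℝ)) =O[F] fun q => q.1 := by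
      refine IsBigO.of_bound 1 ?_
      filter_upwards [hF.eventually_ge_atTop 1] with q hq
      rw [norm_one, one_mul, Real.norm_of_nonneg (by linarith)]; exact hq
    have h4 : (fun q : ℝ × ℝ × ℝ => (q.1 : ℂ) * z) =O[F] fun q => q.1 := by
      have : (fun q : ℝ × ℝ × ℝ => (q.1 : ℂ)) =O[F] fun q => q.1 :=
        isBigO_of_le _ fun q => by simp
      simpa [mul_comm] using this.const_mul_left z
    exact (((hX.trans h3).add h4).congr_left fun q => by ring).norm_left
  set r := P.rootPoint 1 l z with hr
  set e := planePoint (P.chi l) (-P.delta l / (I * P.chi1 l)) with he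
  -- Limit of the scaled argument of the other block. If it were a root, the root points of the two
  -- blocks would coincide.
  set z₁ := I * P.chi1 o * phase (P.chi o) r + P.κ o 1 with hz₁def
  have hz₁ : adlerMoser (P.N o) (P.κ o) z₁ ≠ 0 := by
    intro h
    refine hP.rootPoint_ne hlo hz h (phase_injective (him o) ?_)
    have := h1 o
    rw [phase_rootPoint him, hz₁def, ← hr]
    push_cast
    field_simp
    ring
  have hXo : (fun q : ℝ × ℝ × ℝ => P.xPlus q.1 q.2 o 1 - q.1 * z₁) =O[F] fun _ => (1 : ℝ) := by
    refine (((hphase (P.chi o)).add (hc (phase (P.chi o) e))).const_mul_left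
      (I * P.chi1 o)).congr_left fun q => ?_
    rw [phase_sub, centre_eq_smul him, phase_smul_add, xPlus_one_eq_phase, hz₁def]
    ring
  have key := isBigO_tau_div_sub_fundamental hF hΛ hP.ne_conj h1 hlo hne hN hz (hP.simple l z hz) hX
    hz₁ (fun w => tendsto_scaledArg hF hXo w) n
  simp only [xPlus_sub_add_delta him h1, hP.h3_one, fundamental_eq_firstOrder (him l) (h1 l)] at key
  obtain ⟨K, hK⟩ := key.bound
  rw [hFdef, eventually_inf_principal, eventually_comap, eventually_atTop] at hK
  obtain ⟨A₀, hA₀⟩ := hK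
  refine ⟨|K|, max A₀ 1, by positivity, fun A hA p hp => ?_⟩
  have hA1 : 1 ≤ A := (le_max_right _ _).trans hA
  have h2 := hA₀ A ((le_max_left _ _).trans hA) (A, p) rfl hp
  rw [Real.norm_of_nonneg (inv_nonneg.mpr (size_pos _).le)] at h2
  rw [solution, mul_comm (planeWave _ _ _), ← sub_mul, norm_mul, norm_planeWave, mul_one]
  refine h2.trans ?_
  have h3 : A ≤ size (A, p) := by
    unfold size
    have := le_abs_self A; have := abs_nonneg p.1; have := abs_nonneg p.2
    simp only; linarith
  have h4 : (size (A, p))⁻¹ ≤ A⁻¹ := inv_anti₀ (by linarith) h3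
  exact mul_le_mul (le_abs_self K) h4 (inv_nonneg.mpr (size_pos _).le) (abs_nonneg K)

/-- The asymptotic part of the pattern. -/
theorem Admissible.splitsInto (hP : P.Admissible) (n : Fin 2) :
    SplitsInto (ι := Σ l : Fin 2, P.roots l) (P.solution n) (planeWave P.b n)
      (fun A i => P.centre A i.1 i.2) (fun i => firstOrder P.b (P.chi i.1) n) where
  apart := hP.apart
  near := hP.near n
  away _ hη := hP.away n hη

theorem Admissible.encard_roots (hP : P.Admissible) (l : Fin 2) :
    (P.roots l).encard = (P.N l * (P.N l + 1) / 2 : ℕ) := by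
  have h : P.roots l = rootSet (P.N l) (P.κ l) := by
    ext z; rw [Finset.mem_coe, mem_rootSet]; rfl
  rw [h, Set.encard_coe_eq_coe_finsetCard, card_rootSet (hP.simple l)]

end Params

end

end CNLS

/-! ### Extrema of the first-order wave -/

namespace CNLS

open Complex Filter Topology PowerSeries Asymptotics
open scoped ComplexConjugate

noncomputable section

/-- The normal form of the deviation of the squared amplitude from the background. -/
def deviation (σ : ℝ) (y : ℝ × ℝ) : ℝ := (y.1 ^ 2 - y.2 ^ 2 + σ) / (1 + y.1 ^ 2 + y.2 ^ 2) ^ 2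

/-- This antisymmetry reduces every statement about minima to one about maxima with -σ. -/
theorem deviation_swap (σ : ℝ) (y : ℝ × ℝ) : deviation σ y = -deviation (-σ) y.swap := by
  simp only [deviation, Prod.fst_swap, Prod.snd_swap]
  rw [← neg_div]; congr 1 <;> ring

theorem hasDerivAt_deviation_fst (σ μ ν : ℝ) : HasDerivAt (fun s => deviation σ (s, ν))
    (2 * μ * (1 + μ ^ 2 + ν ^ 2 - 2 * (μ ^ 2 - ν ^ 2 + σ)) / (1 + μ ^ 2 + ν ^ 2) ^ 3) μ := by
  have h1 : HasDerivAt (fun s : ℝ => s ^ 2 - ν ^ 2 + σ) (2 * μ) μ := by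
    simpa using ((hasDerivAt_pow 2 μ).sub_const (ν ^ 2)).add_const σ
  have h2 : HasDerivAt (fun s : ℝ => 1 + s ^ 2 + ν ^ 2) (2 * μ) μ := by
    simpa using ((hasDerivAt_pow 2 μ).const_add 1).add_const (ν ^ 2)
  have hpos : 1 + μ ^ 2 + ν ^ 2 ≠ 0 := by positivity
  refine (h1.div (h2.pow 2) (pow_ne_zero 2 hpos)).congr_deriv ?_
  simp only [Pi.pow_apply]
  field_simp
  ring

theorem hasDerivAt_deviation_snd (σ μ ν : ℝ) : HasDerivAt (fun s => deviation σ (μ, s))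
    (-(2 * ν * (1 + μ ^ 2 + ν ^ 2 + 2 * (μ ^ 2 - ν ^ 2 + σ)) / (1 + μ ^ 2 + ν ^ 2) ^ 3)) ν := by
  have h : (fun s => deviation σ (μ, s)) = fun s => -deviation (-σ) (s, μ) :=
    funext fun s => deviation_swap σ (μ, s)
  rw [h]
  refine (hasDerivAt_deviation_fst (-σ) ν μ).neg.congr_deriv ?_
  congr 2 <;> ring

theorem isLocalMax_fst {f : ℝ × ℝ → ℝ} {y : ℝ × ℝ} (h : IsLocalMax f y) :
    IsLocalMax (fun s => f (s, y.2)) y.1 := by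
  have : Tendsto (fun s : ℝ => (s, y.2)) (𝓝 y.1) (𝓝 y) :=
    (by fun_prop : Continuous fun s : ℝ => (s, y.2)).tendsto y.1
  exact this.eventually h

theorem isLocalMax_snd {f : ℝ × ℝ → ℝ} {y : ℝ × ℝ} (h : IsLocalMax f y) :
    IsLocalMax (fun s => f (y.1, s)) y.2 := by
  have : Tendsto (fun s : ℝ => (y.1, s)) (𝓝 y.2) (𝓝 y) :=
    (by fun_prop : Continuous fun s : ℝ => (y.1, s)).tendsto y.2
  exact this.eventually h

/-- Second-order condition at a maximum on the axis `y.1 = 0`. -/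
theorem le_of_isLocalMax_deviation {σ ν : ℝ} (h : IsLocalMax (deviation σ) (0, ν)) :
    1 + ν ^ 2 ≤ 2 * (σ - ν ^ 2) := by
  -- Comparison with the point (s, ν), divided by s²; then s tends to 0.
  have h1 : ∀ᶠ s : ℝ in 𝓝[≠] 0, (1 + ν ^ 2) ^ 2 - 2 * (σ - ν ^ 2) * (1 + ν ^ 2) -
      (σ - ν ^ 2) * s ^ 2 ≤ 0 := by
    filter_upwards [(isLocalMax_fst h).filter_mono nhdsWithin_le_nhds, self_mem_nhdsWithin]
      with s hs hs0
    have hs2 : 0 < s ^ 2 := by have : s ≠ 0 := hs0; positivity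
    simp only [deviation] at hs
    rw [div_le_div_iff₀ (by positivity) (by positivity)] at hs
    refine nonpos_of_mul_nonpos_right (a := s ^ 2) ?_ hs2
    nlinarith
  have h2 : Tendsto (fun s : ℝ => (1 + ν ^ 2) ^ 2 - 2 * (σ - ν ^ 2) * (1 + ν ^ 2) -
      (σ - ν ^ 2) * s ^ 2) (𝓝[≠] 0) (𝓝 ((1 + ν ^ 2) ^ 2 - 2 * (σ - ν ^ 2) * (1 + ν ^ 2) -
      (σ - ν ^ 2) * 0 ^ 2)) :=
    ((by fun_prop : Continuous fun s : ℝ => (1 + ν ^ 2) ^ 2 - 2 * (σ - ν ^ 2) * (1 + ν ^ 2) -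
      (σ - ν ^ 2) * s ^ 2).tendsto 0).mono_left nhdsWithin_le_nhds
  have h3 := le_of_tendsto h2 h1
  have h4 : 0 < 1 + ν ^ 2 := by positivity
  have h5 : (1 + ν ^ 2) * (1 + ν ^ 2 - 2 * (σ - ν ^ 2)) ≤ 0 := by linarith
  have := nonpos_of_mul_nonpos_right h5 h4
  linarith

/-- The bound is the value at the origin, so the candidate is a global maximum. -/
theorem deviation_le_of_half_le {σ : ℝ} (h : 1 / 2 ≤ σ) (y : ℝ × ℝ) : deviation σ y ≤ σ := by
  rw [deviation, div_le_iff₀ (by positivity)]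
  have h1 := sq_nonneg y.1
  have h2 := sq_nonneg y.2
  nlinarith [mul_nonneg (by linarith : 0 ≤ σ) (sq_nonneg (y.1 ^ 2 + y.2 ^ 2)),
    mul_nonneg (by linarith : 0 ≤ 2 * σ - 1) (add_nonneg h1 h2)]

/-- The bound is the value at y₂ = 0, y₁² = 1 - 2σ. -/
theorem deviation_le_of_lt_half {σ : ℝ} (h : σ < 1 / 2) (y : ℝ × ℝ) :
    deviation σ y ≤ 1 / (4 * (1 - σ)) := by
  rw [deviation, div_le_div_iff₀ (by positivity) (by linarith)]
  have h1 := sq_nonneg y.1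
  have h2 := sq_nonneg y.2
  nlinarith [sq_nonneg (y.1 ^ 2 + 1 - 2 * (1 - σ)), mul_nonneg h1 h2, sq_nonneg (y.2 ^ 2),
    mul_nonneg (by linarith : 0 ≤ 1 - σ) h2]

/-- The local maxima of the deviation. -/
theorem isLocalMax_deviation_iff (σ : ℝ) (y : ℝ × ℝ) : IsLocalMax (deviation σ) y ↔
    y.2 = 0 ∧ if 1 / 2 ≤ σ then y.1 = 0 else y.1 ^ 2 = 1 - 2 * σ := by
  obtain ⟨μ, ν⟩ := y
  constructor
  · intro h
    have hD : 0 < 1 + μ ^ 2 + ν ^ 2 := by positivity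
    have e1 := (isLocalMax_fst h).hasDerivAt_eq_zero (hasDerivAt_deviation_fst σ μ ν)
    have e2 := (isLocalMax_snd h).hasDerivAt_eq_zero (hasDerivAt_deviation_snd σ μ ν)
    rw [div_eq_zero_iff, or_iff_left (pow_ne_zero 3 hD.ne')] at e1
    rw [neg_eq_zero, div_eq_zero_iff, or_iff_left (pow_ne_zero 3 hD.ne')] at e2
    have e3 : μ = 0 → 1 + ν ^ 2 ≤ 2 * (σ - ν ^ 2) := fun h0 => by
      subst h0; exact le_of_isLocalMax_deviation h
    have hν : ν = 0 := by
      by_contra hν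
      have e4 : 1 + μ ^ 2 + ν ^ 2 + 2 * (μ ^ 2 - ν ^ 2 + σ) = 0 := by
        simpa [hν] using e2
      by_cases hμ : μ = 0
      · have := e3 hμ
        subst hμ
        nlinarith [sq_nonneg ν]
      -- Adding e4 and e5 gives 2 (1 + μ² + ν²) = 0.
      · have e5 : 1 + μ ^ 2 + ν ^ 2 - 2 * (μ ^ 2 - ν ^ 2 + σ) = 0 := by
          simpa [hμ] using e1
        linarith
    refine ⟨hν, ?_⟩
    subst hν
    by_cases hμ : μ = 0
    · have := e3 hμ
      rw [if_pos (by linarith)]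
      exact hμ
    · have e5 : 1 + μ ^ 2 + (0 : ℝ) ^ 2 - 2 * (μ ^ 2 - 0 ^ 2 + σ) = 0 := by
        simpa [hμ] using e1
      have : 0 < μ ^ 2 := by positivity
      rw [if_neg (by linarith)]
      linarith
  · rintro ⟨h1, h2⟩
    simp only at h1 h2
    subst h1
    refine Eventually.of_forall fun x => ?_
    split_ifs at h2 with h
    · subst h2
      exact (deviation_le_of_half_le h x).trans_eq (by simp [deviation])
    · push Not at h
      refine (deviation_le_of_lt_half h x).trans_eq ?_
      have : 1 - σ ≠ 0 := by linarith
      rw [deviation, h2, show 1 + (1 - 2 * σ) + (0 : ℝ) ^ 2 = 2 * (1 - σ) by ring]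
      field_simp
      ring

theorem deviation_pos_of_isLocalMax {σ : ℝ} {y : ℝ × ℝ} (h : IsLocalMax (deviation σ) y) :
    0 < deviation σ y := by
  rw [isLocalMax_deviation_iff] at h
  obtain ⟨h1, h2⟩ := h
  refine div_pos ?_ (by positivity)
  rw [h1]
  split_ifs at h2 with hσ
  · rw [h2]; linarith
  · rw [h2]; linarith

theorem encard_isLocalMax_deviation (σ : ℝ) :
    {y | IsLocalMax (deviation σ) y}.encard = if 1 / 2 ≤ σ then 1 else 2 := by
  split_ifs with h
  · have : {y | IsLocalMax (deviation σ) y} = {(0, 0)} := by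
      ext y
      rw [Set.mem_ofPred_eq, isLocalMax_deviation_iff, if_pos h, Set.mem_singleton_iff, Prod.ext_iff,
        and_comm]
    rw [this, Set.encard_singleton]
  · have h0 : 0 < 1 - 2 * σ := by linarith
    have hs := Real.sqrt_pos.mpr h0
    have : {y | IsLocalMax (deviation σ) y} =
        {(Real.sqrt (1 - 2 * σ), 0), (-Real.sqrt (1 - 2 * σ), 0)} := by
      ext y
      rw [Set.mem_ofPred_eq, isLocalMax_deviation_iff, if_neg h, Set.mem_insert_iff,
        Set.mem_singleton_iff, Prod.ext_iff, Prod.ext_iff, ← or_and_right, and_comm,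
        ← Real.sq_sqrt h0.le, sq_eq_sq_iff_eq_or_eq_neg, Real.sq_sqrt h0.le]
    rw [this, Set.encard_pair]
    intro heq
    have := congrArg Prod.fst heq
    simp only at this
    linarith

theorem isLocalMin_deviation_iff (σ : ℝ) (y : ℝ × ℝ) :
    IsLocalMin (deviation σ) y ↔ IsLocalMax (deviation (-σ)) y.swap := by
  have h : 𝓝 y.swap = map Prod.swap (𝓝 y) := ((Homeomorph.prodComm ℝ ℝ).map_nhds_eq y).symm
  rw [IsLocalMin, IsLocalMax, IsMinFilter, IsMaxFilter, h, eventually_map]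
  simp only [deviation_swap σ, neg_le_neg_iff]

theorem encard_isLocalMin_deviation (σ : ℝ) :
    {y | IsLocalMin (deviation σ) y}.encard = if 1 / 2 ≤ -σ then 1 else 2 := by
  rw [← encard_isLocalMax_deviation]
  simp only [isLocalMin_deviation_iff]
  rw [show {y : ℝ × ℝ | IsLocalMax (deviation (-σ)) y.swap} =
    Prod.swap ⁻¹' {y | IsLocalMax (deviation (-σ)) y} from rfl,
    Set.encard_preimage_of_bijective Prod.swap_bijective]

theorem deviation_neg_of_isLocalMin {σ : ℝ} {y : ℝ × ℝ} (h : IsLocalMin (deviation σ) y) :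
    deviation σ y < 0 := by
  rw [deviation_swap, neg_lt_zero]
  exact deviation_pos_of_isLocalMax ((isLocalMin_deviation_iff σ y).mp h)

theorem tendsto_deviation_cocompact (σ : ℝ) :
    Tendsto (deviation σ) (cocompact (ℝ × ℝ)) (𝓝 0) := by
  have h1 : ∀ y : ℝ × ℝ, ‖deviation σ y‖ ≤ (1 + |σ|) / (1 + ‖y‖ ^ 2) := by
    intro y
    have hy : ‖y‖ ^ 2 ≤ y.1 ^ 2 + y.2 ^ 2 := by
      rw [Prod.norm_def, Real.norm_eq_abs, Real.norm_eq_abs]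
      rcases max_cases |y.1| |y.2| with ⟨h, _⟩ | ⟨h, _⟩ <;> rw [h, sq_abs] <;>
        nlinarith [sq_nonneg y.1, sq_nonneg y.2]
    have hD : 0 < 1 + y.1 ^ 2 + y.2 ^ 2 := by positivity
    calc ‖deviation σ y‖ = |y.1 ^ 2 - y.2 ^ 2 + σ| / (1 + y.1 ^ 2 + y.2 ^ 2) ^ 2 := by
          rw [deviation, norm_div, Real.norm_eq_abs, Real.norm_of_nonneg (by positivity)]
      _ ≤ ((1 + |σ|) * (1 + y.1 ^ 2 + y.2 ^ 2)) / (1 + y.1 ^ 2 + y.2 ^ 2) ^ 2 := by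
          gcongr
          have := abs_nonneg σ
          rw [abs_le]
          constructor <;>
            nlinarith [neg_abs_le σ, le_abs_self σ, sq_nonneg y.1, sq_nonneg y.2,
              mul_nonneg this (sq_nonneg y.1), mul_nonneg this (sq_nonneg y.2)]
      _ = (1 + |σ|) / (1 + y.1 ^ 2 + y.2 ^ 2) := by field_simp
      _ ≤ (1 + |σ|) / (1 + ‖y‖ ^ 2) :=
          div_le_div_of_nonneg_left (by positivity) (by positivity) (by linarith)
  refine squeeze_zero_norm h1 (Tendsto.const_div_atTop ?_ _)
  exact tendsto_atTop_add_const_left _ _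
    ((tendsto_pow_atTop two_ne_zero).comp tendsto_norm_cocompact_atTop)

/-- The linear coordinates in which the amplitude takes its normal form. -/
def normalCoords (a c α r : ℝ) (hc : c ≠ 0) (hr : r ≠ 0) (h : r ^ 2 = a ^ 2 + c ^ 2) :
    (ℝ × ℝ) ≃ₜ (ℝ × ℝ) where
  toFun p := (2 * c * (a * (p.1 + α * p.2) - c * (c * p.2)) / r,
    2 * c * (c * (p.1 + α * p.2) + a * (c * p.2)) / r)
  invFun y := ((a * y.1 + c * y.2) / (2 * c * r) - α * ((a * y.2 - c * y.1) / (2 * c ^ 2 * r)),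
    (a * y.2 - c * y.1) / (2 * c ^ 2 * r))
  left_inv p := by
    have h2 : (a * (2 * c * (c * (p.1 + α * p.2) + a * (c * p.2)) / r) -
        c * (2 * c * (a * (p.1 + α * p.2) - c * (c * p.2)) / r)) / (2 * c ^ 2 * r) = p.2 := by
      field_simp
      linear_combination (-p.2) * h
    refine Prod.ext ?_ h2
    simp only
    rw [h2]
    field_simp
    linear_combination (-(p.1 + α * p.2)) * h
  right_inv y := by
    refine Prod.ext ?_ ?_
    · simp only
      field_simp
      linear_combination (-c * y.1) * h
    · simp only
      field_simp
      linear_combination (-y.2) * h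
  continuous_toFun := by fun_prop
  continuous_invFun := by fun_prop

/-- The normal form of the amplitude of a first-order rogue wave. -/
theorem exists_normal_form (b : ℝ) {χ : ℂ} (n : Fin 2) (him : χ.im ≠ 0) :
    ∃ (T : (ℝ × ℝ) ≃ₜ (ℝ × ℝ)) (k σ : ℝ), 0 < k ∧ (1 / 2 ≤ σ ↔ shapeRatio b χ n ≤ 1 / 3) ∧
      (1 / 2 ≤ -σ ↔ 3 ≤ shapeRatio b χ n) ∧
      ∀ p, ‖firstOrder b χ n p‖ ^ 2 = 1 + k * deviation σ (T p) := by
  set a := χ.re + waveNumber b n with ha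
  set c := χ.im with hc
  have hc2 : 0 < c ^ 2 := by positivity
  have hr2 : 0 < a ^ 2 + c ^ 2 := by positivity
  set r := Real.sqrt (a ^ 2 + c ^ 2) with hr
  have hr0 : 0 < r := Real.sqrt_pos.mpr hr2
  have hrsq : r ^ 2 = a ^ 2 + c ^ 2 := Real.sq_sqrt hr2.le
  -- The coordinates are 2c times x + χ t rotated by the argument of χ + b_n. Moreover σ = (1 - ρ) /
  -- (1 + ρ), so the thresholds ±1/2 of σ are the thresholds 1/3 and 3 of ρ.
  refine ⟨normalCoords a c χ.re r him hr0.ne' hrsq, 8 * c ^ 2 / (a ^ 2 + c ^ 2),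
    (c ^ 2 - a ^ 2) / (a ^ 2 + c ^ 2), by positivity, ?_, ?_, fun p => ?_⟩
  · rw [shapeRatio, ← ha, ← hc, div_le_div_iff₀ two_pos hr2, div_le_div_iff₀ hc2 three_pos]
    constructor <;> intro h <;> linarith
  · rw [shapeRatio, ← ha, ← hc, ← neg_div, div_le_div_iff₀ two_pos hr2, le_div_iff₀ hc2]
    constructor <;> intro h <;> linarith
  · set u := p.1 + χ.re * p.2 with hu
    set w := c * p.2 with hw
    have hden : 0 < u ^ 2 + c ^ 2 * p.2 ^ 2 + 1 / (4 * c ^ 2) := by positivity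
    set d := u ^ 2 + c ^ 2 * p.2 ^ 2 + 1 / (4 * c ^ 2) with hd
    have hnorm : ‖χ + waveNumber b n‖ ^ 2 = a ^ 2 + c ^ 2 := by
      rw [← Complex.normSq_eq_norm_sq, Complex.normSq_apply]
      simp [ha, hc]; ring
    have hval : firstOrder b χ n p = ((1 - 1 / ((a ^ 2 + c ^ 2) * d) : ℝ) : ℂ) +
        ((2 * (a * u - c * w) / ((a ^ 2 + c ^ 2) * d) : ℝ) : ℂ) * I := by
      have hdC : (d : ℂ) ≠ 0 := by exact_mod_cast hden.ne'
      have hrC : (a : ℂ) ^ 2 + (c : ℂ) ^ 2 ≠ 0 := by exact_mod_cast hr2.ne'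
      rw [firstOrder, hnorm, ← ha, ← hc, ← hu, ← hd,
        show c ^ 2 * p.2 = c * w by rw [hw]; ring]
      push_cast
      field_simp
      ring_nf
      simp only [Complex.I_sq]
      ring
    have hdd : d = (u ^ 2 + w ^ 2) + 1 / (4 * c ^ 2) := by rw [hd, hw]; ring
    have hcoords : normalCoords a c χ.re r him hr0.ne' hrsq p =
        (2 * c * (a * u - c * w) / r, 2 * c * (c * u + a * w) / r) := rfl
    rw [hval, ← Complex.normSq_eq_norm_sq, Complex.normSq_add_mul_I, hcoords, deviation]
    have e1 : (2 * c * (a * u - c * w) / r) ^ 2 = 4 * c ^ 2 * (a * u - c * w) ^ 2 / (a ^ 2 + c ^ 2) := by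
      rw [div_pow, hrsq]; ring
    have e2 : (2 * c * (c * u + a * w) / r) ^ 2 = 4 * c ^ 2 * (c * u + a * w) ^ 2 / (a ^ 2 + c ^ 2) := by
      rw [div_pow, hrsq]; ring
    have e3 : 1 + 4 * c ^ 2 * (a * u - c * w) ^ 2 / (a ^ 2 + c ^ 2) +
        4 * c ^ 2 * (c * u + a * w) ^ 2 / (a ^ 2 + c ^ 2) = 4 * c ^ 2 * d := by
      rw [hdd]; field_simp; ring
    have e4 : 4 * c ^ 2 * (a * u - c * w) ^ 2 / (a ^ 2 + c ^ 2) -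
        4 * c ^ 2 * (c * u + a * w) ^ 2 / (a ^ 2 + c ^ 2) + (c ^ 2 - a ^ 2) / (a ^ 2 + c ^ 2) =
        (8 * c ^ 2 * (a * u - c * w) ^ 2 + 2 * c ^ 2) / (a ^ 2 + c ^ 2) - 4 * c ^ 2 * d := by
      rw [hdd]; field_simp; ring
    simp only [e1, e2]
    rw [e3, e4]
    field_simp
    ring

/-- The shape of a first-order rogue wave. -/
theorem hasShape_firstOrder (b : ℝ) {χ : ℂ} (n : Fin 2) (him : χ.im ≠ 0) {m k : ℕ}
    (hm : m = if shapeRatio b χ n ≤ 1 / 3 then 1 else 2)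
    (hk : k = if 3 ≤ shapeRatio b χ n then 1 else 2) : HasShape (firstOrder b χ n) m k := by
  obtain ⟨T, K, σ, hK, h1, h2, hT⟩ := exists_normal_form b n him
  have hle : ∀ p r, ‖firstOrder b χ n p‖ ≤ ‖firstOrder b χ n r‖ ↔
      deviation σ (T p) ≤ deviation σ (T r) := fun p r => by
    rw [← sq_le_sq₀ (norm_nonneg _) (norm_nonneg _), hT, hT, add_le_add_iff_left,
      mul_le_mul_iff_right₀ hK]
  have hmax : ∀ p, IsLocalMax (fun r => ‖firstOrder b χ n r‖) p ↔
      IsLocalMax (deviation σ) (T p) := fun p => by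
    rw [IsLocalMax, IsLocalMax, IsMaxFilter, IsMaxFilter, ← T.map_nhds_eq, eventually_map]
    simp only [hle]
  have hmin : ∀ p, IsLocalMin (fun r => ‖firstOrder b χ n r‖) p ↔
      IsLocalMin (deviation σ) (T p) := fun p => by
    rw [IsLocalMin, IsLocalMin, IsMinFilter, IsMinFilter, ← T.map_nhds_eq, eventually_map]
    simp only [hle]
  refine ⟨?_, ?_, fun p hp => ?_, ?_, fun p hp => ?_⟩
  · have h3 : Tendsto (fun p => deviation σ (T p)) (cocompact (ℝ × ℝ)) (𝓝 0) :=
      (tendsto_deviation_cocompact σ).comp T.isClosedEmbedding.tendsto_cocompact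
    have h4 := ((h3.const_mul K).const_add 1).sqrt
    simp only [← hT, Real.sqrt_sq (norm_nonneg _), mul_zero, add_zero, Real.sqrt_one] at h4
    exact h4
  · simp only [hmax]
    rw [show {p | IsLocalMax (deviation σ) (T p)} = T ⁻¹' {y | IsLocalMax (deviation σ) y} from rfl,
      Set.encard_preimage_of_bijective T.bijective, encard_isLocalMax_deviation, hm]
    simp only [h1]
    split_ifs <;> rfl
  · have h3 := mul_pos hK (deviation_pos_of_isLocalMax ((hmax p).mp hp))
    rw [← one_lt_sq_iff₀ (norm_nonneg _), hT]
    linarith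
  · simp only [hmin]
    rw [show {p | IsLocalMin (deviation σ) (T p)} = T ⁻¹' {y | IsLocalMin (deviation σ) y} from rfl,
      Set.encard_preimage_of_bijective T.bijective, encard_isLocalMin_deviation, hk]
    simp only [h2]
    split_ifs <;> rfl
  · have h3 := mul_neg_of_pos_of_neg hK (deviation_neg_of_isLocalMin ((hmin p).mp hp))
    rw [← sq_lt_one_iff₀ (norm_nonneg _), hT]
    linarith

theorem isBright_of_shapeRatio_le {b : ℝ} {χ : ℂ} {n : Fin 2} (him : χ.im ≠ 0)
    (h : shapeRatio b χ n ≤ 1 / 3) : IsBright b χ n :=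
  ⟨h, hasShape_firstOrder b n him (if_pos h).symm (if_neg (by linarith)).symm⟩

theorem isFourPetaled_of_shapeRatio {b : ℝ} {χ : ℂ} {n : Fin 2} (him : χ.im ≠ 0)
    (h : 1 / 3 < shapeRatio b χ n) (h' : shapeRatio b χ n < 3) : IsFourPetaled b χ n :=
  ⟨h, h', hasShape_firstOrder b n him (if_neg (not_le.mpr h)).symm (if_neg (not_le.mpr h')).symm⟩

theorem isFourPetaledOrDark_of_shapeRatio {b : ℝ} {χ : ℂ} {n : Fin 2} (him : χ.im ≠ 0)
    (h : 1 / 3 < shapeRatio b χ n) : IsFourPetaledOrDark b χ n := by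
  rcases lt_or_ge (shapeRatio b χ n) 3 with h' | h'
  · exact Or.inl (isFourPetaled_of_shapeRatio him h h')
  · exact Or.inr ⟨h', hasShape_firstOrder b n him (if_neg (not_le.mpr h)).symm (if_pos h').symm⟩

end

end CNLS

/-! ### The double roots and the types of the waves -/

namespace CNLS

open Complex Filter Topology PowerSeries Asymptotics
open scoped ComplexConjugate

noncomputable section

namespace Params

variable {P : Params}

theorem waveNumber_sq (b : ℝ) (n : Fin 2) : waveNumber b n ^ 2 = b ^ 2 := by
  rw [waveNumber, mul_pow, ← pow_mul, mul_comm (n : ℕ), pow_mul]; simp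

/-- A number with negative real square is purely imaginary. -/
theorem re_eq_zero_of_sq_eq {χ : ℂ} {y : ℝ} (him : χ.im ≠ 0) (h : χ ^ 2 = y) :
    χ.re = 0 ∧ χ.im ^ 2 = -y := by
  have h1 := congrArg Complex.im h
  have h2 := congrArg Complex.re h
  simp only [pow_two, Complex.mul_im, Complex.mul_re, Complex.ofReal_im, Complex.ofReal_re] at h1 h2
  have h3 : χ.re = 0 := by
    have : χ.re * χ.im = 0 := by linarith
    exact (mul_eq_zero.mp this).resolve_right him
  refine ⟨h3, ?_⟩
  rw [h3] at h2
  linarith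

/-- With b² = (1 - ζ²) / 4 the quadratic for χ² has the roots -(1 + ζ)(3 + ζ)/4 and -(1 - ζ)(3 -
ζ)/4. Both double roots are thus purely imaginary, and ρ is (1 - ζ)/(3 + ζ) < 1/3 for the first and
(1 + ζ)/(3 - ζ), between 1/3 and 1, for the second. -/
theorem Admissible.pattern_small (hP : P.Admissible) (hb : P.b < 1 / 2) (n : Fin 2) :
    PatternConsistsOf P n IsBright IsFourPetaled := by
  set ζ := Real.sqrt (1 - 4 * P.b ^ 2) with hζ
  have hpos : 0 < 1 - 4 * P.b ^ 2 := by nlinarith [hP.b_pos]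
  have hζ0 : 0 < ζ := Real.sqrt_pos.mpr hpos
  have hζ2 : ζ ^ 2 = 1 - 4 * P.b ^ 2 := Real.sq_sqrt hpos.le
  have hζ1 : ζ < 1 := by nlinarith [hP.b_pos, mul_pos hP.b_pos hP.b_pos]
  have hy₀ := hP.label_small hb
  rw [← hζ] at hy₀
  obtain ⟨hre₀, him₀⟩ := re_eq_zero_of_sq_eq (hP.chi_im_ne_zero 0) hy₀
  have hy₁ : P.chi 1 ^ 2 = ((-((1 - ζ) * (3 - ζ)) / 4 : ℝ) : ℂ) := by
    have hb2 : (P.b : ℂ) ^ 2 = (1 - (ζ : ℂ) ^ 2) / 4 := by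
      have : P.b ^ 2 = (1 - ζ ^ 2) / 4 := by linarith
      exact_mod_cast this
    have h1 := hP.double_root_eq 1
    rw [hb2] at h1
    have h2 : (P.chi 1 ^ 2 - P.chi 0 ^ 2) *
        (P.chi 1 ^ 2 - ((-((1 - ζ) * (3 - ζ)) / 4 : ℝ) : ℂ)) = 0 := by
      rw [hy₀]
      push_cast
      linear_combination h1
    rcases mul_eq_zero.mp h2 with h3 | h3
    -- Equal squares are excluded, since -χ_1 is the conjugate of the purely imaginary χ_1.
    · rw [sub_eq_zero, sq_eq_sq_iff_eq_or_eq_neg] at h3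
      rcases h3 with h3 | h3
      · exact absurd h3 hP.chi_ne
      · refine absurd ?_ hP.chi_ne_conj
        rw [h3]
        apply Complex.ext <;> simp [hre₀]
    · exact sub_eq_zero.mp h3
  obtain ⟨hre₁, him₁⟩ := re_eq_zero_of_sq_eq (hP.chi_im_ne_zero 1) hy₁
  have h0 : 0 < (P.chi 0).im ^ 2 := by have := hP.chi_im_ne_zero 0; positivity
  have h1 : 0 < (P.chi 1).im ^ 2 := by have := hP.chi_im_ne_zero 1; positivity
  refine ⟨hP.encard_roots, hP.splitsInto n, isBright_of_shapeRatio_le (hP.chi_im_ne_zero 0) ?_,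
    isFourPetaled_of_shapeRatio (hP.chi_im_ne_zero 1) ?_ ?_⟩
  · rw [shapeRatio, hre₀, zero_add, waveNumber_sq, div_le_iff₀ h0, him₀]
    nlinarith
  · rw [shapeRatio, hre₁, zero_add, waveNumber_sq, lt_div_iff₀ h1, him₁]
    nlinarith
  · rw [shapeRatio, hre₁, zero_add, waveNumber_sq, div_lt_iff₀ h1, him₁]
    nlinarith

/-- The double-root equation reads (χ² - (b² - 1))² = 1 - 4b² < 0, so χ² - (b² - 1) is purely
imaginary. -/
theorem Admissible.re_im_eq (hP : P.Admissible) (hb : 1 / 2 < P.b) (l : Fin 2) :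
    (P.chi l).re ^ 2 - (P.chi l).im ^ 2 = P.b ^ 2 - 1 ∧
      4 * ((P.chi l).re ^ 2 * (P.chi l).im ^ 2) = 4 * P.b ^ 2 - 1 := by
  have h := hP.double_root_eq l
  have hx : P.chi l = (P.chi l).re + (P.chi l).im * I := (Complex.re_add_im _).symm
  set α := (P.chi l).re
  set c := (P.chi l).im
  set p := α ^ 2 - c ^ 2 - (P.b ^ 2 - 1) with hp
  set q := 2 * α * c with hq
  have h1 : ((p : ℂ) + q * I) ^ 2 = ((1 - 4 * P.b ^ 2 : ℝ) : ℂ) := by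
    have : (p : ℂ) + q * I = P.chi l ^ 2 - (P.b ^ 2 - 1) := by
      rw [hx, hp, hq]; push_cast; ring_nf; rw [Complex.I_sq]; ring
    rw [this]; push_cast; linear_combination h
  have h2 := congrArg Complex.re h1
  have h3 := congrArg Complex.im h1
  simp [pow_two] at h2 h3
  have h4 : q ≠ 0 := by
    intro h0
    rw [h0] at h2
    nlinarith [mul_self_nonneg p]
  have h5 : p = 0 := by
    have : p * q = 0 := by linarith
    exact (mul_eq_zero.mp this).resolve_right h4
  constructor
  · linarith
  · rw [h5] at h2
    have : q * q = 4 * (α ^ 2 * c ^ 2) := by rw [hq]; ring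
    nlinarith

/-- This is ρ ≤ 1/3 for the bright component. With c² = α² + 1 - b² it becomes 2α² + 4b² - 1 ≤ 6αb,
which is proved by comparing squares. -/
theorem three_mul_sq_le {α b c : ℝ} (hα : 0 < α) (hb : 1 / 2 < b) (hc : c ≠ 0)
    (h1 : α ^ 2 - c ^ 2 = b ^ 2 - 1) (h2 : 4 * (α ^ 2 * c ^ 2) = 4 * b ^ 2 - 1) :
    3 * (α - b) ^ 2 ≤ c ^ 2 := by
  have hc2 : 0 < c ^ 2 := by positivity
  have hb2 : 0 < b ^ 2 := by positivity
  have hX : 0 < α ^ 2 := by positivity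
  have hα2 : α ^ 2 = c ^ 2 + b ^ 2 - 1 := by linarith
  -- After elimination of α⁴ and α² c² by the two relations, the squared inequality `h4` is
  -- equivalent to this bound.
  have h3 : 2 * b ^ 2 * c ^ 2 ≤ 1 + 2 * b ^ 2 := by
    by_contra! hcon
    have h4 : 1 < c ^ 2 := by
      by_contra! h5
      nlinarith
    rw [hα2] at h2
    nlinarith [mul_pos hc2 (by linarith : 0 < c ^ 2 - 1)]
  have h4 : (2 * α ^ 2 + 4 * b ^ 2 - 1) ^ 2 ≤ (6 * α * b) ^ 2 := by
    have h5 : α ^ 2 * (2 * b ^ 2 * c ^ 2) ≤ α ^ 2 * (1 + 2 * b ^ 2) := by gcongr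
    have h6 : α ^ 2 * (2 * b ^ 2 * c ^ 2) = b ^ 2 * (4 * b ^ 2 - 1) / 2 := by
      rw [← h2]; ring
    have h7 : 4 * (α ^ 2) ^ 2 = 4 * b ^ 2 - 1 - 4 * α ^ 2 * (1 - b ^ 2) := by
      have : c ^ 2 = α ^ 2 + 1 - b ^ 2 := by linarith
      rw [this] at h2
      linear_combination h2
    nlinarith
  have h5 := abs_le_of_sq_le_sq h4 (by positivity)
  have := (abs_le.mp h5).2
  nlinarith

/-- Both roots satisfy the same two real equations, so their real and imaginary parts agree up to
sign. As they are neither equal nor conjugate, the real parts are opposite, which interchanges α + b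
and α - b and so the roles of the two components. -/
theorem Admissible.pattern_large (hP : P.Admissible) (hb : 1 / 2 < P.b) :
    PatternConsistsOf P 0 IsFourPetaledOrDark IsBright ∧
      PatternConsistsOf P 1 IsBright IsFourPetaledOrDark := by
  obtain ⟨e1, e2⟩ := hP.re_im_eq hb 0
  obtain ⟨f1, f2⟩ := hP.re_im_eq hb 1
  have hα := hP.label_large hb
  have hc₀ := hP.chi_im_ne_zero 0
  have hc₁ := hP.chi_im_ne_zero 1
  set α := (P.chi 0).re with hαdef
  set c := (P.chi 0).im with hcdef
  set α' := (P.chi 1).re with hα'def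
  set c' := (P.chi 1).im with hc'def
  have hc2 : 0 < c ^ 2 := by positivity
  have hc2' : 0 < c' ^ 2 := by positivity
  have hsq : α' ^ 2 = α ^ 2 := by
    have h1 : (α' ^ 2 - α ^ 2) * (α' ^ 2 + c ^ 2) = 0 := by
      have h2 : c ^ 2 = α ^ 2 + 1 - P.b ^ 2 := by linarith
      have h3 : c' ^ 2 = α' ^ 2 + 1 - P.b ^ 2 := by linarith
      rw [h2] at e2 ⊢
      rw [h3] at f2
      linear_combination (f2 - e2) / 4
    have h4 : α' ^ 2 + c ^ 2 ≠ 0 := by positivity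
    exact sub_eq_zero.mp ((mul_eq_zero.mp h1).resolve_right h4)
  have hcsq : c' ^ 2 = c ^ 2 := by linarith
  have hα' : α' = -α := by
    rcases sq_eq_sq_iff_eq_or_eq_neg.mp hsq with h | h
    · exfalso
      rcases sq_eq_sq_iff_eq_or_eq_neg.mp hcsq with h' | h'
      · exact hP.chi_ne (Complex.ext h h')
      · exact hP.chi_ne_conj (Complex.ext (by simpa using h) (by simpa using h'))
    · exact h
  have hbright := three_mul_sq_le hα hb hc₀ e1 e2
  -- With c² = α² + 1 - b² this is 2α² + 6αb + 4b² > 1, clear from b > 1/2.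
  have hdark : c ^ 2 < 3 * (α + P.b) ^ 2 := by
    have : c ^ 2 = α ^ 2 + 1 - P.b ^ 2 := by linarith
    rw [this]
    nlinarith [mul_pos hα hP.b_pos]
  have w0 : waveNumber P.b 0 = P.b := by simp [waveNumber]
  have w1 : waveNumber P.b 1 = -P.b := by simp [waveNumber]
  refine ⟨⟨hP.encard_roots, hP.splitsInto 0, isFourPetaledOrDark_of_shapeRatio hc₀ ?_,
    isBright_of_shapeRatio_le hc₁ ?_⟩, ⟨hP.encard_roots, hP.splitsInto 1,
    isBright_of_shapeRatio_le hc₀ ?_, isFourPetaledOrDark_of_shapeRatio hc₁ ?_⟩⟩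
  · rw [shapeRatio, w0, lt_div_iff₀ hc2]
    linarith
  · rw [shapeRatio, w0, div_le_iff₀ hc2', hcsq, ← hα'def, hα']
    linarith
  · rw [shapeRatio, w1, div_le_iff₀ hc2, ← hαdef]
    linarith
  · rw [shapeRatio, w1, lt_div_iff₀ hc2', hcsq, ← hα'def, hα']
    linarith

end Params

end

end CNLS

theorem corollary1 (P : CNLS.Params) (hP : P.Admissible) :
    (P.b < 1 / 2 →
      ∀ n : Fin 2, CNLS.PatternConsistsOf P n CNLS.IsBright CNLS.IsFourPetaled) ∧
    (1 / 2 < P.b →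
      CNLS.PatternConsistsOf P 0 CNLS.IsFourPetaledOrDark CNLS.IsBright ∧
      CNLS.PatternConsistsOf P 1 CNLS.IsBright CNLS.IsFourPetaledOrDark) :=
  ⟨hP.pattern_small, hP.pattern_large⟩
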